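/- Let $n\ge 3$ (for $n=3$, $D_3=A_3$) and let $\ell_1,\ell_2\ge 1$ be integers. Write $(t)_+=\max(t,0)$; empty sums are $0$. **The crystals.** For an integer $l\ge1$ let $B'_l$ be the set of $x=(x_1,\dots,x_n,\bar x_{n-1},\dots,\bar x_1)\in\mathbb Z^{2n-1}$ with $x_i,\bar x_i\ge 0$ for $1\le i\le n-1$, $x_n\ge-\min(x_{n-1},\bar x_{n-1})$ and $\ell(x):=\sum_{k=1}^n x_k+\sum_{k=1}^{n-1}\bar x_k=l$. It carries the following structure of the Kang–Kashiwara–Misra $D_n^{(1)}$-crystal: $$\varepsilon_0(x)=x_1+(x_2-\bar x_2)_+,\quad \varphi_0(x)=\bar x_1+(\bar x_2-x_2)_+,$$ $$\varepsilon_i(x)=\bar x_i+(x_{i+1}-\bar x_{i+1})_+,\quad \varphi_i(x)=x_i+(\bar x_{i+1}-x_{i+1})_+\quad(1\le i\le n-2),$$ $$\varepsilon_{n-1}(x)=x_n+\bar x_{n-1},\quad \varphi_{n-1}(x)=x_{n-1},\quad \varepsilon_n(x)=\bar x_{n-1},\quad \varphi_n(x)=x_{n-1}+x_n.$$ For $c\in\mathbb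 Z$ put $\xi_i=\max(x_i,\bar x_i+c)-\max(x_i,\bar x_i)$. The operator $\tilde e_i^c$ ($0\le i\le n$) changes only the following coordinates: - $i=0$: $x_1\mapsto x_1-\xi_2$, $x_2\mapsto x_2+\xi_2-c$, $\bar x_2\mapsto\bar x_2+\xi_2$, $\bar x_1\mapsto\bar x_1-\xi_2+c$; - $1\le i\le n-2$: $x_i\mapsto x_i-\xi_{i+1}+c$, $x_{i+1}\mapsto x_{i+1}+\xi_{i+1}-c$, $\bar x_{i+1}\mapsto\bar x_{i+1}+\xi_{i+1}$, $\bar x_i\mapsto\bar x_i-\xi_{i+1}$; - $i=n-1$: $x_{n-1}\mapsto x_{n-1}+c$, $x_n\mapsto x_n-c$; - $i=n$: $x_n\mapsto x_n+c$, $\bar x_{n-1}\mapsto\bar x_{n-1}-c$; and $\tilde e_i^c(x)$ is defined to be $0$ if the result is not in $B'_l$. On $B'_l\otimes B'_k$ (the set $B'_l\times B'_k$) put $\tilde e_i^c(x\otimes y)=\tilde e_i^{c_1}(x)\otimes\tilde e_i^{c_2}(y)$, which is $0$ if one of the factors is $0$, where $c_1=\max(c+\varphi_i(x),\varepsilon_i(y))-\max(\varphi_i(x),\varepsilon_i(y))$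 and $c_2=\max(\varphi_i(x),\varepsilon_i(y))-\max(\varphi_i(x),-c+\varepsilon_i(y))$. A *combinatorial $R$* is a bijection $R:B'_{\ell_1}\otimes B'_{\ell_2}\to B'_{\ell_2}\otimes B'_{\ell_1}$ which, extended by $R(0)=0$, satisfies $R\,\tilde e_i^c=\tilde e_i^c R$ for all $0\le i\le n$ and $c\in\mathbb Z$. **The piecewise linear map.** For $x,y\in\mathbb Z^{2n-1}$ (coordinates $x_i,\bar x_i$ and $y_i,\bar y_i$) let $$\theta_{i,j}=\begin{cases}\ell(x)+\sum_{k=j+1}^{i}(\bar y_k-\bar x_k)& j\le i\\ \ell(y)+\sum_{k=i+1}^{j}(\bar x_k-\bar y_k)& i<j\le n-2\end{cases}\qquad \theta'_{i,j}=\ell(x)+\sum_{k=1}^{i}(\bar y_k-\bar x_k)+\sum_{k=1}^{j}(y_k-x_k),$$ $$\eta_{i,j}=\begin{cases}\ell(x)+\sum_{k=j+1}^{i}(\bar y_k-\bar x_k)+(\bar y_j-x_j)& j\le i\\ \ell(y)+\sum_{k=i+1}^{j}(\bar x_k-\bar y_k)+(\bar y_j-x_j)& i<j\le n-1\\ \ell(y)+\sum_{k=i+1}^{n-1}(\bar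 x_k-\bar y_k)+x_n& j=n\end{cases}$$ $$\eta'_{i,j}=\begin{cases}\ell(x)+\sum_{k=1}^{i}(\bar y_k-\bar x_k)+\sum_{k=1}^{j}(y_k-x_k)+(x_j-\bar y_j)& j\le n-1\\ \ell(x)+\delta_{i,n-1}(\ell(x)-\ell(y))+\sum_{k=1}^{i}(\bar y_k-\bar x_k)+\sum_{k=1}^{n-1}(y_k-x_k)-x_n& j=n\end{cases}$$ and, for $0\le i\le n-1$, $$V_i=\max\bigl(\{\theta_{i,j},\theta'_{i,j}\mid 1\le j\le n-2\}\cup\{\eta_{i,j},\eta'_{i,j}\mid 1\le j\le n\}\bigr).$$ Let $V_0^{\sigma_1}$ be $V_0$ after exchanging $x_1\leftrightarrow\bar x_1$ and $y_1\leftrightarrow\bar y_1$, and let $V_i^*$ be $V_i$ after exchanging $x_k\leftrightarrow\bar y_k$, $\bar x_k\leftrightarrow y_k$ $(1\le k\le n-1)$ and $x_n\leftrightarrow y_n$. Put $W_1=V_0+V_0^{\sigma_1}$, $W_{n-1}=V_{n-1}+V_{n-1}^*$ and $$W_i=\max\bigl(V_i+V_{i-1}^*-y_i,\;V_{i-1}+V_i^*-\bar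 x_i\bigr)+\min(x_i,\bar y_i)\qquad(2\le i\le n-2).$$ Define $(x,y)\mapsto(x',y')$ by $$x_1'=y_1+V_0^{\sigma_1}-V_1,\quad \bar x_1'=\bar y_1+V_0-V_1,\quad y_1'=x_1+V_0-V_1^*,\quad \bar y_1'=\bar x_1+V_0^{\sigma_1}-V_1^*,$$ $$x_i'=y_i+V_{i-1}+W_i-V_i-W_{i-1},\qquad \bar x_i'=\bar y_i+V_{i-1}-V_i\qquad(2\le i\le n-1),$$ $$y_i'=x_i+V_{i-1}^*-V_i^*,\qquad \bar y_i'=\bar x_i+V_{i-1}^*+W_i-V_i^*-W_{i-1}\qquad(2\le i\le n-1),$$ $$x_n'=y_n+V_{n-1}-V_{n-1}^*,\qquad y_n'=x_n+V_{n-1}^*-V_{n-1}.$$ **Theorem.** The map $(x,y)\mapsto(x',y')$ sends $B'_{\ell_1}\otimes B'_{\ell_2}$ into $B'_{\ell_2}\otimes B'_{\ell_1}$, and its restriction $B'_{\ell_1}\otimes B'_{\ell_2}\to B'_{\ell_2}\otimes B'_{\ell_1}$ is the combinatorial $R$: it is a combinatorial $R$, and every combinatorial $R$ on $B'_{\ell_1}\otimes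 B'_{\ell_2}$ is equal to it. -/

import Mathlib

namespace DCrystal

/-- Integer arrays `(x₁, …, xₙ, x̄ₙ₋₁, …, x̄₁)`.  The field `u` stores `x₁, …, xₙ` and the field
`v` stores `x̄₁, …, x̄ₙ₋₁`; the accessors `x` and `xb` below use the usual indices, starting at 1. -/
@[ext] structure Vec (n : ℕ) where
  u : Fin n → ℤ
  v : Fin (n - 1) → ℤ

namespace Vec

variable {n : ℕ}

/-- The coordinate `x_i`, `1 ≤ i ≤ n`. -/
def x (b : Vec n) (i : ℕ) : ℤ := if h : 1 ≤ i ∧ i ≤ n then b.u ⟨i - 1, by omega⟩ else 0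

/-- The coordinate `x̄_i`, `1 ≤ i ≤ n - 1`. -/
def xb (b : Vec n) (i : ℕ) : ℤ := if h : 1 ≤ i ∧ i ≤ n - 1 then b.v ⟨i - 1, by omega⟩ else 0

/-- The array with `x_i = f i` for `1 ≤ i ≤ n` and `x̄_i = g i` for `1 ≤ i ≤ n - 1`. -/
def mk' (n : ℕ) (f g : ℕ → ℤ) : Vec n := ⟨fun k => f (k + 1), fun k => g (k + 1)⟩

theorem x_mk' (f g : ℕ → ℤ) {i : ℕ} (h1 : 1 ≤ i) (h2 : i ≤ n) : (mk' n f g).x i = f i := by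
  simp [x, mk', h1, h2]

theorem xb_mk' (f g : ℕ → ℤ) {i : ℕ} (h1 : 1 ≤ i) (h2 : i ≤ n - 1) :
    (mk' n f g).xb i = g i := by
  simp [xb, mk', h1, h2]

/-- `ℓ(x) = ∑_{k=1}^n x_k + ∑_{k=1}^{n-1} x̄_k`. -/
def level (b : Vec n) : ℤ := ∑ k ∈ Finset.Icc 1 n, b.x k + ∑ k ∈ Finset.Icc 1 (n - 1), b.xb k

/-- `ε_i(x)`, `0 ≤ i ≤ n`. -/
def eps (i : ℕ) (b : Vec n) : ℤ :=
  if i = 0 then b.x 1 + max (b.x 2 - b.xb 2) 0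
  else if i ≤ n - 2 then b.xb i + max (b.x (i + 1) - b.xb (i + 1)) 0
  else if i = n - 1 then b.x n + b.xb (n - 1)
  else b.xb (n - 1)

/-- `φ_i(x)`, `0 ≤ i ≤ n`. -/
def phi (i : ℕ) (b : Vec n) : ℤ :=
  if i = 0 then b.xb 1 + max (b.xb 2 - b.x 2) 0
  else if i ≤ n - 2 then b.x i + max (b.xb (i + 1) - b.x (i + 1)) 0
  else if i = n - 1 then b.x (n - 1)
  else b.x (n - 1) + b.x n

/-- `ξ_i = max(x_i, x̄_i + c) - max(x_i, x̄_i)`. -/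
def xi (c : ℤ) (b : Vec n) (i : ℕ) : ℤ := max (b.x i) (b.xb i + c) - max (b.x i) (b.xb i)

open Function in
/-- The array `ẽ_i^c(x)`, `0 ≤ i ≤ n`, before one asks whether it lies in the crystal. -/
def eRaw (i : ℕ) (c : ℤ) (b : Vec n) : Vec n :=
  if i = 0 then
    mk' n
      (update (update b.x 1 (b.x 1 - b.xi c 2)) 2 (b.x 2 + b.xi c 2 - c))
      (update (update b.xb 2 (b.xb 2 + b.xi c 2)) 1 (b.xb 1 - b.xi c 2 + c))
  else if i ≤ n - 2 then
    mk' n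
      (update (update b.x i (b.x i - b.xi c (i + 1) + c))
        (i + 1) (b.x (i + 1) + b.xi c (i + 1) - c))
      (update (update b.xb (i + 1) (b.xb (i + 1) + b.xi c (i + 1)))
        i (b.xb i - b.xi c (i + 1)))
  else if i = n - 1 then
    mk' n (update (update b.x (n - 1) (b.x (n - 1) + c)) n (b.x n - c)) b.xb
  else
    mk' n (update b.x n (b.x n + c)) (update b.xb (n - 1) (b.xb (n - 1) - c))

end Vec

/-- The set `B'_l`. -/
def KKM (n : ℕ) (l : ℕ) : Set (Vec n) :=
  {b | (∀ i, 1 ≤ i → i ≤ n - 1 → 0 ≤ b.x i ∧ 0 ≤ b.xb i) ∧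
    -min (b.x (n - 1)) (b.xb (n - 1)) ≤ b.x n ∧
    b.level = l}

open Classical in
/-- The operator `ẽ_i^c` on `B'_l` (that is `f̃_i^{-c}` when `c < 0`), with values in
`B'_l ⊔ {0}`; the value `none` is `0`. -/
noncomputable def e {n l : ℕ} (i : ℕ) (c : ℤ) (b : KKM n l) : Option (KKM n l) :=
  if h : b.1.eRaw i c ∈ KKM n l then some ⟨b.1.eRaw i c, h⟩ else none

/-- The operator `ẽ_i^c` on `B'_l ⊗ B'_k`:
`ẽ_i^c(x ⊗ y) = ẽ_i^{c₁}(x) ⊗ ẽ_i^{c₂}(y)`, which is `0` if one of the factors is `0`. -/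
noncomputable def eTensor {n l k : ℕ} (i : ℕ) (c : ℤ) (p : KKM n l × KKM n k) :
    Option (KKM n l × KKM n k) :=
  let f := p.1.1.phi i
  let g := p.2.1.eps i
  let c₁ := max (c + f) g - max f g
  let c₂ := max f g - max f (-c + g)
  (e i c₁ p.1).bind fun x' => (e i c₂ p.2).map fun y' => (x', y')

/-- `R : B'_l ⊗ B'_k → B'_k ⊗ B'_l` is a combinatorial `R`: a bijection that commutes with all
`ẽ_i^c`, `0 ≤ i ≤ n`, `c ∈ ℤ`, where `R` sends `0` to `0`. -/
def IsCombinatorialR {n l k : ℕ} (R : KKM n l × KKM n k → KKM n k × KKM n l) : Prop :=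
  Function.Bijective R ∧
    ∀ i ≤ n, ∀ (c : ℤ) (p : KKM n l × KKM n k), eTensor i c (R p) = (eTensor i c p).map R

section PiecewiseLinear

variable {n : ℕ}

/-- `(x, y)^{σ₁}`: exchange `x₁ ↔ x̄₁` and `y₁ ↔ ȳ₁`. -/
def sigmaOne (p : Vec n × Vec n) : Vec n × Vec n :=
  let s : Vec n → Vec n := fun b =>
    Vec.mk' n (Function.update b.x 1 (b.xb 1)) (Function.update b.xb 1 (b.x 1))
  (s p.1, s p.2)

/-- `(x, y)^*`: exchange `x_i ↔ ȳ_i`, `x̄_i ↔ y_i` for `1 ≤ i ≤ n - 1`, and `x_n ↔ y_n`. -/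
def star (p : Vec n × Vec n) : Vec n × Vec n :=
  (Vec.mk' n (Function.update p.2.xb n (p.2.x n)) p.2.x,
   Vec.mk' n (Function.update p.1.xb n (p.1.x n)) p.1.x)

/-- `θ_{i,j}(x, y)`, `1 ≤ j ≤ n - 2`. -/
def theta (i j : ℕ) (p : Vec n × Vec n) : ℤ :=
  if j ≤ i then p.1.level + ∑ k ∈ Finset.Icc (j + 1) i, (p.2.xb k - p.1.xb k)
  else p.2.level + ∑ k ∈ Finset.Icc (i + 1) j, (p.1.xb k - p.2.xb k)

/-- `θ'_{i,j}(x, y)`, `1 ≤ j ≤ n - 2`. -/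
def theta' (i j : ℕ) (p : Vec n × Vec n) : ℤ :=
  p.1.level + ∑ k ∈ Finset.Icc 1 i, (p.2.xb k - p.1.xb k)
    + ∑ k ∈ Finset.Icc 1 j, (p.2.x k - p.1.x k)

/-- `η_{i,j}(x, y)`, `1 ≤ j ≤ n`. -/
def eta (i j : ℕ) (p : Vec n × Vec n) : ℤ :=
  if j ≤ i then
    p.1.level + ∑ k ∈ Finset.Icc (j + 1) i, (p.2.xb k - p.1.xb k) + (p.2.xb j - p.1.x j)
  else if j ≤ n - 1 then
    p.2.level + ∑ k ∈ Finset.Icc (i + 1) j, (p.1.xb k - p.2.xb k) + (p.2.xb j - p.1.x j)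
  else
    p.2.level + ∑ k ∈ Finset.Icc (i + 1) (n - 1), (p.1.xb k - p.2.xb k) + p.1.x n

/-- `η'_{i,j}(x, y)`, `1 ≤ j ≤ n`. -/
def eta' (i j : ℕ) (p : Vec n × Vec n) : ℤ :=
  if j ≤ n - 1 then
    p.1.level + ∑ k ∈ Finset.Icc 1 i, (p.2.xb k - p.1.xb k)
      + ∑ k ∈ Finset.Icc 1 j, (p.2.x k - p.1.x k) + (p.1.x j - p.2.xb j)
  else
    p.1.level + (if i = n - 1 then p.1.level - p.2.level else 0)
      + ∑ k ∈ Finset.Icc 1 i, (p.2.xb k - p.1.xb k)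
      + ∑ k ∈ Finset.Icc 1 (n - 1), (p.2.x k - p.1.x k) - p.1.x n

/-- The finite set of integers whose maximum is `V_i(x, y)`. -/
def VSet (i : ℕ) (p : Vec n × Vec n) : Finset ℤ :=
  ((Finset.Icc 1 (n - 2)).image fun j => theta i j p) ∪
  ((Finset.Icc 1 (n - 2)).image fun j => theta' i j p) ∪
  ((Finset.Icc 1 n).image fun j => eta i j p) ∪
  ((Finset.Icc 1 n).image fun j => eta' i j p)

/-- `V_i(x, y)`, `0 ≤ i ≤ n - 1`.  (The set is nonempty as soon as `1 ≤ n`.) -/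
def V (i : ℕ) (p : Vec n × Vec n) : ℤ :=
  if h : (VSet i p).Nonempty then (VSet i p).max' h else 0

/-- `V_i^*(x, y) = V_i((x, y)^*)`. -/
def Vstar (i : ℕ) (p : Vec n × Vec n) : ℤ := V i (star p)

/-- `V_0^{σ₁}(x, y) = V_0((x, y)^{σ₁})`. -/
def VzeroSigma (p : Vec n × Vec n) : ℤ := V 0 (sigmaOne p)

/-- `W_i(x, y)`, `1 ≤ i ≤ n - 1`. -/
def W (i : ℕ) (p : Vec n × Vec n) : ℤ :=
  if i = 1 then V 0 p + VzeroSigma p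
  else if i = n - 1 then V (n - 1) p + Vstar (n - 1) p
  else max (V i p + Vstar (i - 1) p - p.2.x i) (V (i - 1) p + Vstar i p - p.1.xb i)
    + min (p.1.x i) (p.2.xb i)

/-- The piecewise linear map `(x, y) ↦ (x', y')` (the ultradiscretized tropical `R`). -/
def piecewiseR (p : Vec n × Vec n) : Vec n × Vec n :=
  let x := p.1.x
  let xb := p.1.xb
  let y := p.2.x
  let yb := p.2.xb
  (Vec.mk' n
    (fun i =>
      if i = 1 then y 1 + VzeroSigma p - V 1 p
      else if i ≤ n - 1 then y i + V (i - 1) p + W i p - V i p - W (i - 1) p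
      else y n + V (n - 1) p - Vstar (n - 1) p)
    (fun i =>
      if i = 1 then yb 1 + V 0 p - V 1 p
      else yb i + V (i - 1) p - V i p),
   Vec.mk' n
    (fun i =>
      if i = 1 then x 1 + V 0 p - Vstar 1 p
      else if i ≤ n - 1 then x i + Vstar (i - 1) p - Vstar i p
      else x n + Vstar (n - 1) p - V (n - 1) p)
    (fun i =>
      if i = 1 then xb 1 + VzeroSigma p - Vstar 1 p
      else xb i + Vstar (i - 1) p + W i p - Vstar i p - W (i - 1) p))

end PiecewiseLinear

end DCrystal

/-! The map is the ultradiscretization of a birational map. Replace sums by products and maxima by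
sums: the `V_i` become sums of Laurent monomials, the `W_i` become subtraction-free, and the
formulas define a map `RPair.R` on pairs of positive real arrays, on which geometric crystal
operators `RPair.eT` act. Along curves whose coordinates grow like powers of `t`, a subtraction-free
expression grows like `t` to the value of the corresponding piecewise linear one (`Tr`). An identity
between rational expressions therefore gives an identity between piecewise linear ones, and it
suffices that the rational `R` commutes with `e_i^c` and preserves `ε_i` and `φ_i` of the pair
(`RPair.R_eT`, `RPair.eps_R`, `RPair.phi_R`).

For the rational identities let `A` be the difference of the two levels. The `V_i` satisfy a linear
first-order recursion with inhomogeneous term proportional to `A`, the `V_i^*` satisfy the mirrored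
one with `-A`, the values at `0` agree, and one relation links the values at `n - 1`. If `A ≠ 0`,
this system has only one solution (`IsTau.unique`). The effect of an operation on the `V_i` is thus
found by writing down a candidate and checking the system: `e_i^c` with `1 ≤ i ≤ n - 2` changes only
`V_i` and `V_i^*`, and `e_{n-1}^c` changes only `V_{n-1}^*`. As the `W_i` are expressed through the
`V_i` and `V_i^*`, commutation with `R` becomes an identity in a few neighbouring coordinates
(`LocalData`, `LocalPred`). The symmetry `σ₁` reduces node `0` to node `1`, and `*` reduces node `n`
to node `n - 1`. The condition `A ≠ 0` costs nothing, since the lifted curves may carry an extra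
constant factor.

The rest is combinatorial. The crystal `B'_l ⊗ B'_k` is connected (`reach_line`), and at the element
where both factors have all their weight in `x_1` the map is the swap (`piecewiseR_line`). Along
paths this shows that the map lands in `B'_k ⊗ B'_l` and that it is inverse to the map with `l` and
`k` exchanged. Any combinatorial `R` preserves `ε_i` and `φ_i`, which forces its value at that
element; by connectedness it agrees with the piecewise linear map everywhere. -/

namespace DCrystal

open Finset (Icc)

/-! ### The rational lift of the crystals and of the map. -/

/-- Arrays `(x₁, …, xₙ, x̄ₙ₋₁, …, x̄₁)` of real numbers, indexed by all natural numbers. -/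
@[ext] structure RVec where
  x : ℕ → ℝ
  xb : ℕ → ℝ

namespace RVec

/-- All coordinates are positive. -/
structure Pos (b : RVec) : Prop where
  x : ∀ k, 0 < b.x k
  xb : ∀ k, 0 < b.xb k

/-- The product of all coordinates. -/
noncomputable def level (n : ℕ) (b : RVec) : ℝ :=
  (∏ k ∈ Icc 1 n, b.x k) * ∏ k ∈ Icc 1 (n - 1), b.xb k

/-- The rational lift of `ε_i`. -/
noncomputable def eps (n i : ℕ) (b : RVec) : ℝ :=
  if i = 0 then b.x 1 * (1 + b.x 2 / b.xb 2)
  else if i ≤ n - 2 then b.xb i * (1 + b.x (i + 1) / b.xb (i + 1))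
  else if i = n - 1 then b.x n * b.xb (n - 1)
  else b.xb (n - 1)

/-- The rational lift of `φ_i`. -/
noncomputable def phi (n i : ℕ) (b : RVec) : ℝ :=
  if i = 0 then b.xb 1 * (1 + b.xb 2 / b.x 2)
  else if i ≤ n - 2 then b.x i * (1 + b.xb (i + 1) / b.x (i + 1))
  else if i = n - 1 then b.x (n - 1)
  else b.x (n - 1) * b.x n

/-- The rational lift of `ξ_i`. -/
noncomputable def xi (c : ℝ) (b : RVec) (i : ℕ) : ℝ :=
  (b.x i + c * b.xb i) / (b.x i + b.xb i)

open Function in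
/-- The geometric crystal operator `e_i^c`. -/
noncomputable def eRaw (n i : ℕ) (c : ℝ) (b : RVec) : RVec :=
  if i = 0 then
    ⟨update (update b.x 1 (b.x 1 / b.xi c 2)) 2 (b.x 2 * b.xi c 2 / c),
      update (update b.xb 2 (b.xb 2 * b.xi c 2)) 1 (b.xb 1 / b.xi c 2 * c)⟩
  else if i ≤ n - 2 then
    ⟨update (update b.x i (b.x i / b.xi c (i + 1) * c))
        (i + 1) (b.x (i + 1) * b.xi c (i + 1) / c),
      update (update b.xb (i + 1) (b.xb (i + 1) * b.xi c (i + 1)))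
        i (b.xb i / b.xi c (i + 1))⟩
  else if i = n - 1 then
    ⟨update (update b.x (n - 1) (b.x (n - 1) * c)) n (b.x n / c), b.xb⟩
  else
    ⟨update b.x n (b.x n * c), update b.xb (n - 1) (b.xb (n - 1) / c)⟩

/-- Exchange of the first coordinate and its barred partner. -/
noncomputable def sigma (b : RVec) : RVec :=
  ⟨Function.update b.x 1 (b.xb 1), Function.update b.xb 1 (b.x 1)⟩

end RVec

/-- Pairs of real arrays. -/
abbrev RPair := RVec × RVec

namespace RPair

/-- All coordinates are positive. -/
def Pos (p : RPair) : Prop := p.1.Pos ∧ p.2.Pos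

/-- The difference of the levels. -/
noncomputable def gap (n : ℕ) (p : RPair) : ℝ := p.1.level n - p.2.level n

/-- The rational lift of `σ₁`. -/
noncomputable def sigma (p : RPair) : RPair := (p.1.sigma, p.2.sigma)

/-- The rational lift of `*`. -/
noncomputable def star (n : ℕ) (p : RPair) : RPair :=
  -- Indices from `n` on are exchanged without a bar, so that this is an involution on all arrays,
  -- also outside the meaningful range.
  (⟨fun k => if k < n then p.2.xb k else p.2.x k, fun k => if k < n then p.2.x k else p.2.xb k⟩,
   ⟨fun k => if k < n then p.1.xb k else p.1.x k, fun k => if k < n then p.1.x k else p.1.xb k⟩)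

/-- The parameter of `e_i^c` on the first factor. -/
noncomputable def cfst (n i : ℕ) (c : ℝ) (p : RPair) : ℝ :=
  (c * p.1.phi n i + p.2.eps n i) / (p.1.phi n i + p.2.eps n i)

/-- The parameter of `e_i^c` on the second factor. -/
noncomputable def csnd (n i : ℕ) (c : ℝ) (p : RPair) : ℝ :=
  (p.1.phi n i + p.2.eps n i) / (p.1.phi n i + p.2.eps n i / c)

/-- The geometric crystal operator on pairs. -/
noncomputable def eT (n i : ℕ) (c : ℝ) (p : RPair) : RPair :=
  (p.1.eRaw n i (cfst n i c p), p.2.eRaw n i (csnd n i c p))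

/-- The rational lift of `ε_i` of a tensor product. -/
noncomputable def eps (n i : ℕ) (p : RPair) : ℝ := p.1.eps n i * (1 + p.2.eps n i / p.1.phi n i)

/-- The rational lift of `φ_i` of a tensor product. -/
noncomputable def phi (n i : ℕ) (p : RPair) : ℝ := p.2.phi n i * (1 + p.1.phi n i / p.2.eps n i)

/-- The rational lift of `θ_{i,j}`. -/
noncomputable def theta (n i j : ℕ) (p : RPair) : ℝ :=
  if j ≤ i then p.1.level n * ∏ k ∈ Icc (j + 1) i, (p.2.xb k / p.1.xb k)
  else p.2.level n * ∏ k ∈ Icc (i + 1) j, (p.1.xb k / p.2.xb k)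

/-- The rational lift of `θ'_{i,j}`. -/
noncomputable def theta' (n i j : ℕ) (p : RPair) : ℝ :=
  p.1.level n * (∏ k ∈ Icc 1 i, (p.2.xb k / p.1.xb k)) * ∏ k ∈ Icc 1 j, (p.2.x k / p.1.x k)

/-- The rational lift of `η_{i,j}`. -/
noncomputable def eta (n i j : ℕ) (p : RPair) : ℝ :=
  if j ≤ i then
    p.1.level n * (∏ k ∈ Icc (j + 1) i, (p.2.xb k / p.1.xb k)) * (p.2.xb j / p.1.x j)
  else if j ≤ n - 1 then
    p.2.level n * (∏ k ∈ Icc (i + 1) j, (p.1.xb k / p.2.xb k)) * (p.2.xb j / p.1.x j)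
  else
    p.2.level n * (∏ k ∈ Icc (i + 1) (n - 1), (p.1.xb k / p.2.xb k)) * p.1.x n

/-- The rational lift of `η'_{i,j}`. -/
noncomputable def eta' (n i j : ℕ) (p : RPair) : ℝ :=
  if j ≤ n - 1 then
    p.1.level n * (∏ k ∈ Icc 1 i, (p.2.xb k / p.1.xb k))
      * (∏ k ∈ Icc 1 j, (p.2.x k / p.1.x k)) * (p.1.x j / p.2.xb j)
  else
    p.1.level n * (if i = n - 1 then p.1.level n / p.2.level n else 1)
      * (∏ k ∈ Icc 1 i, (p.2.xb k / p.1.xb k))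
      * (∏ k ∈ Icc 1 (n - 1), (p.2.x k / p.1.x k)) / p.1.x n

/-- The rational lift of `V_i`. -/
noncomputable def V (n i : ℕ) (p : RPair) : ℝ :=
  ∑ j ∈ Icc 1 (n - 2), theta n i j p + ∑ j ∈ Icc 1 (n - 2), theta' n i j p
    + ∑ j ∈ Icc 1 n, eta n i j p + ∑ j ∈ Icc 1 n, eta' n i j p

/-- The rational lift of `V_i^*`. -/
noncomputable def Vstar (n i : ℕ) (p : RPair) : ℝ := V n i (star n p)

/-- The rational lift of `W_i`, with `W_0 = V_0²`. -/
noncomputable def W (n i : ℕ) (p : RPair) : ℝ :=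
  if i = 0 then V n 0 p * V n 0 p
  else if i = 1 then V n 0 p * V n 0 (sigma p)
  else if i = n - 1 then V n (n - 1) p * Vstar n (n - 1) p
  else (V n i p * Vstar n (i - 1) p / p.2.x i + V n (i - 1) p * Vstar n i p / p.1.xb i)
    / (1 / p.1.x i + 1 / p.2.xb i)

/-- The tropical `R`. -/
noncomputable def R (n : ℕ) (p : RPair) : RPair :=
  (⟨fun i =>
      if i = 1 then p.2.x 1 * V n 0 (sigma p) / V n 1 p
      else if i ≤ n - 1 then p.2.x i * V n (i - 1) p * W n i p / (V n i p * W n (i - 1) p)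
      -- The value `1` outside the index range keeps every coordinate positive, as `Pos` demands for
      -- all indices.
      else if i = n then p.2.x n * V n (n - 1) p / Vstar n (n - 1) p else 1,
    fun i =>
      if i = 1 then p.2.xb 1 * V n 0 p / V n 1 p
      else if i ≤ n - 1 then p.2.xb i * V n (i - 1) p / V n i p else 1⟩,
   ⟨fun i =>
      if i = 1 then p.1.x 1 * V n 0 p / Vstar n 1 p
      else if i ≤ n - 1 then p.1.x i * Vstar n (i - 1) p / Vstar n i p
      else if i = n then p.1.x n * Vstar n (n - 1) p / V n (n - 1) p else 1,
    fun i =>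
      if i = 1 then p.1.xb 1 * V n 0 (sigma p) / Vstar n 1 p
      else if i ≤ n - 1 then
        p.1.xb i * Vstar n (i - 1) p * W n i p / (Vstar n i p * W n (i - 1) p)
      else 1⟩)

variable {n : ℕ} {p : RPair}

theorem star_star (n : ℕ) (p : RPair) : star n (star n p) = p := by
  ext k <;> by_cases h : k < n <;> simp [star, h]

theorem sigma_sigma (p : RPair) : sigma (sigma p) = p := by
  ext k <;> by_cases h : k = 1 <;> simp [sigma, RVec.sigma, h]

theorem star_sigma (hn : 2 ≤ n) (p : RPair) : star n (sigma p) = sigma (star n p) := by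
  have h0 : 1 < n := by omega
  ext k <;> by_cases h : k < n <;> by_cases h1 : k = 1 <;>
    simp_all [star, sigma, RVec.sigma]

theorem star_fst_x {k : ℕ} (h : k < n) (p : RPair) : (star n p).1.x k = p.2.xb k := if_pos h
theorem star_fst_xb {k : ℕ} (h : k < n) (p : RPair) : (star n p).1.xb k = p.2.x k := if_pos h
theorem star_snd_x {k : ℕ} (h : k < n) (p : RPair) : (star n p).2.x k = p.1.xb k := if_pos h
theorem star_snd_xb {k : ℕ} (h : k < n) (p : RPair) : (star n p).2.xb k = p.1.x k := if_pos h
theorem star_fst_x_self (n : ℕ) (p : RPair) : (star n p).1.x n = p.2.x n := if_neg (lt_irrefl n)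
theorem star_snd_x_self (n : ℕ) (p : RPair) : (star n p).2.x n = p.1.x n := if_neg (lt_irrefl n)

theorem Pos.star (hp : p.Pos) : (star n p).Pos := by
  obtain ⟨⟨h1, h2⟩, ⟨h3, h4⟩⟩ := hp
  refine ⟨⟨fun k => ?_, fun k => ?_⟩, ⟨fun k => ?_, fun k => ?_⟩⟩ <;>
    simp only [RPair.star] <;> split_ifs <;> simp [*]

theorem Pos.sigma (hp : p.Pos) : (sigma p).Pos := by
  obtain ⟨⟨h1, h2⟩, ⟨h3, h4⟩⟩ := hp
  refine ⟨⟨fun k => ?_, fun k => ?_⟩, ⟨fun k => ?_, fun k => ?_⟩⟩ <;>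
    simp only [RPair.sigma, RVec.sigma, Function.update_apply] <;> split_ifs <;> simp [*]

theorem _root_.DCrystal.RVec.Pos.level {b : RVec} (hb : b.Pos) (n : ℕ) : 0 < b.level n :=
  mul_pos (Finset.prod_pos fun k _ => hb.x k) (Finset.prod_pos fun k _ => hb.xb k)

theorem star_fst_level (hn : 1 ≤ n) (p : RPair) : (star n p).1.level n = p.2.level n := by
  obtain ⟨m, rfl⟩ : ∃ m, n = m + 1 := ⟨n - 1, by omega⟩
  simp only [RVec.level, Finset.prod_Icc_succ_top (Nat.le_add_left 1 m), Nat.add_sub_cancel]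
  rw [Finset.prod_congr (g := p.2.xb) rfl, Finset.prod_congr (s₁ := Icc 1 m)
    (f := (star (m + 1) p).1.xb) (g := p.2.x) rfl, star_fst_x_self]
  · ring
  · intro k hk
    exact star_fst_xb (by have := Finset.mem_Icc.1 hk; omega) p
  · intro k hk
    exact star_fst_x (by have := Finset.mem_Icc.1 hk; omega) p

theorem star_snd_level (hn : 1 ≤ n) (p : RPair) : (star n p).2.level n = p.1.level n := by
  rw [← star_fst_level hn, star_star]

theorem gap_star (hn : 1 ≤ n) (p : RPair) : gap n (star n p) = -gap n p := by
  simp [gap, star_fst_level hn, star_snd_level hn]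

theorem V_pos (hn : 3 ≤ n) (hp : p.Pos) (i : ℕ) : 0 < V n i p := by
  have h1 := hp.1.level n
  have h2 := hp.2.level n
  have q1 (s : Finset ℕ) : 0 < ∏ k ∈ s, (p.2.xb k / p.1.xb k) :=
    Finset.prod_pos fun k _ => div_pos (hp.2.xb k) (hp.1.xb k)
  have q2 (s : Finset ℕ) : 0 < ∏ k ∈ s, (p.1.xb k / p.2.xb k) :=
    Finset.prod_pos fun k _ => div_pos (hp.1.xb k) (hp.2.xb k)
  have q3 (s : Finset ℕ) : 0 < ∏ k ∈ s, (p.2.x k / p.1.x k) :=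
    Finset.prod_pos fun k _ => div_pos (hp.2.x k) (hp.1.x k)
  have a1 := hp.1.x
  have a2 := hp.2.xb
  have ne : (Icc 1 (n - 2)).Nonempty := ⟨1, by simp; omega⟩
  have ne' : (Icc 1 n).Nonempty := ⟨1, by simp; omega⟩
  refine add_pos (add_pos (add_pos ?_ ?_) ?_) ?_ <;> refine Finset.sum_pos (fun j _ => ?_) ‹_›
  · unfold theta; split_ifs
    · exact mul_pos h1 (q1 _)
    · exact mul_pos h2 (q2 _)
  · exact mul_pos (mul_pos h1 (q1 _)) (q3 _)
  · unfold eta; split_ifs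
    · exact mul_pos (mul_pos h1 (q1 _)) (div_pos (a2 _) (a1 _))
    · exact mul_pos (mul_pos h2 (q2 _)) (div_pos (a2 _) (a1 _))
    · exact mul_pos (mul_pos h2 (q2 _)) (a1 _)
  · unfold eta'; split_ifs
    · exact mul_pos (mul_pos (mul_pos h1 (q1 _)) (q3 _)) (div_pos (a1 _) (a2 _))
    · exact div_pos (mul_pos (mul_pos (mul_pos h1 (div_pos h1 h2)) (q1 _)) (q3 _)) (a1 _)
    · exact div_pos (mul_pos (mul_pos (mul_pos h1 one_pos) (q1 _)) (q3 _)) (a1 _)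

/-- All coordinates of `y` divided by all coordinates of `x` multiply to the quotient of the levels.
This converts one level into the other when terms of `V_i` and `V_i^*` are compared. -/
theorem prod_ratio_eq (hn : 1 ≤ n) (hp : p.Pos) :
    p.1.level n * (∏ k ∈ Icc 1 (n - 1), (p.2.xb k / p.1.xb k))
      * (∏ k ∈ Icc 1 (n - 1), (p.2.x k / p.1.x k)) * (p.2.x n / p.1.x n) = p.2.level n := by
  obtain ⟨m, rfl⟩ : ∃ m, n = m + 1 := ⟨n - 1, by omega⟩
  have a1 : ∏ k ∈ Icc 1 m, p.1.x k ≠ 0 := Finset.prod_ne_zero_iff.2 fun k _ => (hp.1.x k).ne'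
  have a2 : ∏ k ∈ Icc 1 m, p.1.xb k ≠ 0 := Finset.prod_ne_zero_iff.2 fun k _ => (hp.1.xb k).ne'
  have a3 := (hp.1.x (m + 1)).ne'
  simp only [RVec.level, Finset.prod_Icc_succ_top (Nat.le_add_left 1 m), Nat.add_sub_cancel,
    Finset.prod_div_distrib]
  field_simp

/-! ### The linear system that characterises `V_i` and `V_i^*`. -/

/-- The constant term in the recursion for `V_i`. -/
noncomputable def dterm (n i : ℕ) (p : RPair) : ℝ := if i = n - 1 then 1 / p.2.x n else 1

/-- The recursion that `i ↦ V_i` satisfies. -/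
def IsRec (n : ℕ) (p : RPair) (v : ℕ → ℝ) : Prop :=
  ∀ i, 1 ≤ i → i ≤ n - 1 →
    v i = p.2.xb i / p.1.xb i * v (i - 1) + gap n p * (p.2.xb i / p.1.x i + dterm n i p)

theorem sum_eq_of_single {s : Finset ℕ} {f g : ℕ → ℝ} {r A : ℝ} {i : ℕ}
    (hi : i ∈ s) (h : ∀ j ∈ s, f j = r * g j + if j = i then A else 0) :
    ∑ j ∈ s, f j = r * ∑ j ∈ s, g j + A := by
  rw [Finset.sum_congr rfl h, Finset.sum_add_distrib, Finset.mul_sum, Finset.sum_ite_eq' s i,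
    if_pos hi]

theorem sum_eq_of_none {s : Finset ℕ} {f g : ℕ → ℝ} {r : ℝ}
    (h : ∀ j ∈ s, f j = r * g j) :
    ∑ j ∈ s, f j = r * ∑ j ∈ s, g j := by
  rw [Finset.sum_congr rfl h, Finset.mul_sum]

theorem prod_Icc_left {f : ℕ → ℝ} {a b : ℕ} (h : a ≤ b) :
    ∏ k ∈ Icc a b, f k = f a * ∏ k ∈ Icc (a + 1) b, f k := by
  rw [Finset.Icc_eq_cons_Ioc h, Finset.prod_cons, Finset.Icc_add_one_left_eq_Ioc]

/-- Only the term `j = i + 1` changes branch when `i` grows by one: it passes from the level of `y`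
to the level of `x`, which produces the gap. All other terms acquire the common factor. -/
theorem theta_rec (hp : p.Pos) (i j : ℕ) :
    theta n (i + 1) j p = p.2.xb (i + 1) / p.1.xb (i + 1) * theta n i j p
      + if j = i + 1 then gap n p else 0 := by
  have h1 := (hp.1.xb (i + 1)).ne'
  have h2 := (hp.2.xb (i + 1)).ne'
  unfold theta gap
  rcases lt_trichotomy j (i + 1) with h | h | h
  · rw [if_pos h.le, if_pos (by omega), if_neg h.ne, Finset.prod_Icc_succ_top (by omega)]
    ring
  · subst h
    simp
    field_simp
    ring
  · rw [if_neg (by omega), if_neg (by omega), if_neg h.ne', prod_Icc_left (a := i + 1) (by omega)]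
    field_simp
    ring

theorem theta'_rec (i j : ℕ) :
    theta' n (i + 1) j p = p.2.xb (i + 1) / p.1.xb (i + 1) * theta' n i j p := by
  unfold theta'
  rw [Finset.prod_Icc_succ_top (by omega)]
  ring

theorem eta_rec (hp : p.Pos) (i j : ℕ) (hi : i + 1 ≤ n - 1) :
    eta n (i + 1) j p = p.2.xb (i + 1) / p.1.xb (i + 1) * eta n i j p
      + if j = i + 1 then gap n p * (p.2.xb (i + 1) / p.1.x (i + 1)) else 0 := by
  have h1 := (hp.1.xb (i + 1)).ne'
  have h2 := (hp.2.xb (i + 1)).ne'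
  have h3 := (hp.1.x (i + 1)).ne'
  unfold eta gap
  rcases lt_trichotomy j (i + 1) with h | h | h
  · rw [if_pos h.le, if_pos (by omega), if_neg h.ne, Finset.prod_Icc_succ_top (by omega)]
    ring
  · subst h
    simp [hi]
    field_simp
    ring
  · rw [if_neg (by omega), if_neg (by omega : ¬ j ≤ i), if_neg h.ne']
    split_ifs with h5
    · rw [prod_Icc_left (a := i + 1) (by omega)]
      field_simp
      ring
    · rw [prod_Icc_left (a := i + 1) (by omega)]
      field_simp
      ring

/-- The jump is caused by the extra factor `ℓ(x)/ℓ(y)` in `η'_{n-1,n}`. By `prod_ratio_eq` this term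
is `ℓ(x)/y_n`, whereas without the extra factor it would be `ℓ(y)/y_n`. -/
theorem eta'_rec (hn : 1 ≤ n) (hp : p.Pos) (i j : ℕ) (hi : i + 1 ≤ n - 1) (hj : j ≤ n) :
    eta' n (i + 1) j p = p.2.xb (i + 1) / p.1.xb (i + 1) * eta' n i j p
      + if j = n then (if i + 1 = n - 1 then gap n p / p.2.x n else 0) else 0 := by
  unfold eta'
  rcases hj.lt_or_eq with h | h
  · rw [if_pos (show j ≤ n - 1 by omega), if_pos (show j ≤ n - 1 by omega), if_neg h.ne,
      Finset.prod_Icc_succ_top (by omega)]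
    ring
  · subst h
    have h8 : ¬ j ≤ j - 1 := by omega
    rw [if_neg h8, if_neg h8, if_pos rfl, if_neg (by omega : i ≠ j - 1),
      Finset.prod_Icc_succ_top (by omega)]
    split_ifs with h5
    · have := prod_ratio_eq hn hp
      have hs : ∏ k ∈ Icc 1 (j - 1), (p.2.xb k / p.1.xb k)
          = (∏ k ∈ Icc 1 i, (p.2.xb k / p.1.xb k)) * (p.2.xb (i + 1) / p.1.xb (i + 1)) := by
        rw [← h5, Finset.prod_Icc_succ_top (by omega)]
      rw [hs] at this
      have h1 := (hp.1.xb (i + 1)).ne'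
      have h2 := (hp.2.x j).ne'
      have h3 := (hp.1.x j).ne'
      have h4 := (hp.2.level j).ne'
      have h6 := (hp.1.level j).ne'
      unfold gap
      generalize p.2.level j = ly at *
      generalize p.1.level j = lx at *
      field_simp at this ⊢
      linear_combination (lx - ly) * this
    · ring

/-- The jumps of the single terms add up. Since `θ_{i,j}` only has `j ≤ n - 2`, its jump is missing
at `i = n - 1`, and the jump of `η'_{i,n}` takes its place; hence the two values of `dterm`. -/
theorem isRec_V (hn : 3 ≤ n) (hp : p.Pos) : IsRec n p (fun i => V n i p) := by
  intro i hi1 hi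
  obtain ⟨i, rfl⟩ : ∃ k, i = k + 1 := ⟨i - 1, by omega⟩
  have e2 : ∑ j ∈ Icc 1 (n - 2), theta' n (i + 1) j p = _ :=
    sum_eq_of_none fun j _ => theta'_rec i j
  have e3 : ∑ j ∈ Icc 1 n, eta n (i + 1) j p = _ :=
    sum_eq_of_single (i := i + 1) (by simp; omega) fun j _ => eta_rec hp i j hi
  have e4 : ∑ j ∈ Icc 1 n, eta' n (i + 1) j p = _ :=
    sum_eq_of_single (i := n) (by simp; omega)
      fun j hj => eta'_rec (by omega) hp i j hi (Finset.mem_Icc.1 hj).2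
  simp only [V, Nat.add_sub_cancel, dterm]
  by_cases h : i + 1 = n - 1
  · have e1 : ∑ j ∈ Icc 1 (n - 2), theta n (i + 1) j p = _ :=
      sum_eq_of_none (r := p.2.xb (i + 1) / p.1.xb (i + 1)) (g := fun j => theta n i j p)
        fun j hj => by
          have := (Finset.mem_Icc.1 hj).2
          rw [theta_rec hp i j, if_neg (by omega), add_zero]
    rw [e1, e2, e3, e4, if_pos h, if_pos h]
    ring
  · have e1 : ∑ j ∈ Icc 1 (n - 2), theta n (i + 1) j p = _ :=
      sum_eq_of_single (i := i + 1) (by simp; omega) fun j _ => theta_rec hp i j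
    rw [e1, e2, e3, e4, if_neg h, if_neg h]
    ring

/-- The system that determines `i ↦ V_i` and `i ↦ V_i^*`. -/
structure IsTau (n : ℕ) (p : RPair) (v vs : ℕ → ℝ) : Prop where
  fst : IsRec n p v
  snd : IsRec n (star n p) vs
  zero : v 0 = vs 0
  top : p.1.x n * vs (n - 1) - p.2.x n * v (n - 1) = gap n p * (p.1.x n * p.2.x n - 1)

/-- The difference of two solutions satisfies homogeneous recursions, so it is a multiple of its
value at `0`. The top relation then annihilates this value up to a factor that vanishes only if the
levels agree. -/
theorem IsTau.unique (hn : 3 ≤ n) (hp : p.Pos) (hA : gap n p ≠ 0) {v vs w ws : ℕ → ℝ}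
    (h : IsTau n p v vs) (h' : IsTau n p w ws) {i : ℕ} (hi : i ≤ n - 1) :
    v i = w i ∧ vs i = ws i := by
  have key (q : RPair) (v w : ℕ → ℝ) (h : IsRec n q v) (h' : IsRec n q w) (i : ℕ)
      (hi : i ≤ n - 1) :
      v i - w i = (∏ k ∈ Icc 1 i, (q.2.xb k / q.1.xb k)) * (v 0 - w 0) := by
    induction i with
    | zero => simp
    | succ i ih =>
      rw [h (i + 1) (by omega) hi, h' (i + 1) (by omega) hi, Finset.prod_Icc_succ_top (by omega)]
      simp only [Nat.add_sub_cancel]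
      linear_combination (q.2.xb (i + 1) / q.1.xb (i + 1)) * ih (by omega)
  have k1 := key p v w h.fst h'.fst
  have k2 := key _ vs ws h.snd h'.snd
  have hprod (i : ℕ) (hi : i ≤ n - 1) :
      ∏ k ∈ Icc 1 i, ((RPair.star n p).2.xb k / (RPair.star n p).1.xb k)
        = (∏ k ∈ Icc 1 i, (p.2.x k / p.1.x k))⁻¹ := by
    rw [← Finset.prod_inv_distrib]
    refine Finset.prod_congr rfl fun k hk => ?_
    have := (Finset.mem_Icc.1 hk).2
    simp [RPair.star, show k < n by omega]
  have k3 := k1 (n - 1) le_rfl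
  have k4 := k2 (n - 1) le_rfl
  rw [hprod _ le_rfl] at k4
  have P1 : 0 < ∏ k ∈ Icc 1 (n - 1), (p.2.x k / p.1.x k) :=
    Finset.prod_pos fun k _ => div_pos (hp.2.x k) (hp.1.x k)
  have P2 : 0 < ∏ k ∈ Icc 1 (n - 1), (p.2.xb k / p.1.xb k) :=
    Finset.prod_pos fun k _ => div_pos (hp.2.xb k) (hp.1.xb k)
  have hl := prod_ratio_eq (n := n) (by omega) hp
  have t1 := h.top
  have t2 := h'.top
  have z1 := h.zero
  have z2 := h'.zero
  rw [← z1, ← z2] at k4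
  have hz : v 0 - w 0 = 0 := by
    generalize ∏ k ∈ Icc 1 (n - 1), (p.2.x k / p.1.x k) = P at *
    generalize ∏ k ∈ Icc 1 (n - 1), (p.2.xb k / p.1.xb k) = Q at *
    have h1 := hp.1.x n
    have h2 := hp.2.x n
    have hP := P1.ne'
    -- The second factor, multiplied by `ℓ(x)/x_n`, is the gap, by `prod_ratio_eq`.
    have e : (v 0 - w 0) * (p.1.x n - p.2.x n * P * Q) = 0 := by
      field_simp at k4
      linear_combination P * (t1 - t2) + P * p.2.x n * k3 - p.1.x n * k4
    rcases mul_eq_zero.1 e with e | e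
    · exact e
    · exfalso
      apply hA
      unfold gap
      rw [← hl]
      field_simp
      linear_combination p.1.level n * e
  constructor
  · have := k1 i hi
    rw [hz] at this
    linarith
  · have := k2 i hi
    rw [← z1, ← z2, hz] at this
    linarith

theorem prod_star_snd {i : ℕ} (hi : i ≤ n - 1) (a : ℕ) (ha : 1 ≤ a):
    ∏ k ∈ Icc a i, ((RPair.star n p).2.xb k / (RPair.star n p).1.xb k)
      = ∏ k ∈ Icc a i, (p.1.x k / p.2.x k) := by
  refine Finset.prod_congr rfl fun k hk => ?_
  have := Finset.mem_Icc.1 hk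
  simp [RPair.star, show k < n by omega]

theorem prod_star_fst {i : ℕ} (hi : i ≤ n - 1) (a : ℕ) (ha : 1 ≤ a):
    ∏ k ∈ Icc a i, ((RPair.star n p).1.xb k / (RPair.star n p).2.xb k)
      = ∏ k ∈ Icc a i, (p.2.x k / p.1.x k) := by
  refine Finset.prod_congr rfl fun k hk => ?_
  have := Finset.mem_Icc.1 hk
  simp [RPair.star, show k < n by omega]

theorem prod_star_x {i : ℕ} (hi : i ≤ n - 1) (a : ℕ) (ha : 1 ≤ a):
    ∏ k ∈ Icc a i, ((RPair.star n p).2.x k / (RPair.star n p).1.x k)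
      = ∏ k ∈ Icc a i, (p.1.xb k / p.2.xb k) := by
  refine Finset.prod_congr rfl fun k hk => ?_
  have := Finset.mem_Icc.1 hk
  simp [RPair.star, show k < n by omega]

theorem prod_ratio_inv (s : Finset ℕ) (f g : ℕ → ℝ) :
    ∏ k ∈ s, (f k / g k) = (∏ k ∈ s, (g k / f k))⁻¹ := by
  rw [← Finset.prod_inv_distrib]
  simp

/-- Term by term: `*` exchanges `θ_{0,j}` with `θ'_{0,j}` and, for `j < n`, `η_{0,j}` with
`η'_{0,j}`, while it fixes both terms with `j = n`. -/
theorem V_zero_star (hn : 3 ≤ n) (hp : p.Pos) : V n 0 (star n p) = V n 0 p := by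
  have e1 : ∑ j ∈ Icc 1 (n - 2), theta n 0 j (star n p) = ∑ j ∈ Icc 1 (n - 2), theta' n 0 j p := by
    refine Finset.sum_congr rfl fun j hj => ?_
    have := Finset.mem_Icc.1 hj
    simp [theta, theta', show j ≠ 0 by omega, star_snd_level (by omega : 1 ≤ n),
      prod_star_fst (show j ≤ n - 1 by omega)]
  have e2 : ∑ j ∈ Icc 1 (n - 2), theta' n 0 j (star n p) = ∑ j ∈ Icc 1 (n - 2), theta n 0 j p := by
    refine Finset.sum_congr rfl fun j hj => ?_
    have := Finset.mem_Icc.1 hj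
    simp [theta, theta', show j ≠ 0 by omega, star_fst_level (by omega : 1 ≤ n),
      prod_star_x (show j ≤ n - 1 by omega)]
  have hpr := prod_ratio_eq (n := n) (by omega) hp
  have hx := (hp.1.x n).ne'
  have hy := (hp.2.x n).ne'
  have P2 : ∏ k ∈ Icc 1 (n - 1), (p.2.xb k / p.1.xb k) ≠ 0 :=
    (Finset.prod_pos fun k _ => div_pos (hp.2.xb k) (hp.1.xb k)).ne'
  obtain ⟨m, rfl⟩ : ∃ m, n = m + 1 := ⟨n - 1, by omega⟩
  have e3 : ∑ j ∈ Icc 1 m, eta (m + 1) 0 j (star (m + 1) p)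
      = ∑ j ∈ Icc 1 m, eta' (m + 1) 0 j p := by
    refine Finset.sum_congr rfl fun j hj => ?_
    have := Finset.mem_Icc.1 hj
    simp [eta, eta', show j ≠ 0 by omega, star_snd_level,
      prod_star_fst (n := m + 1) (i := j) (by simp; omega), this,
      star_fst_x (show j < m + 1 by omega), star_snd_xb (show j < m + 1 by omega)]
  have e4 : ∑ j ∈ Icc 1 m, eta' (m + 1) 0 j (star (m + 1) p)
      = ∑ j ∈ Icc 1 m, eta (m + 1) 0 j p := by
    refine Finset.sum_congr rfl fun j hj => ?_
    have := Finset.mem_Icc.1 hj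
    simp [eta, eta', show j ≠ 0 by omega, star_fst_level,
      prod_star_x (n := m + 1) (i := j) (by simp; omega), this,
      star_fst_x (show j < m + 1 by omega), star_snd_xb (show j < m + 1 by omega)]
  have hm : ¬ m + 1 ≤ m := by omega
  have hm' : (0 : ℕ) ≠ m := by omega
  simp only [Nat.add_sub_cancel] at hpr P2
  have e5 : eta (m + 1) 0 (m + 1) (star (m + 1) p) = eta (m + 1) 0 (m + 1) p := by
    simp only [eta, star_snd_level (Nat.le_add_left 1 m), Nat.add_sub_cancel, zero_add,
      prod_star_fst (n := m + 1) (i := m) le_rfl 1 le_rfl, hm, if_false, star_fst_x_self,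
      Nat.le_zero, Nat.succ_ne_zero]
    rw [prod_ratio_inv _ p.1.xb, ← hpr]
    field_simp
  have e6 : eta' (m + 1) 0 (m + 1) (star (m + 1) p) = eta' (m + 1) 0 (m + 1) p := by
    simp only [eta', star_fst_level (Nat.le_add_left 1 m), Nat.add_sub_cancel,
      prod_star_x (n := m + 1) (i := m) le_rfl 1 le_rfl, hm, hm', if_false, star_fst_x_self,
      Finset.Icc_eq_empty (show ¬ 1 ≤ 0 by omega), Finset.prod_empty]
    rw [prod_ratio_inv _ p.1.xb, ← hpr]
    field_simp
  simp only [V, Finset.sum_Icc_succ_top (Nat.le_add_left 1 m)]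
  rw [e1, e2, e3, e4, e5, e6]
  ring

/-- After multiplication by `x_n` and `y_n`, the terms of `V_{n-1}^*` and `V_{n-1}` cancel in pairs,
an unprimed term against a primed one; `e0` and `e0'` are the underlying product identities. Only
the terms with `j = n` survive, which equal `ℓ(y) x_n` and `ℓ(x)/y_n` and their mirror images. -/
theorem V_top (hn : 3 ≤ n) (hp : p.Pos) :
    p.1.x n * V n (n - 1) (star n p) - p.2.x n * V n (n - 1) p
      = gap n p * (p.1.x n * p.2.x n - 1) := by
  have hpr := prod_ratio_eq (n := n) (by omega) hp
  have hx := (hp.1.x n).ne'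
  have hy := (hp.2.x n).ne'
  have hlx := (hp.1.level n).ne'
  have hly := (hp.2.level n).ne'
  have P2 (i) : ∏ k ∈ Icc 1 i, (p.2.xb k / p.1.xb k) ≠ 0 :=
    (Finset.prod_pos fun k _ => div_pos (hp.2.xb k) (hp.1.xb k)).ne'
  have P3 (i) : ∏ k ∈ Icc 1 i, (p.2.x k / p.1.x k) ≠ 0 :=
    (Finset.prod_pos fun k _ => div_pos (hp.2.x k) (hp.1.x k)).ne'
  have split (f : ℕ → ℝ) (j : ℕ) (hj : j ≤ n - 1) :
      ∏ k ∈ Icc 1 (n - 1), f k = (∏ k ∈ Icc 1 j, f k) * ∏ k ∈ Icc (j + 1) (n - 1), f k := by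
    have : Icc 1 (n - 1) = Icc 1 j ∪ Icc (j + 1) (n - 1) := by ext; simp; omega
    rw [this, Finset.prod_union]
    rw [Finset.disjoint_left]; intro a; simp; omega
  have e0 (j : ℕ) (hj : j ≤ n - 1) :
      p.1.x n * (p.2.level n * ∏ k ∈ Icc (j + 1) (n - 1), (p.1.x k / p.2.x k))
        = p.2.x n * (p.1.level n * (∏ k ∈ Icc 1 (n - 1), (p.2.xb k / p.1.xb k))
          * ∏ k ∈ Icc 1 j, (p.2.x k / p.1.x k)) := by
    rw [← hpr, split (fun k => p.2.x k / p.1.x k) j hj, prod_ratio_inv _ p.1.x]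
    have := P3 (n - 1)
    rw [split _ j hj] at this
    have := right_ne_zero_of_mul this
    field_simp
  have e0' (j : ℕ) (hj : j ≤ n - 1) :
      p.2.x n * (p.1.level n * ∏ k ∈ Icc (j + 1) (n - 1), (p.2.xb k / p.1.xb k))
        = p.1.x n * (p.2.level n * (∏ k ∈ Icc 1 (n - 1), (p.1.x k / p.2.x k))
          * ∏ k ∈ Icc 1 j, (p.1.xb k / p.2.xb k)) := by
    rw [← hpr, split (fun k => p.2.xb k / p.1.xb k) j hj, prod_ratio_inv _ p.1.x,
      prod_ratio_inv (Icc 1 j) p.1.xb]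
    have := P3 (n - 1)
    have := P2 j
    field_simp
  have e1 : p.1.x n * ∑ j ∈ Icc 1 (n - 2), theta n (n - 1) j (star n p)
      = p.2.x n * ∑ j ∈ Icc 1 (n - 2), theta' n (n - 1) j p := by
    rw [Finset.mul_sum, Finset.mul_sum]
    refine Finset.sum_congr rfl fun j hj => ?_
    have := Finset.mem_Icc.1 hj
    rw [theta, theta', if_pos (by omega), star_fst_level (by omega), prod_star_snd le_rfl _ (by omega),
      e0 j (by omega)]
  have e2 : p.2.x n * ∑ j ∈ Icc 1 (n - 2), theta n (n - 1) j p
      = p.1.x n * ∑ j ∈ Icc 1 (n - 2), theta' n (n - 1) j (star n p) := by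
    rw [Finset.mul_sum, Finset.mul_sum]
    refine Finset.sum_congr rfl fun j hj => ?_
    have := Finset.mem_Icc.1 hj
    rw [theta, theta', if_pos (by omega), star_fst_level (by omega), prod_star_snd le_rfl _ (by omega),
      e0' j (by omega), prod_star_x (by omega) _ le_rfl]
  have e3 : p.1.x n * ∑ j ∈ Icc 1 (n - 1), eta n (n - 1) j (star n p)
      = p.2.x n * ∑ j ∈ Icc 1 (n - 1), eta' n (n - 1) j p := by
    rw [Finset.mul_sum, Finset.mul_sum]
    refine Finset.sum_congr rfl fun j hj => ?_
    have := Finset.mem_Icc.1 hj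
    rw [eta, eta', if_pos (by omega), if_pos (by omega), star_fst_level (by omega),
      prod_star_snd le_rfl _ (by omega), ← mul_assoc, e0 j (by omega)]
    rw [star_fst_x (show j < n by omega), star_snd_xb (show j < n by omega)]
    ring
  have e4 : p.2.x n * ∑ j ∈ Icc 1 (n - 1), eta n (n - 1) j p
      = p.1.x n * ∑ j ∈ Icc 1 (n - 1), eta' n (n - 1) j (star n p) := by
    rw [Finset.mul_sum, Finset.mul_sum]
    refine Finset.sum_congr rfl fun j hj => ?_
    have := Finset.mem_Icc.1 hj
    rw [eta, eta', if_pos (by omega), if_pos (by omega), star_fst_level (by omega),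
      prod_star_snd le_rfl _ (by omega), ← mul_assoc, e0' j (by omega),
      prod_star_x (by omega) _ le_rfl]
    rw [star_fst_x (show j < n by omega), star_snd_xb (show j < n by omega)]
    ring
  have e5 (q : RPair) : eta n (n - 1) n q = q.2.level n * q.1.x n := by
    rw [eta, if_neg (by omega), if_neg (by omega), Finset.Icc_eq_empty (by omega)]
    simp
  have e6 (q : RPair) (hq : q.Pos) : eta' n (n - 1) n q = q.1.level n / q.2.x n := by
    have h1 := prod_ratio_eq (n := n) (by omega) hq
    have hx := (hq.1.x n).ne'
    have hy := (hq.2.x n).ne'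
    have hlx := (hq.1.level n).ne'
    have hly := (hq.2.level n).ne'
    rw [eta', if_neg (by omega), if_pos rfl]
    generalize q.2.level n = ly at *
    field_simp at h1 ⊢
    linear_combination h1
  obtain ⟨m, rfl⟩ : ∃ m, n = m + 1 := ⟨n - 1, by omega⟩
  simp only [V, Finset.sum_Icc_succ_top (Nat.le_add_left 1 m)]
  rw [e5, e5, e6 _ hp, e6 _ hp.star, star_fst_level (by omega), star_snd_level (by omega)]
  simp only [Nat.add_sub_cancel] at *
  rw [star_fst_x_self, star_snd_x_self]
  unfold gap
  have f1 : p.1.x (m + 1) * (p.2.level (m + 1) / p.1.x (m + 1)) = p.2.level (m + 1) := by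
    field_simp
  have f2 : p.2.x (m + 1) * (p.1.level (m + 1) / p.2.x (m + 1)) = p.1.level (m + 1) := by
    field_simp
  linear_combination e1 - e2 + e3 - e4 + f1 - f2

theorem isTau_V (hn : 3 ≤ n) (hp : p.Pos) :
    IsTau n p (fun i => V n i p) (fun i => Vstar n i p) where
  fst := isRec_V hn hp
  snd := isRec_V hn hp.star
  zero := (V_zero_star hn hp).symm
  top := V_top hn hp

end RPair

end DCrystal

/-! ### Local identities for the nodes `1 ≤ i ≤ n - 2`. -/

namespace DCrystal

/-- The quantities that enter the action of `e_i^c`, `1 ≤ i ≤ n - 2`, on a pair: `a`, `a'`, `b`,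
`b'` are `x_i`, `x̄_i`, `x_{i+1}`, `x̄_{i+1}`, and `p`, `p'`, `q`, `q'` are the same coordinates
of `y`. -/
structure LocalData (a a' b b' p p' q q' c φ ε c₁ c₂ ξ ζ : ℝ) : Prop where
  a_pos : 0 < a
  a'_pos : 0 < a'
  b_pos : 0 < b
  b'_pos : 0 < b'
  p_pos : 0 < p
  p'_pos : 0 < p'
  q_pos : 0 < q
  q'_pos : 0 < q'
  c_pos : 0 < c
  phi_eq : φ = a * (1 + b' / b)
  eps_eq : ε = p' * (1 + q / q')
  c₁_eq : c₁ = (c * φ + ε) / (φ + ε)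
  c₂_eq : c₂ = (φ + ε) / (φ + ε / c)
  xi_eq : ξ = (b + c₁ * b') / (b + b')
  zeta_eq : ζ = (q + c₂ * q') / (q + q')

namespace LocalData

variable {a a' b b' p p' q q' c φ ε c₁ c₂ ξ ζ : ℝ}

theorem phi_pos (h : LocalData a a' b b' p p' q q' c φ ε c₁ c₂ ξ ζ) : 0 < φ := by
  have := h.a_pos; have := h.b_pos; have := h.b'_pos
  rw [h.phi_eq]; positivity

theorem eps_pos (h : LocalData a a' b b' p p' q q' c φ ε c₁ c₂ ξ ζ) : 0 < ε := by
  have := h.p'_pos; have := h.q_pos; have := h.q'_pos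
  rw [h.eps_eq]; positivity

theorem c₁_pos (h : LocalData a a' b b' p p' q q' c φ ε c₁ c₂ ξ ζ) : 0 < c₁ := by
  have := h.c_pos; have := h.phi_pos; have := h.eps_pos
  rw [h.c₁_eq]; positivity

theorem c₂_pos (h : LocalData a a' b b' p p' q q' c φ ε c₁ c₂ ξ ζ) : 0 < c₂ := by
  have := h.c_pos; have := h.phi_pos; have := h.eps_pos
  rw [h.c₂_eq]; positivity

theorem xi_pos (h : LocalData a a' b b' p p' q q' c φ ε c₁ c₂ ξ ζ) : 0 < ξ := by
  have := h.c₁_pos; have := h.b_pos; have := h.b'_pos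
  rw [h.xi_eq]; positivity

theorem zeta_pos (h : LocalData a a' b b' p p' q q' c φ ε c₁ c₂ ξ ζ) : 0 < ζ := by
  have := h.c₂_pos; have := h.q_pos; have := h.q'_pos
  rw [h.zeta_eq]; positivity

theorem c₁_mul (h : LocalData a a' b b' p p' q q' c φ ε c₁ c₂ ξ ζ) :
    c₁ * (φ + ε) = c * φ + ε := by
  have := h.phi_pos; have := h.eps_pos
  rw [h.c₁_eq]; field_simp

theorem c₁_mul_c₂ (h : LocalData a a' b b' p p' q q' c φ ε c₁ c₂ ξ ζ) : c₁ * c₂ = c := by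
  have := h.phi_pos; have := h.eps_pos; have := h.c_pos
  have : 0 < c * φ + ε := by positivity
  rw [h.c₁_eq, h.c₂_eq]; field_simp

theorem c₂_mul (h : LocalData a a' b b' p p' q q' c φ ε c₁ c₂ ξ ζ) :
    c₂ * (c * φ + ε) = c * (φ + ε) := by
  rw [← h.c₁_mul, ← h.c₁_mul_c₂]; ring

theorem phi_mul (h : LocalData a a' b b' p p' q q' c φ ε c₁ c₂ ξ ζ) : φ * b = a * (b + b') := by
  have := h.b_pos
  rw [h.phi_eq]; field_simp

theorem eps_mul (h : LocalData a a' b b' p p' q q' c φ ε c₁ c₂ ξ ζ) :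
    ε * q' = p' * (q + q') := by
  have := h.q'_pos
  rw [h.eps_eq]; field_simp; ring

/-- This lemma and the next two separate the value at `c = 1` from a multiple of `c - 1`, so that
the change of `V_i` under the operator can be read off. -/
theorem zeta_sub (h : LocalData a a' b b' p p' q q' c φ ε c₁ c₂ ξ ζ) :
    ζ = 1 + p' * (c - 1) / (c * φ + ε) := by
  have := h.phi_pos; have := h.eps_pos; have := h.c_pos; have := h.q_pos; have := h.q'_pos
  have : 0 < c * φ + ε := by positivity
  rw [h.zeta_eq]
  field_simp
  linear_combination q' * h.c₂_mul + (c - 1) * h.eps_mul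

theorem xi_div (h : LocalData a a' b b' p p' q q' c φ ε c₁ c₂ ξ ζ) :
    ξ / c₁ = 1 - (c - 1) * a / (c * φ + ε) := by
  have := h.phi_pos; have := h.eps_pos; have := h.c_pos; have := h.b_pos; have := h.b'_pos
  have : 0 < c * φ + ε := by positivity
  rw [h.xi_eq, h.c₁_eq]
  field_simp
  linear_combination (1 - c) * h.phi_mul

theorem xi_sub (h : LocalData a a' b b' p p' q q' c φ ε c₁ c₂ ξ ζ) :
    ξ = 1 + (c - 1) * (a * b') / (b * (φ + ε)) := by
  have := h.phi_pos; have := h.eps_pos; have := h.c_pos; have := h.b_pos; have := h.b'_pos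
  rw [h.xi_eq]
  field_simp
  linear_combination b * b' * h.c₁_mul + b' * (c - 1) * h.phi_mul

/-- The effect of `e_i^c` on `V_i`. -/
theorem V_mul (h : LocalData a a' b b' p p' q q' c φ ε c₁ c₂ ξ ζ) {v vi vh A : ℝ}
    (hvi : vi = p' / a' * v + A * (p' / a + 1))
    (hvh : vh = p' / ζ / (a' / ξ) * v + A * (p' / ζ / (a / ξ * c₁) + 1)) :
    vh * ζ = vi + (c - 1) * v * (a * b' * p') / (b * a' * (φ + ε)) := by
  have h1 := h.a_pos; have h2 := h.a'_pos; have h3 := h.b_pos; have h4 := h.zeta_pos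
  have h5 := h.xi_pos; have h6 := h.c₁_pos; have := h.phi_pos; have := h.eps_pos
  have := h.c_pos
  have hT : 0 < c * φ + ε := by positivity
  have e : vh * ζ = ξ * (p' / a') * v + A * (ζ + p' / a * (ξ / c₁)) := by
    rw [hvh]; field_simp; ring
  rw [e, hvi, h.zeta_sub, h.xi_div, h.xi_sub]
  field_simp
  ring

/-- The operator `e_i^c` does not change `V_{i+1}`. -/
theorem V_next (h : LocalData a a' b b' p p' q q' c φ ε c₁ c₂ ξ ζ) {v vi vh A : ℝ} (d : ℝ)
    (hvi : vi = p' / a' * v + A * (p' / a + 1))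
    (hvh : vh = p' / ζ / (a' / ξ) * v + A * (p' / ζ / (a / ξ * c₁) + 1)) :
    q' * ζ / (b' * ξ) * vh + A * (q' * ζ / (b * ξ / c₁) + d)
      = q' / b' * vi + A * (q' / b + d) := by
  have h1 := h.a_pos; have h2 := h.a'_pos; have h3 := h.b_pos; have h4 := h.zeta_pos
  have h5 := h.xi_pos; have h6 := h.c₁_pos; have := h.phi_pos; have := h.eps_pos
  have := h.c_pos; have h7 := h.b'_pos
  have hT : 0 < c * φ + ε := by positivity
  have e := h.V_mul hvi hvh
  have e1 : (1 + c₁ * b' / b) = ξ * (φ / a) := by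
    rw [h.phi_eq, h.xi_eq]; field_simp
  have e2 : q' * ζ / (b' * ξ) * vh = q' / (b' * ξ) * (vh * ζ) := by ring
  have e3 : vh * ζ = ξ * (p' / a') * v + A * (ζ + p' / a * (ξ / c₁)) := by
    rw [hvh]; field_simp; ring
  rw [e2, e3, hvi]
  -- The terms with `v` and with `d` match at once; this is the equality of the remaining
  -- coefficients of `A`.
  have key : ζ * (1 + c₁ * b' / b) + p' / a * (ξ / c₁) = ξ * (1 + p' / a + b' / b) := by
    rw [e1]
    have : ξ / c₁ = ξ * (1 / c₁) := by ring
    have e4 : 1 / c₁ = (φ + ε) / (c * φ + ε) := by rw [h.c₁_eq]; field_simp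
    rw [this, e4, h.zeta_sub]
    have : b' / b = φ / a - 1 := by rw [h.phi_eq]; field_simp; ring
    rw [this]
    field_simp
    ring
  have e5 : q' / (b' * ξ) * (ξ * (p' / a') * v + A * (ζ + p' / a * (ξ / c₁)))
      + A * (q' * ζ / (b * ξ / c₁) + d)
      = q' / b' * (p' / a') * v + A * (q' / (b' * ξ)) * (ζ * (1 + c₁ * b' / b) + p' / a * (ξ / c₁))
        + A * d := by
    field_simp
    ring
  rw [e5, key]
  field_simp
  ring

/-- The effect of `e_i^c` on `W_i`. -/
theorem W_mul (h : LocalData a a' b b' p p' q q' c φ ε c₁ c₂ ξ ζ) {v vs wh A : ℝ}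
    (hwh : wh = a / ξ * c₁ * (p' / ζ) / (a' / ξ * (p / ζ * c₂)) * (v * vs)
      + A * (p' / ζ / (p / ζ * c₂)) * vs - A * (a / ξ * c₁ / (a' / ξ)) * v) :
    wh * c₂ * (φ + ε) * (a' * p) = a * p' * (c * (v * (φ * vs - A * (p / p') * (φ + ε)))
      + vs * (ε * v + A * (a' / a) * (φ + ε))) := by
  have h1 := h.a_pos; have h2 := h.a'_pos; have h3 := h.p_pos; have h4 := h.zeta_pos
  have h5 := h.xi_pos; have h6 := h.c₁_pos; have := h.phi_pos; have := h.eps_pos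
  have h7 := h.p'_pos; have h8 := h.c₂_pos
  have e : wh * c₂ = c₁ * (a * p' / (a' * p)) * (v * vs) + A * (p' / p) * vs
      - A * (c₁ * c₂) * (a / a') * v := by
    rw [hwh]; field_simp
  rw [e, h.c₁_mul_c₂]
  field_simp
  linear_combination (a * p' * v * vs) * h.c₁_mul

/-- The counterpart of `W_mul` for `c = 1`. The two summands on the right are, up to one common
factor, the values of `φ_i` and `ε_i` on the two factors of the image; see `phi_image` and
`eps_image`. -/
theorem W_eq_div (h : LocalData a a' b b' p p' q q' c φ ε c₁ c₂ ξ ζ) {v vs w A : ℝ}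
    (hw : w = a * p' / (a' * p) * (v * vs) + A * (p' / p) * vs - A * (a / a') * v) :
    w * (φ + ε) * (a' * p) = a * p' * (v * (φ * vs - A * (p / p') * (φ + ε))
      + vs * (ε * v + A * (a' / a) * (φ + ε))) := by
  have h1 := h.a_pos; have h2 := h.a'_pos; have h3 := h.p_pos
  have h7 := h.p'_pos
  rw [hw]
  field_simp
  ring

/-- The value of `φ_i` on the first factor of the image under the tropical `R`. -/
theorem phi_image (h : LocalData a a' b b' p p' q q' c φ ε c₁ c₂ ξ ζ)
    {v vs w vi vsi w₂ w₀ v₂ A : ℝ}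
    (hw₀ : 0 < w₀) (hw : 0 < w) (hw₂ : 0 < w₂) (hvi : 0 < vi) (hv₂ : 0 < v₂)
    (hvsi : vsi = a / p * vs - A * (a / p' + 1))
    (hwi : w = vi * vsi + A * (vi - vsi))
    (hw₂' : w₂ = b * q' / (b' * q) * (vi * vsi) + A * (q' / q) * vsi - A * (b / b') * vi) :
    p * v * w / (vi * w₀) * (1 + q' * vi / v₂ / (q * vi * w₂ / (v₂ * w)))
      = w * b * q' / (w₀ * b' * q * w₂) * (v * (φ * vs - A * (p / p') * (φ + ε))) := by
  have h1 := h.a_pos; have h2 := h.b_pos; have h3 := h.p_pos; have h4 := h.q_pos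
  have h5 := h.b'_pos; have h6 := h.p'_pos; have h7 := h.q'_pos
  have e1 : b' * (q * w₂ + q' * w) = vi * (vsi * q' * (b + b') + A * (q' * b' - b * q)) := by
    rw [hw₂', hwi]; field_simp; ring
  have e2 : p * (vsi * q' * (b + b') + A * (q' * b' - b * q))
      = q' * b * (φ * vs - A * (p / p') * (φ + ε)) := by
    rw [hvsi, h.phi_eq, h.eps_eq]
    field_simp
    ring
  have e3 : p * v * w / (vi * w₀) * (1 + q' * vi / v₂ / (q * vi * w₂ / (v₂ * w)))
      = v * w / (vi * w₀ * q * w₂ * b') * (p * (b' * (q * w₂ + q' * w))) := by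
    field_simp
  rw [e3, e1, mul_left_comm p, e2]
  field_simp

/-- The value of `ε_i` on the second factor of the image under the tropical `R`. -/
theorem eps_image (h : LocalData a a' b b' p p' q q' c φ ε c₁ c₂ ξ ζ)
    {v vs w vi vsi w₂ w₀ vs₂ A : ℝ}
    (hw₀ : 0 < w₀) (hw : 0 < w) (hw₂ : 0 < w₂) (hvsi : 0 < vsi) (hvs₂ : 0 < vs₂)
    (hvi : vi = p' / a' * v + A * (p' / a + 1))
    (hwi : w = vi * vsi + A * (vi - vsi))
    (hw₂' : w₂ = b * q' / (b' * q) * (vi * vsi) + A * (q' / q) * vsi - A * (b / b') * vi) :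
    a' * vs * w / (vsi * w₀) * (1 + b * vsi / vs₂ / (b' * vsi * w₂ / (vs₂ * w)))
      = w * b * q' / (w₀ * b' * q * w₂) * (vs * (ε * v + A * (a' / a) * (φ + ε))) := by
  have h1 := h.a_pos; have h2 := h.b_pos; have h3 := h.a'_pos; have h4 := h.q_pos
  have h5 := h.b'_pos; have h6 := h.p'_pos; have h7 := h.q'_pos
  have e1 : q * (b' * w₂ + b * w) = vsi * (vi * b * (q + q') + A * (b' * q' - b * q)) := by
    rw [hw₂', hwi]; field_simp; ring
  have e2 : a' * (vi * b * (q + q') + A * (b' * q' - b * q))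
      = q' * b * (ε * v + A * (a' / a) * (φ + ε)) := by
    rw [hvi, h.phi_eq, h.eps_eq]
    field_simp
    ring
  have e3 : a' * vs * w / (vsi * w₀) * (1 + b * vsi / vs₂ / (b' * vsi * w₂ / (vs₂ * w)))
      = vs * w / (vsi * w₀ * q * w₂ * b') * (a' * (q * (b' * w₂ + b * w))) := by
    field_simp
  rw [e3, e1, mul_left_comm a', e2]
  field_simp

/-- The prefactors in `phi_image` and `eps_image` coincide, so the sum is a multiple of the right
side of `W_eq_div`, that is, of `W_i`. -/
theorem image_sum (h : LocalData a a' b b' p p' q q' c φ ε c₁ c₂ ξ ζ)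
    {v vs w vi vsi w₂ w₀ v₂ vs₂ A φ' ε' : ℝ}
    (hw₀ : 0 < w₀) (hw : 0 < w) (hw₂ : 0 < w₂) (hvi0 : 0 < vi) (hvsi0 : 0 < vsi)
    (hv₂ : 0 < v₂) (hvs₂ : 0 < vs₂)
    (hvi : vi = p' / a' * v + A * (p' / a + 1)) (hvsi : vsi = a / p * vs - A * (a / p' + 1))
    (hwi : w = vi * vsi + A * (vi - vsi))
    (hws : w = a * p' / (a' * p) * (v * vs) + A * (p' / p) * vs - A * (a / a') * v)
    (hw₂' : w₂ = b * q' / (b' * q) * (vi * vsi) + A * (q' / q) * vsi - A * (b / b') * vi)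
    (hφ : φ' = p * v * w / (vi * w₀) * (1 + q' * vi / v₂ / (q * vi * w₂ / (v₂ * w))))
    (hε : ε' = a' * vs * w / (vsi * w₀) * (1 + b * vsi / vs₂ / (b' * vsi * w₂ / (vs₂ * w)))) :
    φ' + ε' = w * b * q' / (w₀ * b' * q * w₂) * (φ + ε) * (w * (a' * p) / (a * p')) := by
  have h1 := h.a_pos; have h2 := h.p'_pos
  have e := h.W_eq_div hws
  rw [hφ, hε, h.phi_image hw₀ hw hw₂ hvi0 hv₂ hvsi hwi hw₂',
    h.eps_image hw₀ hw hw₂ hvsi0 hvs₂ hvi hwi hw₂', ← mul_add]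
  have : (φ + ε) * (w * (a' * p) / (a * p')) = v * (φ * vs - A * (p / p') * (φ + ε))
      + vs * (ε * v + A * (a' / a) * (φ + ε)) := by
    rw [mul_div_assoc', div_eq_iff (by positivity)]
    linear_combination e
  rw [mul_assoc _ (φ + ε), this]

/-- The change of `W_i` in terms of the action on the image. -/
theorem W_image (h : LocalData a a' b b' p p' q q' c φ ε c₁ c₂ ξ ζ)
    {v vs w wh vi vsi w₂ w₀ v₂ vs₂ A φ' ε' : ℝ}
    (hw₀ : 0 < w₀) (hw : 0 < w) (hw₂ : 0 < w₂) (hvi0 : 0 < vi) (hvsi0 : 0 < vsi)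
    (hv₂ : 0 < v₂) (hvs₂ : 0 < vs₂)
    (hvi : vi = p' / a' * v + A * (p' / a + 1)) (hvsi : vsi = a / p * vs - A * (a / p' + 1))
    (hwi : w = vi * vsi + A * (vi - vsi))
    (hws : w = a * p' / (a' * p) * (v * vs) + A * (p' / p) * vs - A * (a / a') * v)
    (hw₂' : w₂ = b * q' / (b' * q) * (vi * vsi) + A * (q' / q) * vsi - A * (b / b') * vi)
    (hwh : wh = a / ξ * c₁ * (p' / ζ) / (a' / ξ * (p / ζ * c₂)) * (v * vs)
      + A * (p' / ζ / (p / ζ * c₂)) * vs - A * (a / ξ * c₁ / (a' / ξ)) * v)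
    (hφ : φ' = p * v * w / (vi * w₀) * (1 + q' * vi / v₂ / (q * vi * w₂ / (v₂ * w))))
    (hε : ε' = a' * vs * w / (vsi * w₀) * (1 + b * vsi / vs₂ / (b' * vsi * w₂ / (vs₂ * w)))) :
    wh * c₂ = w * ((c * φ' + ε') / (φ' + ε')) := by
  have h1 := h.a_pos; have h2 := h.p'_pos; have h3 := h.a'_pos; have h4 := h.p_pos
  have h5 := h.b_pos; have h6 := h.b'_pos; have h7 := h.q_pos; have h8 := h.q'_pos
  have h9 := h.phi_pos; have h10 := h.eps_pos
  have e := h.W_mul hwh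
  rw [h.image_sum hw₀ hw hw₂ hvi0 hvsi0 hv₂ hvs₂ hvi hvsi hwi hws hw₂' hφ hε,
    hφ, hε, h.phi_image hw₀ hw hw₂ hvi0 hv₂ hvsi hwi hw₂',
    h.eps_image hw₀ hw hw₂ hvsi0 hvs₂ hvi hwi hw₂']
  -- With these names, `φ'` and `ε'` are proportional to `F` and `E` with the same factor, `W_i` is
  -- proportional to `F + E`, and its value after the operator, times `c₂`, to `c F + E`.
  generalize v * (φ * vs - A * (p / p') * (φ + ε)) = F at *
  generalize vs * (ε * v + A * (a' / a) * (φ + ε)) = E at *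
  field_simp
  linear_combination e

/-- The change of `V_i` in terms of the action on the image. -/
theorem V_image (h : LocalData a a' b b' p p' q q' c φ ε c₁ c₂ ξ ζ)
    {v vs w vh vi vsi w₂ w₀ v₂ vs₂ A φ' ε' : ℝ}
    (hw₀ : 0 < w₀) (hw : 0 < w) (hw₂ : 0 < w₂) (hvi0 : 0 < vi) (hvsi0 : 0 < vsi)
    (hv₂ : 0 < v₂) (hvs₂ : 0 < vs₂)
    (hvi : vi = p' / a' * v + A * (p' / a + 1)) (hvsi : vsi = a / p * vs - A * (a / p' + 1))
    (hwi : w = vi * vsi + A * (vi - vsi))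
    (hws : w = a * p' / (a' * p) * (v * vs) + A * (p' / p) * vs - A * (a / a') * v)
    (hw₂' : w₂ = b * q' / (b' * q) * (vi * vsi) + A * (q' / q) * vsi - A * (b / b') * vi)
    (hvh : vh = p' / ζ / (a' / ξ) * v + A * (p' / ζ / (a / ξ * c₁) + 1))
    (hφ : φ' = p * v * w / (vi * w₀) * (1 + q' * vi / v₂ / (q * vi * w₂ / (v₂ * w))))
    (hε : ε' = a' * vs * w / (vsi * w₀) * (1 + b * vsi / vs₂ / (b' * vsi * w₂ / (vs₂ * w)))) :
    vh * ζ = vi * ((q * vi * w₂ / (v₂ * w) + (c * φ' + ε') / (φ' + ε') * (q' * vi / v₂))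
      / (q * vi * w₂ / (v₂ * w) + q' * vi / v₂)) := by
  have h1 := h.a_pos; have h2 := h.p'_pos; have h3 := h.a'_pos; have h4 := h.p_pos
  have h5 := h.b_pos; have h6 := h.b'_pos; have h7 := h.q_pos; have h8 := h.q'_pos
  have h9 := h.phi_pos; have h10 := h.eps_pos
  have hs := h.image_sum hw₀ hw hw₂ hvi0 hvsi0 hv₂ hvs₂ hvi hvsi hwi hws hw₂' hφ hε
  have hs0 : 0 < φ' + ε' := by rw [hs]; positivity
  rw [h.V_mul hvi hvh]
  have e1 : (c * φ' + ε') / (φ' + ε') = 1 + (c - 1) * φ' / (φ' + ε') := by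
    field_simp; ring
  rw [e1, hs, hφ]
  field_simp
  ring

/-- The function `ε_i` of a pair does not change under the tropical `R`. -/
theorem tensor_eps_image (h : LocalData a a' b b' p p' q q' c φ ε c₁ c₂ ξ ζ)
    {v vs w vi vsi w₂ w₀ v₂ vs₂ A φ' ε' : ℝ}
    (hw₀ : 0 < w₀) (hw : 0 < w) (hw₂ : 0 < w₂) (hvi0 : 0 < vi) (hvsi0 : 0 < vsi)
    (hv₂ : 0 < v₂) (hvs₂ : 0 < vs₂) (hv : 0 < v)
    (hvi : vi = p' / a' * v + A * (p' / a + 1)) (hvsi : vsi = a / p * vs - A * (a / p' + 1))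
    (hwi : w = vi * vsi + A * (vi - vsi))
    (hws : w = a * p' / (a' * p) * (v * vs) + A * (p' / p) * vs - A * (a / a') * v)
    (hw₂' : w₂ = b * q' / (b' * q) * (vi * vsi) + A * (q' / q) * vsi - A * (b / b') * vi)
    (hφ : φ' = p * v * w / (vi * w₀) * (1 + q' * vi / v₂ / (q * vi * w₂ / (v₂ * w))))
    (hε : ε' = a' * vs * w / (vsi * w₀) * (1 + b * vsi / vs₂ / (b' * vsi * w₂ / (vs₂ * w)))) :
    p' * v / vi * (1 + q * vi * w₂ / (v₂ * w) / (q' * vi / v₂)) * (1 + ε' / φ')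
      = a' * (1 + b / b') * (1 + ε / φ) := by
  have h1 := h.a_pos; have h2 := h.p'_pos; have h3 := h.a'_pos; have h4 := h.p_pos
  have h5 := h.b_pos; have h6 := h.b'_pos; have h7 := h.q_pos; have h8 := h.q'_pos
  have h9 := h.phi_pos; have h10 := h.eps_pos
  have hs := h.image_sum hw₀ hw hw₂ hvi0 hvsi0 hv₂ hvs₂ hvi hvsi hwi hws hw₂' hφ hε
  have hφ0 : 0 < φ' := by rw [hφ]; positivity
  have e1 : 1 + ε' / φ' = (φ' + ε') / φ' := by field_simp
  have e2 : 1 + ε / φ = (φ + ε) / φ := by field_simp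
  rw [e1, e2, hs, hφ]
  have e4 := h.phi_mul
  have e5 : 1 + b / b' = φ * b / (a * b') := by rw [e4]; field_simp; ring
  rw [e5]
  field_simp
  ring

end LocalData

end DCrystal

/-! ### How the geometric operators, `*` and `σ₁` act on `V_i` and `W_i`. -/

namespace DCrystal

open Finset (Icc)
open Function (update)

theorem prod_update_eq {s : Finset ℕ} {f : ℕ → ℝ} {i : ℕ} (hi : i ∈ s) (hf : f i ≠ 0) (r : ℝ) :
    ∏ k ∈ s, update f i r k = r / f i * ∏ k ∈ s, f k := by
  rw [Finset.prod_update_of_mem hi, ← Finset.mul_prod_erase s f hi, Finset.sdiff_singleton_eq_erase]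
  field_simp

namespace RVec

variable {n i : ℕ} {b : RVec} {c : ℝ}

theorem Pos.eps (hb : b.Pos) (n i : ℕ) : 0 < b.eps n i := by
  have h1 := hb.x; have h2 := hb.xb
  have h3 (k) := div_pos (h1 k) (h2 k)
  unfold RVec.eps
  split_ifs
  · exact mul_pos (h1 _) (add_pos one_pos (h3 _))
  · exact mul_pos (h2 _) (add_pos one_pos (h3 _))
  · exact mul_pos (h1 _) (h2 _)
  · exact h2 _

theorem Pos.phi (hb : b.Pos) (n i : ℕ) : 0 < b.phi n i := by
  have h1 := hb.x; have h2 := hb.xb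
  have h3 (k) := div_pos (h2 k) (h1 k)
  unfold RVec.phi
  split_ifs
  · exact mul_pos (h2 _) (add_pos one_pos (h3 _))
  · exact mul_pos (h1 _) (add_pos one_pos (h3 _))
  · exact h1 _
  · exact mul_pos (h1 _) (h1 _)

theorem Pos.xi (hb : b.Pos) (hc : 0 < c) (i : ℕ) : 0 < b.xi c i :=
  div_pos (add_pos (hb.x _) (mul_pos hc (hb.xb _))) (add_pos (hb.x _) (hb.xb _))

theorem update_pos {f : ℕ → ℝ} (hf : ∀ k, 0 < f k) {r : ℝ} (hr : 0 < r) (i k : ℕ) :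
    0 < update f i r k := by
  rcases eq_or_ne k i with rfl | h
  · simpa
  · simpa [h] using hf k

theorem Pos.eRaw (hb : b.Pos) (hc : 0 < c) (n i : ℕ) : (b.eRaw n i c).Pos := by
  have h1 := hb.x; have h2 := hb.xb; have h3 := hb.xi hc
  unfold RVec.eRaw
  split_ifs
  · exact ⟨update_pos (update_pos h1 (div_pos (h1 _) (h3 _)) _) (div_pos (mul_pos (h1 _) (h3 _)) hc) _,
      update_pos (update_pos h2 (mul_pos (h2 _) (h3 _)) _) (mul_pos (div_pos (h2 _) (h3 _)) hc) _⟩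
  · exact ⟨update_pos (update_pos h1 (mul_pos (div_pos (h1 _) (h3 _)) hc) _)
      (div_pos (mul_pos (h1 _) (h3 _)) hc) _,
      update_pos (update_pos h2 (mul_pos (h2 _) (h3 _)) _) (div_pos (h2 _) (h3 _)) _⟩
  · exact ⟨update_pos (update_pos h1 (mul_pos (h1 _) hc) _) (div_pos (h1 _) hc) _, h2⟩
  · exact ⟨update_pos h1 (mul_pos (h1 _) hc) _, update_pos h2 (div_pos (h2 _) hc) _⟩

theorem eRaw_mid (h1 : 1 ≤ i) (h2 : i ≤ n - 2) (c : ℝ) (b : RVec) : b.eRaw n i c =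
    ⟨update (update b.x i (b.x i / b.xi c (i + 1) * c))
        (i + 1) (b.x (i + 1) * b.xi c (i + 1) / c),
      update (update b.xb (i + 1) (b.xb (i + 1) * b.xi c (i + 1)))
        i (b.xb i / b.xi c (i + 1))⟩ := by
  rw [RVec.eRaw, if_neg (by omega), if_pos h2]

theorem eRaw_pred (hn : 2 ≤ n) (c : ℝ) (b : RVec) : b.eRaw n (n - 1) c =
    ⟨update (update b.x (n - 1) (b.x (n - 1) * c)) n (b.x n / c), b.xb⟩ := by
  rw [RVec.eRaw, if_neg (by omega), if_neg (by omega), if_pos rfl]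

theorem phi_mid (h1 : 1 ≤ i) (h2 : i ≤ n - 2) (b : RVec) :
    b.phi n i = b.x i * (1 + b.xb (i + 1) / b.x (i + 1)) := by
  rw [RVec.phi, if_neg (by omega), if_pos h2]

theorem eps_mid (h1 : 1 ≤ i) (h2 : i ≤ n - 2) (b : RVec) :
    b.eps n i = b.xb i * (1 + b.x (i + 1) / b.xb (i + 1)) := by
  rw [RVec.eps, if_neg (by omega), if_pos h2]

theorem phi_pred (hn : 2 ≤ n) (b : RVec) : b.phi n (n - 1) = b.x (n - 1) := by
  rw [RVec.phi, if_neg (by omega), if_neg (by omega), if_pos rfl]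

theorem eps_pred (hn : 2 ≤ n) (b : RVec) : b.eps n (n - 1) = b.x n * b.xb (n - 1) := by
  rw [RVec.eps, if_neg (by omega), if_neg (by omega), if_pos rfl]

theorem eRaw_mid_x_self (h1 : 1 ≤ i) (h2 : i ≤ n - 2) (c : ℝ) (b : RVec) :
    (b.eRaw n i c).x i = b.x i / b.xi c (i + 1) * c := by simp [eRaw_mid h1 h2]
theorem eRaw_mid_x_succ (h1 : 1 ≤ i) (h2 : i ≤ n - 2) (c : ℝ) (b : RVec) :
    (b.eRaw n i c).x (i + 1) = b.x (i + 1) * b.xi c (i + 1) / c := by simp [eRaw_mid h1 h2]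
theorem eRaw_mid_x_of_ne (h1 : 1 ≤ i) (h2 : i ≤ n - 2) (c : ℝ) (b : RVec) {k : ℕ} (hk : k ≠ i)
    (hk' : k ≠ i + 1) : (b.eRaw n i c).x k = b.x k := by simp [eRaw_mid h1 h2, hk, hk']
theorem eRaw_mid_xb_self (h1 : 1 ≤ i) (h2 : i ≤ n - 2) (c : ℝ) (b : RVec) :
    (b.eRaw n i c).xb i = b.xb i / b.xi c (i + 1) := by simp [eRaw_mid h1 h2]
theorem eRaw_mid_xb_succ (h1 : 1 ≤ i) (h2 : i ≤ n - 2) (c : ℝ) (b : RVec) :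
    (b.eRaw n i c).xb (i + 1) = b.xb (i + 1) * b.xi c (i + 1) := by simp [eRaw_mid h1 h2]
theorem eRaw_mid_xb_of_ne (h1 : 1 ≤ i) (h2 : i ≤ n - 2) (c : ℝ) (b : RVec) {k : ℕ} (hk : k ≠ i)
    (hk' : k ≠ i + 1) : (b.eRaw n i c).xb k = b.xb k := by simp [eRaw_mid h1 h2, hk, hk']

theorem eRaw_pred_x_pred (hn : 2 ≤ n) (c : ℝ) (b : RVec) :
    (b.eRaw n (n - 1) c).x (n - 1) = b.x (n - 1) * c := by
  simp [eRaw_pred hn, show n - 1 ≠ n by omega]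
theorem eRaw_pred_x_self (hn : 2 ≤ n) (c : ℝ) (b : RVec) :
    (b.eRaw n (n - 1) c).x n = b.x n / c := by simp [eRaw_pred hn]
theorem eRaw_pred_x_of_ne (hn : 2 ≤ n) (c : ℝ) (b : RVec) {k : ℕ} (hk : k ≠ n - 1) (hk' : k ≠ n) :
    (b.eRaw n (n - 1) c).x k = b.x k := by simp [eRaw_pred hn, hk, hk']
theorem eRaw_pred_xb (hn : 2 ≤ n) (c : ℝ) (b : RVec) (k : ℕ) :
    (b.eRaw n (n - 1) c).xb k = b.xb k := by simp [eRaw_pred hn]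

theorem level_eRaw_mid (hb : b.Pos) (hc : 0 < c) (h1 : 1 ≤ i) (h2 : i ≤ n - 2) :
    (b.eRaw n i c).level n = b.level n := by
  have hx := fun k => (hb.x k).ne'
  have hxb := fun k => (hb.xb k).ne'
  have hxi := (hb.xi hc (i + 1)).ne'
  rw [eRaw_mid h1 h2, level, level]
  simp only
  have m1 : i + 1 ∈ Icc 1 n := by simp; omega
  have m2 : i ∈ Icc 1 n := by simp; omega
  have m3 : i + 1 ∈ Icc 1 (n - 1) := by simp; omega
  have m4 : i ∈ Icc 1 (n - 1) := by simp; omega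
  rw [prod_update_eq m1 (by simpa using hx _), prod_update_eq m2 (hx _),
    prod_update_eq m4 (by simpa using hxb _), prod_update_eq m3 (hxb _)]
  have := hx i; have := hx (i + 1); have := hxb i; have := hxb (i + 1)
  simp
  field_simp

theorem level_eRaw_pred (hb : b.Pos) (hc : 0 < c) (hn : 2 ≤ n) :
    (b.eRaw n (n - 1) c).level n = b.level n := by
  have hx := fun k => (hb.x k).ne'
  rw [eRaw_pred hn, level, level]
  simp only
  have m1 : n ∈ Icc 1 n := by simp; omega
  have m2 : n - 1 ∈ Icc 1 n := by simp; omega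
  have m3 : n ≠ n - 1 := by omega
  rw [prod_update_eq m1 (by simpa [m3] using hx _), prod_update_eq m2 (hx _)]
  have := hx n; have := hx (n - 1)
  simp only [Function.update_of_ne m3]
  field_simp

theorem level_sigma (hb : b.Pos) (hn : 2 ≤ n) : b.sigma.level n = b.level n := by
  have hx := hb.x 1
  have hxb := hb.xb 1
  rw [sigma, level, level]
  simp only
  rw [prod_update_eq (by simp; omega) hx.ne', prod_update_eq (by simp; omega) hxb.ne']
  field_simp

theorem sigma_x_of_ne {k : ℕ} (hk : k ≠ 1) : b.sigma.x k = b.x k := by simp [sigma, hk]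
theorem sigma_xb_of_ne {k : ℕ} (hk : k ≠ 1) : b.sigma.xb k = b.xb k := by simp [sigma, hk]
theorem sigma_x_one : b.sigma.x 1 = b.xb 1 := by simp [sigma]
theorem sigma_xb_one : b.sigma.xb 1 = b.x 1 := by simp [sigma]

end RVec

namespace RPair

variable {n i : ℕ} {p : RPair} {c : ℝ}

theorem Pos.cfst (hp : p.Pos) (hc : 0 < c) (n i : ℕ) : 0 < cfst n i c p := by
  have h1 := hp.1.phi n i; have h2 := hp.2.eps n i
  unfold RPair.cfst; positivity

theorem Pos.csnd (hp : p.Pos) (hc : 0 < c) (n i : ℕ) : 0 < csnd n i c p := by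
  have h1 := hp.1.phi n i; have h2 := hp.2.eps n i
  unfold RPair.csnd; positivity

theorem Pos.eT (hp : p.Pos) (hc : 0 < c) (n i : ℕ) : (eT n i c p).Pos :=
  ⟨hp.1.eRaw (hp.cfst hc n i) n i, hp.2.eRaw (hp.csnd hc n i) n i⟩

theorem localData (hp : p.Pos) (hc : 0 < c) (h1 : 1 ≤ i) (h2 : i ≤ n - 2) :
    LocalData (p.1.x i) (p.1.xb i) (p.1.x (i + 1)) (p.1.xb (i + 1))
      (p.2.x i) (p.2.xb i) (p.2.x (i + 1)) (p.2.xb (i + 1)) c (p.1.phi n i) (p.2.eps n i)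
      (cfst n i c p) (csnd n i c p) (p.1.xi (cfst n i c p) (i + 1))
      (p.2.xi (csnd n i c p) (i + 1)) where
  a_pos := hp.1.x _
  a'_pos := hp.1.xb _
  b_pos := hp.1.x _
  b'_pos := hp.1.xb _
  p_pos := hp.2.x _
  p'_pos := hp.2.xb _
  q_pos := hp.2.x _
  q'_pos := hp.2.xb _
  c_pos := hc
  phi_eq := RVec.phi_mid h1 h2 _
  eps_eq := RVec.eps_mid h1 h2 _
  c₁_eq := rfl
  c₂_eq := rfl
  xi_eq := rfl
  zeta_eq := rfl

theorem gap_eT_mid (hp : p.Pos) (hc : 0 < c) (h1 : 1 ≤ i) (h2 : i ≤ n - 2) :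
    gap n (eT n i c p) = gap n p := by
  simp only [gap, eT, RVec.level_eRaw_mid hp.1 (hp.cfst hc n i) h1 h2,
    RVec.level_eRaw_mid hp.2 (hp.csnd hc n i) h1 h2]

theorem gap_eT_pred (hp : p.Pos) (hc : 0 < c) (hn : 2 ≤ n) :
    gap n (eT n (n - 1) c p) = gap n p := by
  simp only [gap, eT, RVec.level_eRaw_pred hp.1 (hp.cfst hc n _) hn,
    RVec.level_eRaw_pred hp.2 (hp.csnd hc n _) hn]

theorem gap_sigma (hp : p.Pos) (hn : 2 ≤ n) : gap n (sigma p) = gap n p := by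
  simp only [gap, sigma, RVec.level_sigma hp.1 hn, RVec.level_sigma hp.2 hn]

theorem star_phi_mid (h1 : 1 ≤ i) (h2 : i ≤ n - 2) (p : RPair) :
    (star n p).1.phi n i = p.2.eps n i := by
  rw [RVec.phi_mid h1 h2, RVec.eps_mid h1 h2, star_fst_x (by omega), star_fst_x (by omega),
    star_fst_xb (by omega)]

theorem star_eps_mid (h1 : 1 ≤ i) (h2 : i ≤ n - 2) (p : RPair) :
    (star n p).2.eps n i = p.1.phi n i := by
  rw [← star_phi_mid h1 h2, star_star]

/-- The involution reverses the two factors and exchanges `φ_i` of the first with `ε_i` of the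
second. This interchanges the two parameters up to inversion. Statements about `V^*` or the second
factor thus follow from those about `V` or the first factor. -/
theorem star_eT_mid (hp : p.Pos) (hc : 0 < c) (h1 : 1 ≤ i) (h2 : i ≤ n - 2) :
    star n (eT n i c p) = eT n i c⁻¹ (star n p) := by
  have h := localData hp hc h1 h2
  have f1 : cfst n i c⁻¹ (star n p) = (csnd n i c p)⁻¹ := by
    rw [cfst, csnd, star_phi_mid h1 h2, star_eps_mid h1 h2, inv_div]
    congr 1 <;> ring
  have f2 : csnd n i c⁻¹ (star n p) = (cfst n i c p)⁻¹ := by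
    rw [cfst, csnd, star_phi_mid h1 h2, star_eps_mid h1 h2, inv_div, div_inv_eq_mul]
    congr 1 <;> ring
  have g1 : (star n p).1.xi (csnd n i c p)⁻¹ (i + 1)
      = p.2.xi (csnd n i c p) (i + 1) / csnd n i c p := by
    have := h.c₂_pos; have := h.q_pos; have := h.q'_pos
    rw [RVec.xi, RVec.xi, star_fst_x (by omega), star_fst_xb (by omega)]
    field_simp
    ring
  have g2 : (star n p).2.xi (cfst n i c p)⁻¹ (i + 1)
      = p.1.xi (cfst n i c p) (i + 1) / cfst n i c p := by
    have := h.c₁_pos; have := h.b_pos; have := h.b'_pos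
    rw [RVec.xi, RVec.xi, star_snd_x (by omega), star_snd_xb (by omega)]
    field_simp
    ring
  have q1 := h.c₁_pos; have q2 := h.c₂_pos; have q3 := h.xi_pos; have q4 := h.zeta_pos
  have hi : i < n := by omega
  have hi' : i + 1 < n := by omega
  rw [show eT n i c⁻¹ (star n p) = (RVec.eRaw n i (cfst n i c⁻¹ (star n p)) (star n p).1,
    RVec.eRaw n i (csnd n i c⁻¹ (star n p)) (star n p).2) from rfl, f1, f2]
  ext k
  · rcases eq_or_ne k i with rfl | e1
    · rw [star_fst_x hi, RVec.eRaw_mid_x_self h1 h2, star_fst_x hi, g1]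
      simp only [eT]
      rw [RVec.eRaw_mid_xb_self h1 h2]
      field_simp
    rcases eq_or_ne k (i + 1) with rfl | e2
    · rw [star_fst_x hi', RVec.eRaw_mid_x_succ h1 h2, star_fst_x hi', g1]
      simp only [eT]
      rw [RVec.eRaw_mid_xb_succ h1 h2]
      field_simp
    simp [RVec.eRaw_mid_x_of_ne h1 h2 _ _ e1 e2, RVec.eRaw_mid_xb_of_ne h1 h2 _ _ e1 e2, star, eT]
  · rcases eq_or_ne k i with rfl | e1
    · rw [star_fst_xb hi, RVec.eRaw_mid_xb_self h1 h2, star_fst_xb hi, g1]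
      simp only [eT]
      rw [RVec.eRaw_mid_x_self h1 h2]
      field_simp
    rcases eq_or_ne k (i + 1) with rfl | e2
    · rw [star_fst_xb hi', RVec.eRaw_mid_xb_succ h1 h2, star_fst_xb hi', g1]
      simp only [eT]
      rw [RVec.eRaw_mid_x_succ h1 h2]
      field_simp
    simp [RVec.eRaw_mid_x_of_ne h1 h2 _ _ e1 e2, RVec.eRaw_mid_xb_of_ne h1 h2 _ _ e1 e2, star, eT]
  · rcases eq_or_ne k i with rfl | e1
    · rw [star_snd_x hi, RVec.eRaw_mid_x_self h1 h2, star_snd_x hi, g2]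
      simp only [eT]
      rw [RVec.eRaw_mid_xb_self h1 h2]
      field_simp
    rcases eq_or_ne k (i + 1) with rfl | e2
    · rw [star_snd_x hi', RVec.eRaw_mid_x_succ h1 h2, star_snd_x hi', g2]
      simp only [eT]
      rw [RVec.eRaw_mid_xb_succ h1 h2]
      field_simp
    simp [RVec.eRaw_mid_x_of_ne h1 h2 _ _ e1 e2, RVec.eRaw_mid_xb_of_ne h1 h2 _ _ e1 e2, star, eT]
  · rcases eq_or_ne k i with rfl | e1
    · rw [star_snd_xb hi, RVec.eRaw_mid_xb_self h1 h2, star_snd_xb hi, g2]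
      simp only [eT]
      rw [RVec.eRaw_mid_x_self h1 h2]
      field_simp
    rcases eq_or_ne k (i + 1) with rfl | e2
    · rw [star_snd_xb hi', RVec.eRaw_mid_xb_succ h1 h2, star_snd_xb hi', g2]
      simp only [eT]
      rw [RVec.eRaw_mid_x_succ h1 h2]
      field_simp
    simp [RVec.eRaw_mid_x_of_ne h1 h2 _ _ e1 e2, RVec.eRaw_mid_xb_of_ne h1 h2 _ _ e1 e2, star, eT]

/-- The value of `V_i` after `e_i^c`. -/
noncomputable def newV (n i : ℕ) (q : RPair) (v : ℕ → ℝ) : ℝ :=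
  q.2.xb i / q.1.xb i * v (i - 1) + gap n q * (q.2.xb i / q.1.x i + dterm n i q)

/-- The operator touches only the coordinates `i` and `i + 1`, hence two steps of the recursion. At
step `i` the value `newV` is made to fit; at step `i + 1` the old value still fits by
`LocalData.V_next`. -/
theorem IsRec.eT_mid (hp : p.Pos) (hc : 0 < c) (h1 : 1 ≤ i) (h2 : i ≤ n - 2) {v : ℕ → ℝ}
    (h : IsRec n p v) : IsRec n (eT n i c p) (update v i (newV n i (eT n i c p) v)) := by
  have hg := gap_eT_mid hp hc h1 h2
  have hd (j : ℕ) : dterm n j (eT n i c p) = dterm n j p := by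
    simp [dterm, eT, RVec.eRaw_mid_x_of_ne h1 h2 (k := n) _ _ (by omega) (by omega)]
  intro j hj1 hj2
  rcases eq_or_ne j i with rfl | e1
  · rw [Function.update_self, Function.update_of_ne (by omega), newV]
  rcases eq_or_ne j (i + 1) with rfl | e2
  · have hi := h i h1 (by omega)
    rw [dterm, if_neg (by omega : i ≠ n - 1)] at hi
    have hv : newV n i (eT n i c p) v = _ := rfl
    conv_rhs at hv =>
      rw [newV, hg, hd, dterm, if_neg (by omega : i ≠ n - 1)]
      simp only [eT]
      rw [RVec.eRaw_mid_xb_self h1 h2, RVec.eRaw_mid_xb_self h1 h2, RVec.eRaw_mid_x_self h1 h2]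
    rw [Function.update_of_ne (by omega), Nat.add_sub_cancel, Function.update_self, hg, hd,
      h (i + 1) hj1 hj2, Nat.add_sub_cancel]
    generalize newV n i (eT n i c p) v = vh at hv ⊢
    simp only [eT]
    rw [RVec.eRaw_mid_xb_succ h1 h2, RVec.eRaw_mid_xb_succ h1 h2, RVec.eRaw_mid_x_succ h1 h2]
    exact ((localData hp hc h1 h2).V_next (dterm n (i + 1) p) hi hv).symm
  · rw [Function.update_of_ne e1, Function.update_of_ne (by omega), hg, hd, h j hj1 hj2]
    simp only [eT]
    rw [RVec.eRaw_mid_xb_of_ne h1 h2 _ _ e1 e2, RVec.eRaw_mid_xb_of_ne h1 h2 _ _ e1 e2,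
      RVec.eRaw_mid_x_of_ne h1 h2 _ _ e1 e2]

/-- The candidate of `IsRec.eT_mid`, together with its mirror image, solves the whole system for the
new pair, so uniqueness applies. -/
theorem V_eT_mid (hn : 3 ≤ n) (hp : p.Pos) (hA : gap n p ≠ 0) (hc : 0 < c) (h1 : 1 ≤ i)
    (h2 : i ≤ n - 2) {j : ℕ} (hj : j ≤ n - 1) (hji : j ≠ i) : V n j (eT n i c p) = V n j p := by
  have h := isTau_V hn hp
  have hg := gap_eT_mid hp hc h1 h2
  have h' : IsTau n (eT n i c p) _ _ :=
    { fst := h.fst.eT_mid hp hc h1 h2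
      snd := by
        rw [star_eT_mid hp hc h1 h2]
        exact h.snd.eT_mid hp.star (inv_pos.2 hc) h1 h2
      zero := by
        rw [Function.update_of_ne (by omega), Function.update_of_ne (by omega)]
        exact h.zero
      top := by
        rw [Function.update_of_ne (by omega), Function.update_of_ne (by omega), hg]
        simp only [eT]
        rw [RVec.eRaw_mid_x_of_ne h1 h2 _ _ (by omega) (by omega),
          RVec.eRaw_mid_x_of_ne h1 h2 _ _ (by omega) (by omega)]
        exact h.top }
  have := ((isTau_V hn (hp.eT hc n i)).unique hn (hp.eT hc n i) (by rwa [hg]) h' hj).1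
  simpa [hji] using this

theorem gap_star_ne (hn : 3 ≤ n) (hA : gap n p ≠ 0) : gap n (star n p) ≠ 0 := by
  rwa [gap_star (by omega), neg_ne_zero]

theorem Vstar_eT_mid (hn : 3 ≤ n) (hp : p.Pos) (hA : gap n p ≠ 0) (hc : 0 < c) (h1 : 1 ≤ i)
    (h2 : i ≤ n - 2) {j : ℕ} (hj : j ≤ n - 1) (hji : j ≠ i) :
    Vstar n j (eT n i c p) = Vstar n j p := by
  rw [Vstar, star_eT_mid hp hc h1 h2,
    V_eT_mid hn hp.star (gap_star_ne hn hA) (inv_pos.2 hc) h1 h2 hj hji, Vstar]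

/-- Only the step at `1` involves the exchanged coordinates. Solving that step backwards gives the
new value at `0`. -/
theorem IsRec.sigma (hp : p.Pos) (hn : 3 ≤ n) {v : ℕ → ℝ} (h : IsRec n p v) :
    IsRec n (sigma p) (update v 0
      (p.1.x 1 / p.2.x 1 * (v 1 - gap n p * (p.2.x 1 / p.1.xb 1 + 1)))) := by
  have hg := gap_sigma hp (by omega : 2 ≤ n)
  have hd (j : ℕ) : dterm n j (RPair.sigma p) = dterm n j p := by
    simp [dterm, RPair.sigma, RVec.sigma_x_of_ne (show n ≠ 1 by omega)]
  intro j hj1 hj2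
  have a1 := hp.1.x 1; have a2 := hp.2.x 1
  rw [Function.update_of_ne (by omega), hg, hd]
  simp only [RPair.sigma]
  rcases eq_or_ne j 1 with rfl | e1
  · rw [dterm, if_neg (by omega), RVec.sigma_xb_one, RVec.sigma_xb_one, RVec.sigma_x_one]
    simp
    field_simp
    ring
  · rw [Function.update_of_ne (by omega), RVec.sigma_xb_of_ne e1, RVec.sigma_xb_of_ne e1,
      RVec.sigma_x_of_ne e1, h j hj1 hj2]

/-- Besides the recursions, the point to check is that the values at `0` found from `V_1` and from
`V_1^*` coincide. -/
theorem isTau_sigma (hn : 3 ≤ n) (hp : p.Pos) : IsTau n (sigma p)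
    (update (fun i => V n i p) 0
      (p.1.x 1 / p.2.x 1 * (V n 1 p - gap n p * (p.2.x 1 / p.1.xb 1 + 1))))
    (update (fun i => Vstar n i p) 0
      (p.2.xb 1 / p.1.xb 1 * (Vstar n 1 p + gap n p * (p.1.xb 1 / p.2.x 1 + 1)))) := by
  have h := isTau_V hn hp
  have h2 := h.snd.sigma hp.star hn
  have b1 : 1 < n := by omega
  rw [← star_sigma (by omega), gap_star (by omega), star_fst_x b1, star_fst_xb b1, star_snd_x b1]
    at h2
  refine ⟨h.fst.sigma hp hn, ?_, ?_, ?_⟩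
  · convert h2 using 3
    ring
  · have r1 := h.fst 1 le_rfl (by omega)
    have r2 := h.snd 1 le_rfl (by omega)
    have z := h.zero
    rw [dterm, if_neg (by omega)] at r1 r2
    rw [star_snd_xb b1, star_fst_xb b1, star_fst_x b1, gap_star (by omega)] at r2
    simp only [Nat.sub_self] at r1 r2
    simp only [Function.update_self]
    rw [r1, r2, z]
    have := hp.1.x 1; have := hp.2.x 1; have := hp.1.xb 1; have := hp.2.xb 1
    field_simp
    ring
  · rw [Function.update_of_ne (by omega), Function.update_of_ne (by omega),
      gap_sigma hp (by omega)]
    simp only [sigma]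
    rw [RVec.sigma_x_of_ne (by omega), RVec.sigma_x_of_ne (by omega)]
    exact h.top

theorem V_sigma (hn : 3 ≤ n) (hp : p.Pos) (hA : gap n p ≠ 0) {j : ℕ} (hj : j ≤ n - 1)
    (hj0 : j ≠ 0) : V n j (sigma p) = V n j p := by
  have := ((isTau_V hn hp.sigma).unique hn hp.sigma (by rwa [gap_sigma hp (by omega)])
    (isTau_sigma hn hp) hj).1
  simpa [hj0] using this

theorem V_zero_sigma (hn : 3 ≤ n) (hp : p.Pos) (hA : gap n p ≠ 0) : V n 0 (sigma p)
    = p.1.x 1 / p.2.x 1 * (V n 1 p - gap n p * (p.2.x 1 / p.1.xb 1 + 1)) := by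
  have := ((isTau_V hn hp.sigma).unique hn hp.sigma (by rwa [gap_sigma hp (by omega)])
    (isTau_sigma hn hp) (Nat.zero_le _)).1
  simpa using this

theorem Vstar_sigma (hn : 3 ≤ n) (hp : p.Pos) (hA : gap n p ≠ 0) {j : ℕ} (hj : j ≤ n - 1)
    (hj0 : j ≠ 0) : Vstar n j (sigma p) = Vstar n j p := by
  rw [Vstar, star_sigma (by omega), V_sigma hn hp.star (gap_star_ne hn hA) hj hj0, Vstar]

theorem Vstar_pos (hn : 3 ≤ n) (hp : p.Pos) (i : ℕ) : 0 < Vstar n i p := V_pos hn hp.star i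

theorem Vstar_zero (hn : 3 ≤ n) (hp : p.Pos) : Vstar n 0 p = V n 0 p := V_zero_star hn hp

theorem V_rec (hn : 3 ≤ n) (hp : p.Pos) (h1 : 1 ≤ i) (h2 : i ≤ n - 2) :
    V n i p = p.2.xb i / p.1.xb i * V n (i - 1) p + gap n p * (p.2.xb i / p.1.x i + 1) := by
  have := (isTau_V hn hp).fst i h1 (by omega)
  rwa [dterm, if_neg (by omega)] at this

theorem Vstar_rec (hn : 3 ≤ n) (hp : p.Pos) (h1 : 1 ≤ i) (h2 : i ≤ n - 2) :
    Vstar n i p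
      = p.1.x i / p.2.x i * Vstar n (i - 1) p - gap n p * (p.1.x i / p.2.xb i + 1) := by
  have := V_rec hn (hp.star (n := n)) h1 h2
  rw [star_snd_xb (by omega), star_fst_xb (by omega), star_fst_x (by omega),
    gap_star (by omega)] at this
  rw [Vstar, this, Vstar]
  ring

theorem V_rec_last (hn : 3 ≤ n) (hp : p.Pos) :
    V n (n - 1) p = p.2.xb (n - 1) / p.1.xb (n - 1) * V n (n - 2) p
      + gap n p * (p.2.xb (n - 1) / p.1.x (n - 1) + 1 / p.2.x n) := by
  have := (isTau_V hn hp).fst (n - 1) (by omega) le_rfl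
  rwa [dterm, if_pos rfl] at this

theorem Vstar_rec_last (hn : 3 ≤ n) (hp : p.Pos) :
    Vstar n (n - 1) p = p.1.x (n - 1) / p.2.x (n - 1) * Vstar n (n - 2) p
      - gap n p * (p.1.x (n - 1) / p.2.xb (n - 1) + 1 / p.1.x n) := by
  have := V_rec_last hn (hp.star (n := n))
  rw [star_snd_xb (by omega), star_fst_xb (by omega), star_fst_x (by omega),
    gap_star (by omega), star_snd_x_self] at this
  rw [Vstar, this, Vstar]
  ring

/-- For `i ≤ n - 2` a single formula replaces the case distinction in the definition. Through it
`W_i` inherits the invariance of `V_i` and `V_i^*`. -/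
theorem W_eq (hn : 3 ≤ n) (hp : p.Pos) (hA : gap n p ≠ 0) (h2 : i ≤ n - 2) :
    W n i p = V n i p * Vstar n i p + gap n p * (V n i p - Vstar n i p) := by
  have := hp.1.x i; have := hp.2.x i; have := hp.1.xb i; have := hp.2.xb i
  unfold W
  rcases eq_or_ne i 0 with rfl | e0
  · rw [if_pos rfl, Vstar_zero hn hp]; ring
  rcases eq_or_ne i 1 with rfl | e1
  · have r1 := V_rec hn hp le_rfl h2
    have r2 := Vstar_rec hn hp le_rfl h2
    simp only [Nat.sub_self] at r1 r2
    rw [if_neg (by omega), if_pos rfl, V_zero_sigma hn hp hA, r2, r1, Vstar_zero hn hp]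
    field_simp
    ring
  · rw [if_neg e0, if_neg e1, if_neg (by omega), V_rec hn hp (by omega) h2,
      Vstar_rec hn hp (by omega) h2]
    field_simp
    ring

theorem W_last (hn : 3 ≤ n) (p : RPair) :
    W n (n - 1) p = V n (n - 1) p * Vstar n (n - 1) p := by
  rw [W, if_neg (by omega), if_neg (by omega), if_pos rfl]

/-- Here `W_i` is expressed by the values at `i - 1`, which `e_i^c` does not change, so its change
comes from the coordinates alone. For `i = n - 1` the top relation is what makes the formula hold.
-/
theorem W_eq' (hn : 3 ≤ n) (hp : p.Pos) (hA : gap n p ≠ 0) (h1 : 1 ≤ i) (h2 : i ≤ n - 1) :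
    W n i p = p.1.x i * p.2.xb i / (p.1.xb i * p.2.x i) * (V n (i - 1) p * Vstar n (i - 1) p)
      + gap n p * (p.2.xb i / p.2.x i) * Vstar n (i - 1) p
      - gap n p * (p.1.x i / p.1.xb i) * V n (i - 1) p := by
  have := hp.1.x i; have := hp.2.x i; have := hp.1.xb i; have := hp.2.xb i
  rcases eq_or_ne i (n - 1) with rfl | e
  · have a1 := hp.1.x n; have a2 := hp.2.x n
    have t := (isTau_V hn hp).top
    rw [W_last hn]
    rw [Vstar_rec_last hn hp, V_rec_last hn hp] at t ⊢
    rw [show n - 1 - 1 = n - 2 by omega]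
    field_simp at t ⊢
    linear_combination gap n p * t
  · rw [W_eq hn hp hA (by omega), V_rec hn hp h1 (by omega), Vstar_rec hn hp h1 (by omega)]
    field_simp
    ring

theorem W_pos (hn : 3 ≤ n) (hp : p.Pos) (i : ℕ) : 0 < W n i p := by
  have := hp.1.x i; have := hp.2.x i; have := hp.1.xb i; have := hp.2.xb i
  have hV := V_pos hn hp
  have hVs := Vstar_pos hn hp
  have hV' := V_pos hn hp.sigma
  unfold W
  split_ifs
  · exact mul_pos (hV _) (hV _)
  · exact mul_pos (hV _) (hV' _)
  · exact mul_pos (hV _) (hVs _)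
  · exact div_pos (add_pos (div_pos (mul_pos (hV _) (hVs _)) ‹_›)
      (div_pos (mul_pos (hV _) (hVs _)) ‹_›)) (by positivity)

theorem W_star (hn : 3 ≤ n) (hp : p.Pos) (h2 : i ≤ n - 1) : W n i (star n p) = W n i p := by
  unfold W
  have hs (i) : Vstar n i (star n p) = V n i p := by rw [Vstar, star_star]
  have hs' (i) : V n i (star n p) = Vstar n i p := rfl
  split_ifs with e0 e1 e2
  · rw [V_zero_star hn hp]
  · rw [V_zero_star hn hp, ← star_sigma (by omega), V_zero_star hn hp.sigma]
  · rw [hs, hs', mul_comm]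
  · rw [hs, hs, hs', hs', star_snd_x (by omega), star_fst_xb (by omega), star_fst_x (by omega),
      star_snd_xb (by omega)]
    ring

theorem W_eT_mid (hn : 3 ≤ n) (hp : p.Pos) (hA : gap n p ≠ 0) (hc : 0 < c) (h1 : 1 ≤ i)
    (h2 : i ≤ n - 2) {j : ℕ} (hj : j ≤ n - 1) (hji : j ≠ i) :
    W n j (eT n i c p) = W n j p := by
  have hg := gap_eT_mid hp hc h1 h2
  rcases eq_or_ne j (n - 1) with rfl | e
  · rw [W_last hn, W_last hn, V_eT_mid hn hp hA hc h1 h2 hj hji,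
      Vstar_eT_mid hn hp hA hc h1 h2 hj hji]
  · rw [W_eq hn hp hA (by omega), W_eq hn (hp.eT hc n i) (by rwa [hg]) (by omega), hg,
      V_eT_mid hn hp hA hc h1 h2 hj hji, Vstar_eT_mid hn hp hA hc h1 h2 hj hji]

end RPair

end DCrystal

/-! ### The tropical `R`: symmetries and the nodes `0` to `n - 2`. -/

namespace DCrystal

open Function (update)

namespace RPair

variable {n i : ℕ} {p : RPair} {c : ℝ}

/-- The convention `W_0 = V_0²` makes the generic formula valid for `k = 1` too, so that later
computations need no separate case. -/
theorem R_fst_x (hn : 3 ≤ n) (hp : p.Pos) {k : ℕ} (hk : k ≤ n - 1) :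
    (R n p).1.x k = p.2.x k * V n (k - 1) p * W n k p / (V n k p * W n (k - 1) p) := by
  simp only [R]
  split_ifs with h
  · subst h
    have := V_pos hn hp 0; have := V_pos hn hp 1
    simp only [Nat.sub_self, W, if_true, if_neg one_ne_zero]
    field_simp
  · rfl

theorem R_fst_xb (p : RPair) {k : ℕ} (hk : k ≤ n - 1) :
    (R n p).1.xb k = p.2.xb k * V n (k - 1) p / V n k p := by
  simp only [R]
  split_ifs with h
  · subst h; rfl
  · rfl

theorem R_snd_x (hn : 3 ≤ n) (hp : p.Pos) {k : ℕ} (hk : k ≤ n - 1) :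
    (R n p).2.x k = p.1.x k * Vstar n (k - 1) p / Vstar n k p := by
  simp only [R]
  split_ifs with h
  · subst h; rw [Nat.sub_self, Vstar_zero hn hp]
  · rfl

theorem R_snd_xb (hn : 3 ≤ n) (hp : p.Pos) {k : ℕ} (hk : k ≤ n - 1) :
    (R n p).2.xb k
      = p.1.xb k * Vstar n (k - 1) p * W n k p / (Vstar n k p * W n (k - 1) p) := by
  simp only [R]
  split_ifs with h
  · subst h
    have := V_pos hn hp 0; have := Vstar_pos hn hp 1
    rw [Nat.sub_self, Vstar_zero hn hp]
    simp only [W, if_true, if_neg one_ne_zero]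
    field_simp
  · rfl

theorem R_fst_x_self (hn : 3 ≤ n) (p : RPair) :
    (R n p).1.x n = p.2.x n * V n (n - 1) p / Vstar n (n - 1) p := by
  simp only [R, if_true]
  rw [if_neg (by omega), if_neg (by omega)]

theorem R_fst_x_of_lt (hn : 3 ≤ n) (p : RPair) {k : ℕ} (hk : n < k) :
    (R n p).1.x k = 1 := by
  simp only [R]
  rw [if_neg (by omega), if_neg (by omega), if_neg (by omega)]

theorem R_snd_x_self (hn : 3 ≤ n) (p : RPair) :
    (R n p).2.x n = p.1.x n * Vstar n (n - 1) p / V n (n - 1) p := by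
  simp only [R, if_true]
  rw [if_neg (by omega), if_neg (by omega)]

theorem R_snd_x_of_lt (hn : 3 ≤ n) (p : RPair) {k : ℕ} (hk : n < k) :
    (R n p).2.x k = 1 := by
  simp only [R]
  rw [if_neg (by omega), if_neg (by omega), if_neg (by omega)]

theorem R_fst_xb_of_le (hn : 3 ≤ n) (p : RPair) {k : ℕ} (hk : n ≤ k) : (R n p).1.xb k = 1 := by
  simp only [R]
  rw [if_neg (by omega), if_neg (by omega)]

theorem R_snd_xb_of_le (hn : 3 ≤ n) (p : RPair) {k : ℕ} (hk : n ≤ k) : (R n p).2.xb k = 1 := by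
  simp only [R]
  rw [if_neg (by omega), if_neg (by omega)]

theorem Pos.R (hn : 3 ≤ n) (hp : p.Pos) : (R n p).Pos := by
  have hV := V_pos hn hp; have hVs := Vstar_pos hn hp; have hW := W_pos hn hp
  have a1 := hp.1.x; have a2 := hp.1.xb; have a3 := hp.2.x; have a4 := hp.2.xb
  refine ⟨⟨fun k => ?_, fun k => ?_⟩, ⟨fun k => ?_, fun k => ?_⟩⟩ <;>
    rcases le_or_gt k (n - 1) with h | h
  · rw [R_fst_x hn hp h]
    exact div_pos (mul_pos (mul_pos (a3 _) (hV _)) (hW _)) (mul_pos (hV _) (hW _))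
  · rcases eq_or_ne k n with rfl | e
    · rw [R_fst_x_self hn p]
      exact div_pos (mul_pos (a3 _) (hV _)) (hVs _)
    · rw [R_fst_x_of_lt hn p (by omega)]
      exact one_pos
  · rw [R_fst_xb p h]
    exact div_pos (mul_pos (a4 _) (hV _)) (hV _)
  · rw [R_fst_xb_of_le hn p (by omega)]
    exact one_pos
  · rw [R_snd_x hn hp h]
    exact div_pos (mul_pos (a1 _) (hVs _)) (hVs _)
  · rcases eq_or_ne k n with rfl | e
    · rw [R_snd_x_self hn p]
      exact div_pos (mul_pos (a1 _) (hVs _)) (hV _)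
    · rw [R_snd_x_of_lt hn p (by omega)]
      exact one_pos
  · rw [R_snd_xb hn hp h]
    exact div_pos (mul_pos (mul_pos (a2 _) (hVs _)) (hW _)) (mul_pos (hVs _) (hW _))
  · rw [R_snd_xb_of_le hn p (by omega)]
    exact one_pos

theorem Vstar_star (n i : ℕ) (p : RPair) : Vstar n i (star n p) = V n i p := by
  rw [Vstar, star_star]

theorem star_fst_x_of_le {k : ℕ} (h : n ≤ k) (p : RPair) : (star n p).1.x k = p.2.x k :=
  if_neg (by omega)
theorem star_fst_xb_of_le {k : ℕ} (h : n ≤ k) (p : RPair) : (star n p).1.xb k = p.2.xb k :=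
  if_neg (by omega)

/-- The first component of `star n q` carries the second component of `q`. Since `R` commutes with
`*`, identities for `R` need only be checked on first components. -/
theorem ext_star {q r : RPair} (n : ℕ) (h : q.1 = r.1) (h' : (star n q).1 = (star n r).1) :
    q = r := by
  refine Prod.ext h ?_
  have e : (star n (star n q)).2 = (star n (star n r)).2 := by
    rw [star, h']
    rfl
  rwa [star_star, star_star] at e

theorem R_star_fst (hn : 3 ≤ n) (hp : p.Pos) : (R n (star n p)).1 = (star n (R n p)).1 := by
  ext k <;> rcases lt_or_ge k n with h | h
  · rw [R_fst_x hn hp.star (by omega), star_fst_x h, R_snd_xb hn hp (by omega), star_snd_x h,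
      W_star hn hp (by omega), W_star hn hp (by omega)]
    rfl
  · rw [star_fst_x_of_le h]
    rcases eq_or_ne k n with rfl | e
    · rw [R_fst_x_self hn, R_snd_x_self hn, star_snd_x_self, Vstar_star]
      rfl
    · rw [R_fst_x_of_lt hn _ (by omega), R_snd_x_of_lt hn _ (by omega)]
  · rw [R_fst_xb _ (by omega), star_fst_xb h, R_snd_x hn hp (by omega), star_snd_xb h]
    rfl
  · rw [R_fst_xb_of_le hn _ h, star_fst_xb_of_le h, R_snd_xb_of_le hn _ h]

theorem R_star (hn : 3 ≤ n) (hp : p.Pos) : R n (star n p) = star n (R n p) := by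
  refine ext_star n (R_star_fst hn hp) ?_
  rw [← R_star_fst hn hp.star, star_star, star_star]

theorem W_sigma (hn : 3 ≤ n) (hp : p.Pos) (hA : gap n p ≠ 0) {j : ℕ} (h1 : j ≤ n - 1)
    (h2 : j ≠ 0) : W n j (sigma p) = W n j p := by
  rcases eq_or_ne j 1 with rfl | e1
  · rw [W, W, if_neg one_ne_zero, if_pos rfl, if_neg one_ne_zero, if_pos rfl, sigma_sigma,
      mul_comm]
  rcases eq_or_ne j (n - 1) with rfl | e2
  · rw [W_last hn, W_last hn, V_sigma hn hp hA le_rfl h2, Vstar_sigma hn hp hA le_rfl h2]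
  · rw [W_eq hn hp hA (by omega), W_eq hn hp.sigma (by rwa [gap_sigma hp (by omega)]) (by omega),
      V_sigma hn hp hA h1 h2, Vstar_sigma hn hp hA h1 h2, gap_sigma hp (by omega)]

/-- All `V_j`, `V_j^*` and `W_j` with `j ≥ 1` are invariant under `σ₁`, while `V_0` and `V_0^{σ₁}`
are exchanged, which exchanges the formulas for `x'_1` and `x̄'_1`. -/
theorem R_sigma_fst (hn : 3 ≤ n) (hp : p.Pos) (hA : gap n p ≠ 0) :
    (R n (sigma p)).1 = (R n p).1.sigma := by
  have hV (j) (h1 : j ≤ n - 1) (h2 : j ≠ 0) := V_sigma hn hp hA h1 h2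
  have hW (j) (h1 : j ≤ n - 1) (h2 : j ≠ 0) := W_sigma hn hp hA h1 h2
  have hV1 := hV 1 (by omega) one_ne_zero
  have p1 := V_pos hn hp 0; have p2 := W_pos hn hp 0
  have p3 := V_pos hn hp.sigma 0; have p4 := W_pos hn hp.sigma 0
  ext k <;> rcases eq_or_ne k 1 with rfl | e1
  · rw [RVec.sigma_x_one]
    simp only [R, if_true, sigma_sigma, hV1]
    rw [show (sigma p).2.x 1 = p.2.xb 1 from RVec.sigma_x_one]
  · rw [RVec.sigma_x_of_ne e1]
    rcases le_or_gt k (n - 1) with h | h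
    · rw [R_fst_x hn hp h, R_fst_x hn hp.sigma h,
        show (sigma p).2.x k = p.2.x k from RVec.sigma_x_of_ne e1]
      rcases eq_or_ne k 0 with rfl | e0
      · field_simp
      rw [hV k h e0, hW k h e0, hV (k - 1) (by omega) (by omega), hW (k - 1) (by omega) (by omega)]
    · rcases eq_or_ne k n with rfl | e
      · rw [R_fst_x_self hn, R_fst_x_self hn, hV _ le_rfl (by omega),
          Vstar_sigma hn hp hA le_rfl (by omega),
          show (sigma p).2.x k = p.2.x k from RVec.sigma_x_of_ne (by omega)]
      · rw [R_fst_x_of_lt hn _ (by omega), R_fst_x_of_lt hn _ (by omega)]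
  · rw [RVec.sigma_xb_one]
    simp only [R, if_true, hV1]
    rw [show (sigma p).2.xb 1 = p.2.x 1 from RVec.sigma_xb_one]
  · rw [RVec.sigma_xb_of_ne e1]
    rcases le_or_gt k (n - 1) with h | h
    · rw [R_fst_xb _ h, R_fst_xb _ h,
        show (sigma p).2.xb k = p.2.xb k from RVec.sigma_xb_of_ne e1]
      rcases eq_or_ne k 0 with rfl | e0
      · field_simp
      rw [hV k h e0, hV (k - 1) (by omega) (by omega)]
    · rw [R_fst_xb_of_le hn _ (by omega), R_fst_xb_of_le hn _ (by omega)]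

theorem R_sigma (hn : 3 ≤ n) (hp : p.Pos) (hA : gap n p ≠ 0) :
    R n (sigma p) = sigma (R n p) := by
  refine ext_star n (R_sigma_fst hn hp hA) ?_
  rw [← R_star_fst hn hp.sigma, star_sigma (by omega),
    R_sigma_fst hn hp.star (gap_star_ne hn hA), star_sigma (by omega), R_star hn hp]
  rfl

section Mid

/-- The relations that the lemmas about `LocalData` need. -/
theorem mid_relations (hn : 3 ≤ n) (hp : p.Pos) (hA : gap n p ≠ 0) (hc : 0 < c) (h1 : 1 ≤ i)
    (h2 : i ≤ n - 2) :
    W n i (eT n i c p) * csnd n i c p = W n i p * cfst n i c (R n p) ∧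
    V n i (eT n i c p) * p.2.xi (csnd n i c p) (i + 1)
      = V n i p * (R n p).1.xi (cfst n i c (R n p)) (i + 1) ∧
    eps n i (R n p) = eps n i p := by
  have hL := localData hp hc h1 h2
  have hg := gap_eT_mid hp hc h1 h2
  have hpe := hp.eT hc n i
  have hV := V_pos hn hp; have hVs := Vstar_pos hn hp; have hW := W_pos hn hp
  have rV := V_rec hn hp h1 h2
  have rVs := Vstar_rec hn hp h1 h2
  have rW := W_eq hn hp hA h2
  have rW' := W_eq' hn hp hA h1 (by omega)
  have rW2 := W_eq' hn hp hA (i := i + 1) (by omega) (by omega)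
  have rVh := V_rec hn hpe h1 h2
  have rWh := W_eq' hn hpe (by rwa [hg]) h1 (by omega)
  rw [hg, V_eT_mid hn hp hA hc h1 h2 (j := i - 1) (by omega) (by omega)] at rVh rWh
  rw [Vstar_eT_mid hn hp hA hc h1 h2 (j := i - 1) (by omega) (by omega)] at rWh
  generalize hwh : W n i (eT n i c p) = wh at rWh ⊢
  generalize hvh : V n i (eT n i c p) = vh at rVh ⊢
  simp only [eT, RVec.eRaw_mid_xb_self h1 h2, RVec.eRaw_mid_x_self h1 h2] at rVh rWh
  rw [Nat.add_sub_cancel] at rW2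
  have eφ : (R n p).1.phi n i = _ := RVec.phi_mid h1 h2 _
  have eε : (R n p).2.eps n i = _ := RVec.eps_mid h1 h2 _
  rw [R_fst_x hn hp (by omega), R_fst_xb _ (by omega), R_fst_x hn hp (by omega),
    Nat.add_sub_cancel] at eφ
  rw [R_snd_xb hn hp (by omega), R_snd_x hn hp (by omega), R_snd_xb hn hp (by omega),
    Nat.add_sub_cancel] at eε
  refine ⟨?_, ?_, ?_⟩
  · exact hL.W_image (hW _) (hW _) (hW _) (hV _) (hVs _) (hV _) (hVs _) rV rVs rW rW' rW2 rWh eφ eε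
  · rw [RVec.xi.eq_1 _ (R n p).1, R_fst_x hn hp (by omega), R_fst_xb _ (by omega),
      Nat.add_sub_cancel]
    exact hL.V_image (hW _) (hW _) (hW _) (hV _) (hVs _) (hV _) (hVs _) rV rVs rW rW' rW2 rVh eφ eε
  · rw [eps, eps, RVec.eps_mid h1 h2 (R n p).1, RVec.eps_mid h1 h2 p.1, R_fst_x hn hp (by omega),
      R_fst_xb _ (by omega), R_fst_xb _ (by omega), Nat.add_sub_cancel]
    exact hL.tensor_eps_image (hW _) (hW _) (hW _) (hV _) (hVs _) (hV _) (hVs _) (hV _)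
      rV rVs rW rW' rW2 eφ eε

/-- Of the `V` and `W` that enter the first component, only `V_i` and `W_i` change. By
`mid_relations` their changes combine with those of `y` so that the coordinates `i` and `i + 1`
acquire exactly the factors of `e_i^c` on the image. -/
theorem R_eT_mid_fst (hn : 3 ≤ n) (hp : p.Pos) (hA : gap n p ≠ 0) (hc : 0 < c) (h1 : 1 ≤ i)
    (h2 : i ≤ n - 2) : (R n (eT n i c p)).1 = (eT n i c (R n p)).1 := by
  obtain ⟨rW, rV, -⟩ := mid_relations hn hp hA hc h1 h2
  have hpe := hp.eT hc n i
  have hR := hp.R hn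
  have hV := V_pos hn hp; have hVs := Vstar_pos hn hp; have hW := W_pos hn hp
  have hc1 := hR.cfst hc n i
  have hc2 := hp.csnd hc n i
  have hζ := hp.2.xi hc2 (i + 1)
  have hξ := hR.1.xi hc1 (i + 1)
  have iV (j) (h : j ≤ n - 1) (h' : j ≠ i) := V_eT_mid hn hp hA hc h1 h2 h h'
  have iVs (j) (h : j ≤ n - 1) (h' : j ≠ i) := Vstar_eT_mid hn hp hA hc h1 h2 h h'
  have iW (j) (h : j ≤ n - 1) (h' : j ≠ i) := W_eT_mid hn hp hA hc h1 h2 h h'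
  rw [← eq_div_iff hζ.ne'] at rV
  rw [← eq_div_iff hc2.ne'] at rW
  have v0 := hV (i - 1); have v1 := hV i; have v2 := hV (i + 1)
  have w0 := hW (i - 1); have w1 := hW i; have w2 := hW (i + 1)
  change _ = (R n p).1.eRaw n i (cfst n i c (R n p))
  ext k <;> rcases eq_or_ne k i with rfl | e1
  · rw [RVec.eRaw_mid_x_self h1 h2, R_fst_x hn hpe (by omega), R_fst_x hn hp (by omega),
      iV (k - 1) (by omega) (by omega), iW (k - 1) (by omega) (by omega), rV, rW]
    simp only [eT]
    rw [RVec.eRaw_mid_x_self h1 h2]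
    field_simp
  · rcases eq_or_ne k (i + 1) with rfl | e2
    · rw [RVec.eRaw_mid_x_succ h1 h2, R_fst_x hn hpe (by omega), R_fst_x hn hp (by omega),
        Nat.add_sub_cancel, iV (i + 1) (by omega) (by omega), iW (i + 1) (by omega) (by omega), rV, rW]
      simp only [eT]
      rw [RVec.eRaw_mid_x_succ h1 h2]
      field_simp
    rw [RVec.eRaw_mid_x_of_ne h1 h2 _ _ e1 e2]
    rcases le_or_gt k (n - 1) with h | h
    · rw [R_fst_x hn hpe h, R_fst_x hn hp h, iV k h e1, iW k h e1, iV (k - 1) (by omega) (by omega),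
        iW (k - 1) (by omega) (by omega)]
      simp only [eT]
      rw [RVec.eRaw_mid_x_of_ne h1 h2 _ _ e1 e2]
    · rcases eq_or_ne k n with rfl | e
      · rw [R_fst_x_self hn, R_fst_x_self hn, iV _ le_rfl (by omega), iVs _ le_rfl (by omega)]
        simp only [eT]
        rw [RVec.eRaw_mid_x_of_ne h1 h2 _ _ (by omega) (by omega)]
      · rw [R_fst_x_of_lt hn _ (by omega), R_fst_x_of_lt hn _ (by omega)]
  · rw [RVec.eRaw_mid_xb_self h1 h2, R_fst_xb _ (by omega), R_fst_xb _ (by omega),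
      iV (k - 1) (by omega) (by omega), rV]
    simp only [eT]
    rw [RVec.eRaw_mid_xb_self h1 h2]
    field_simp
  · rcases eq_or_ne k (i + 1) with rfl | e2
    · rw [RVec.eRaw_mid_xb_succ h1 h2, R_fst_xb _ (by omega), R_fst_xb _ (by omega),
        Nat.add_sub_cancel, iV (i + 1) (by omega) (by omega), rV]
      simp only [eT]
      rw [RVec.eRaw_mid_xb_succ h1 h2]
      field_simp
    rw [RVec.eRaw_mid_xb_of_ne h1 h2 _ _ e1 e2]
    rcases le_or_gt k (n - 1) with h | h
    · rw [R_fst_xb _ h, R_fst_xb _ h, iV k h e1, iV (k - 1) (by omega) (by omega)]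
      simp only [eT]
      rw [RVec.eRaw_mid_xb_of_ne h1 h2 _ _ e1 e2]
    · rw [R_fst_xb_of_le hn _ (by omega), R_fst_xb_of_le hn _ (by omega)]

theorem R_eT_mid (hn : 3 ≤ n) (hp : p.Pos) (hA : gap n p ≠ 0) (hc : 0 < c) (h1 : 1 ≤ i)
    (h2 : i ≤ n - 2) : R n (eT n i c p) = eT n i c (R n p) := by
  refine ext_star n (R_eT_mid_fst hn hp hA hc h1 h2) ?_
  rw [← R_star_fst hn (hp.eT hc n i), star_eT_mid hp hc h1 h2,
    R_eT_mid_fst hn hp.star (gap_star_ne hn hA) (inv_pos.2 hc) h1 h2,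
    star_eT_mid (hp.R hn) hc h1 h2, R_star hn hp]

theorem eps_R_mid (hn : 3 ≤ n) (hp : p.Pos) (hA : gap n p ≠ 0) (h1 : 1 ≤ i)
    (h2 : i ≤ n - 2) : eps n i (R n p) = eps n i p :=
  (mid_relations hn hp hA one_pos h1 h2).2.2

theorem phi_eq_eps_star_mid (h1 : 1 ≤ i) (h2 : i ≤ n - 2) (p : RPair) :
    phi n i p = eps n i (star n p) := by
  rw [phi, eps, star_phi_mid h1 h2, star_eps_mid h1 h2, RVec.eps_mid h1 h2 (star n p).1,
    RVec.phi_mid h1 h2 p.2, star_fst_xb (by omega), star_fst_xb (by omega), star_fst_x (by omega)]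

theorem phi_R_mid (hn : 3 ≤ n) (hp : p.Pos) (hA : gap n p ≠ 0) (h1 : 1 ≤ i)
    (h2 : i ≤ n - 2) : phi n i (R n p) = phi n i p := by
  rw [phi_eq_eps_star_mid h1 h2, phi_eq_eps_star_mid h1 h2, ← R_star hn hp,
    eps_R_mid hn hp.star (gap_star_ne hn hA) h1 h2]

end Mid

section Zero

theorem sigma_phi_one (hn : 3 ≤ n) (b : RVec) : b.sigma.phi n 1 = b.phi n 0 := by
  rw [RVec.phi_mid le_rfl (by omega), RVec.sigma_x_one, RVec.sigma_x_of_ne (by omega),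
    RVec.sigma_xb_of_ne (by omega), RVec.phi, if_pos rfl]

theorem sigma_eps_one (hn : 3 ≤ n) (b : RVec) : b.sigma.eps n 1 = b.eps n 0 := by
  rw [RVec.eps_mid le_rfl (by omega), RVec.sigma_xb_one, RVec.sigma_x_of_ne (by omega),
    RVec.sigma_xb_of_ne (by omega), RVec.eps, if_pos rfl]

theorem sigma_eRaw_one (hn : 3 ≤ n) (c : ℝ) (b : RVec) :
    (b.sigma.eRaw n 1 c).sigma = b.eRaw n 0 c := by
  have e : b.sigma.xi c 2 = b.xi c 2 := by
    rw [RVec.xi, RVec.sigma_x_of_ne (by omega), RVec.sigma_xb_of_ne (by omega), RVec.xi]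
  rw [RVec.eRaw_mid le_rfl (by omega), e, RVec.eRaw, if_pos rfl]
  ext k <;> by_cases h1 : k = 1 <;> by_cases h2 : k = 2 <;>
    simp_all [RVec.sigma]

/-- The exchange `σ₁` realises the diagram automorphism that swaps the nodes `0` and `1`; everything
about node `0` is transported from node `1` in this way. -/
theorem eT_zero (hn : 3 ≤ n) (c : ℝ) (p : RPair) : eT n 0 c p = sigma (eT n 1 c (sigma p)) := by
  simp only [eT, sigma, cfst, csnd, sigma_phi_one hn, sigma_eps_one hn, sigma_eRaw_one hn]

theorem R_eT_zero (hn : 3 ≤ n) (hp : p.Pos) (hA : gap n p ≠ 0) (hc : 0 < c) :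
    R n (eT n 0 c p) = eT n 0 c (R n p) := by
  have hg : gap n (sigma p) ≠ 0 := by rwa [gap_sigma hp (by omega)]
  rw [eT_zero hn, eT_zero hn, R_sigma hn (hp.sigma.eT hc n 1)
    (by rwa [gap_eT_mid hp.sigma hc le_rfl (by omega)]),
    R_eT_mid hn hp.sigma hg hc le_rfl (by omega), R_sigma hn hp hA]

theorem eps_zero (hn : 3 ≤ n) (p : RPair) : eps n 0 p = eps n 1 (sigma p) := by
  simp only [eps, sigma, sigma_phi_one hn, sigma_eps_one hn]

theorem phi_zero (hn : 3 ≤ n) (p : RPair) : phi n 0 p = phi n 1 (sigma p) := by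
  simp only [phi, sigma, sigma_phi_one hn, sigma_eps_one hn]

theorem eps_R_zero (hn : 3 ≤ n) (hp : p.Pos) (hA : gap n p ≠ 0) :
    eps n 0 (R n p) = eps n 0 p := by
  rw [eps_zero hn, eps_zero hn, ← R_sigma hn hp hA,
    eps_R_mid hn hp.sigma (by rwa [gap_sigma hp (by omega)]) le_rfl (by omega)]

theorem phi_R_zero (hn : 3 ≤ n) (hp : p.Pos) (hA : gap n p ≠ 0) :
    phi n 0 (R n p) = phi n 0 p := by
  rw [phi_zero hn, phi_zero hn, ← R_sigma hn hp hA,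
    phi_R_mid hn hp.sigma (by rwa [gap_sigma hp (by omega)]) le_rfl (by omega)]

end Zero

end RPair

end DCrystal

/-! ### The nodes `n - 1` and `n`. -/

namespace DCrystal

open Function (update)

/-- The quantities that enter the action of `e_{n-1}^c` on a pair. -/
structure LocalPred (a a' s p p' t c c₁ c₂ v vs v₁ vs₁ A : ℝ) : Prop where
  a_pos : 0 < a
  a'_pos : 0 < a'
  s_pos : 0 < s
  p_pos : 0 < p
  p'_pos : 0 < p'
  t_pos : 0 < t
  c_pos : 0 < c
  c₁_eq : c₁ = (c * a + t * p') / (a + t * p')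
  c₂_eq : c₂ = (a + t * p') / (a + t * p' / c)
  v_pos : 0 < v
  vs_pos : 0 < vs
  v₁_pos : 0 < v₁
  vs₁_pos : 0 < vs₁
  v₁_eq : v₁ = p' / a' * v + A * (p' / a + 1 / t)
  vs₁_eq : vs₁ = a / p * vs - A * (a / p' + 1 / s)
  top : s * vs₁ - t * v₁ = A * (s * t - 1)

namespace LocalPred

variable {a a' s p p' t c c₁ c₂ v vs v₁ vs₁ A : ℝ}

theorem c₂_eq' (h : LocalPred a a' s p p' t c c₁ c₂ v vs v₁ vs₁ A) : c₂ = c / c₁ := by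
  have := h.a_pos; have := h.t_pos; have := h.p'_pos; have := h.c_pos
  have : 0 < c * a + t * p' := by positivity
  rw [h.c₁_eq, h.c₂_eq]; field_simp

/-- The changes of `p'/a` and of `1/t` cancel, so that at this node no `V_j` changes at all. -/
theorem V_last (h : LocalPred a a' s p p' t c c₁ c₂ v vs v₁ vs₁ A) :
    p' / a' * v + A * (p' / (a * c₁) + 1 / (t / c₂)) = v₁ := by
  have := h.a_pos; have := h.t_pos; have := h.p'_pos; have := h.c_pos
  have := h.a'_pos
  have : 0 < c * a + t * p' := by positivity
  rw [h.v₁_eq, h.c₂_eq', h.c₁_eq]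
  field_simp
  ring

theorem top_new (h : LocalPred a a' s p p' t c c₁ c₂ v vs v₁ vs₁ A) :
    s / c₁ * (a * c₁ / (p * c₂) * vs - A * (a * c₁ / p' + 1 / (s / c₁))) - t / c₂ * v₁
      = A * (s / c₁ * (t / c₂) - 1) := by
  have := h.a_pos; have := h.t_pos; have := h.p'_pos; have := h.c_pos
  have := h.a'_pos; have := h.s_pos; have := h.p_pos
  have : 0 < c * a + t * p' := by positivity
  have ht := h.top
  rw [h.vs₁_eq] at ht
  rw [h.c₂_eq', h.c₁_eq]
  field_simp at ht ⊢
  linear_combination (c * a + t * p') * ht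

/-- Once the recursions are inserted, the two sides differ by a multiple of the top relation. The
left side is, up to a factor, `φ' + ε'` of the image, so this sum is controlled by `vs₁`. -/
theorem key (h : LocalPred a a' s p p' t c c₁ c₂ v vs v₁ vs₁ A) :
    p * v + s * a' * vs = vs₁ * (s * a' * p * (a + t * p') / (a * t * p')) := by
  have := h.a_pos; have := h.t_pos; have := h.p'_pos
  have := h.a'_pos; have := h.s_pos; have := h.p_pos
  have ht := h.top
  have e : (p * v + s * a' * vs) - vs₁ * (s * a' * p * (a + t * p') / (a * t * p'))
      = -(a' * p / (t * p')) * ((s * vs₁ - t * v₁) - A * (s * t - 1)) := by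
    rw [h.vs₁_eq, h.v₁_eq]
    field_simp
    ring
  rw [ht] at e
  linear_combination e

theorem V_image (h : LocalPred a a' s p p' t c c₁ c₂ v vs v₁ vs₁ A) {w₀ φ' ε' : ℝ}
    (hw₀ : 0 < w₀) (hφ : φ' = p * v * (v₁ * vs₁) / (v₁ * w₀))
    (hε : ε' = s * vs₁ / v₁ * (a' * vs * (v₁ * vs₁) / (vs₁ * w₀))) :
    (a * c₁ / (p * c₂) * vs - A * (a * c₁ / p' + 1 / (s / c₁))) * c₂
      = vs₁ * ((c * φ' + ε') / (φ' + ε')) := by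
  have := h.a_pos; have := h.t_pos; have := h.p'_pos; have := h.c_pos
  have := h.a'_pos; have := h.s_pos; have := h.p_pos; have := h.v₁_pos; have := h.vs₁_pos
  have := h.v_pos; have := h.vs_pos
  have hK := h.key
  have : 0 < c * a + t * p' := by positivity
  have e1 : (c * φ' + ε') / (φ' + ε')
      = (c * (p * v + s * a' * vs) + (1 - c) * (s * a' * vs)) / (p * v + s * a' * vs) := by
    rw [hφ, hε]
    have : 0 < p * v + s * a' * vs := by positivity
    field_simp
    ring
  have e2 : vs₁ * ((c * φ' + ε') / (φ' + ε'))
      = c * vs₁ + (1 - c) * (a * t * p' * vs) / (p * (a + t * p')) := by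
    rw [e1, hK]
    field_simp
  rw [e2, h.c₂_eq', h.c₁_eq, h.vs₁_eq]
  field_simp
  ring

theorem tensor_eps_image (h : LocalPred a a' s p p' t c c₁ c₂ v vs v₁ vs₁ A) {w₀ φ' ε' : ℝ}
    (hw₀ : 0 < w₀) (hφ : φ' = p * v * (v₁ * vs₁) / (v₁ * w₀))
    (hε : ε' = s * vs₁ / v₁ * (a' * vs * (v₁ * vs₁) / (vs₁ * w₀))) :
    t * v₁ / vs₁ * (p' * v / v₁) * (1 + ε' / φ') = s * a' * (1 + t * p' / a) := by
  have := h.a_pos; have := h.t_pos; have := h.p'_pos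
  have := h.a'_pos; have := h.s_pos; have := h.p_pos; have := h.v₁_pos; have := h.vs₁_pos
  have := h.v_pos; have := h.vs_pos
  have hK := h.key
  have e : 1 + ε' / φ' = (p * v + s * a' * vs) / (p * v) := by
    rw [hφ, hε]
    field_simp
  rw [e, hK]
  field_simp

theorem tensor_phi_image (h : LocalPred a a' s p p' t c c₁ c₂ v vs v₁ vs₁ A) {w₀ φ' ε' : ℝ}
    (hw₀ : 0 < w₀) (hφ : φ' = p * v * (v₁ * vs₁) / (v₁ * w₀))
    (hε : ε' = s * vs₁ / v₁ * (a' * vs * (v₁ * vs₁) / (vs₁ * w₀))) :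
    a * vs / vs₁ * (1 + φ' / ε') = p * (1 + a / (t * p')) := by
  have := h.a_pos; have := h.t_pos; have := h.p'_pos
  have := h.a'_pos; have := h.s_pos; have := h.p_pos; have := h.v₁_pos; have := h.vs₁_pos
  have := h.v_pos; have := h.vs_pos
  have hK := h.key
  have e : 1 + φ' / ε' = (p * v + s * a' * vs) / (s * a' * vs) := by
    rw [hφ, hε]
    field_simp
    ring
  rw [e, hK]
  field_simp
  ring

end LocalPred

namespace RPair

variable {n i : ℕ} {p : RPair} {c : ℝ}

theorem localPred (hn : 3 ≤ n) (hp : p.Pos) (hc : 0 < c) :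
    LocalPred (p.1.x (n - 1)) (p.1.xb (n - 1)) (p.1.x n) (p.2.x (n - 1)) (p.2.xb (n - 1))
      (p.2.x n) c (cfst n (n - 1) c p) (csnd n (n - 1) c p) (V n (n - 2) p) (Vstar n (n - 2) p)
      (V n (n - 1) p) (Vstar n (n - 1) p) (gap n p) where
  a_pos := hp.1.x _
  a'_pos := hp.1.xb _
  s_pos := hp.1.x _
  p_pos := hp.2.x _
  p'_pos := hp.2.xb _
  t_pos := hp.2.x _
  c_pos := hc
  c₁_eq := by rw [cfst, RVec.phi_pred (by omega), RVec.eps_pred (by omega)]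
  c₂_eq := by rw [csnd, RVec.phi_pred (by omega), RVec.eps_pred (by omega)]
  v_pos := V_pos hn hp _
  vs_pos := Vstar_pos hn hp _
  v₁_pos := V_pos hn hp _
  vs₁_pos := Vstar_pos hn hp _
  v₁_eq := V_rec_last hn hp
  vs₁_eq := Vstar_rec_last hn hp
  top := V_top hn hp

/-- All values are kept except `V_{n-1}^*`, which receives the value dictated by its own recursion.
Compatibility with the top relation is `LocalPred.top_new`. -/
theorem isTau_eT_pred (hn : 3 ≤ n) (hp : p.Pos) (hc : 0 < c) :
    IsTau n (eT n (n - 1) c p) (fun i => V n i p)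
      (update (fun i => Vstar n i p) (n - 1)
        (p.1.x (n - 1) * cfst n (n - 1) c p / (p.2.x (n - 1) * csnd n (n - 1) c p)
            * Vstar n (n - 2) p
          - gap n p * (p.1.x (n - 1) * cfst n (n - 1) c p / p.2.xb (n - 1)
            + 1 / (p.1.x n / cfst n (n - 1) c p)))) := by
  have h := isTau_V hn hp
  have hL := localPred hn hp hc
  have hg := gap_eT_pred hp hc (by omega : 2 ≤ n)
  have hn2 : 2 ≤ n := by omega
  have hn1 : n - 1 < n := by omega
  refine ⟨fun j hj1 hj2 => ?_, fun j hj1 hj2 => ?_, ?_, ?_⟩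
  · rw [hg]
    rcases eq_or_ne j (n - 1) with rfl | e
    · rw [dterm, if_pos rfl]
      simp only [eT]
      rw [RVec.eRaw_pred_xb hn2, RVec.eRaw_pred_xb hn2, RVec.eRaw_pred_x_pred hn2,
        RVec.eRaw_pred_x_self hn2, show n - 1 - 1 = n - 2 by omega, hL.V_last]
    · rw [dterm, if_neg e]
      simp only [eT]
      rw [RVec.eRaw_pred_xb hn2, RVec.eRaw_pred_xb hn2, RVec.eRaw_pred_x_of_ne hn2 _ _ e (by omega),
        V_rec hn hp hj1 (by omega)]
  · rw [gap_star (by omega), hg, star_snd_xb (by omega), star_fst_xb (by omega),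
      star_fst_x (by omega), dterm, star_snd_x_self]
    simp only [eT]
    rcases eq_or_ne j (n - 1) with rfl | e
    · rw [if_pos rfl, Function.update_self, Function.update_of_ne (by omega),
        RVec.eRaw_pred_xb hn2, RVec.eRaw_pred_x_pred hn2, RVec.eRaw_pred_x_pred hn2,
        RVec.eRaw_pred_x_self hn2, show n - 1 - 1 = n - 2 by omega]
      ring
    · rw [if_neg e, Function.update_of_ne e, Function.update_of_ne (by omega),
        RVec.eRaw_pred_xb hn2, RVec.eRaw_pred_x_of_ne hn2 _ _ e (by omega),
        RVec.eRaw_pred_x_of_ne hn2 _ _ e (by omega), Vstar_rec hn hp hj1 (by omega)]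
      ring
  · rw [Function.update_of_ne (by omega)]
    exact h.zero
  · rw [Function.update_self, hg]
    simp only [eT]
    rw [RVec.eRaw_pred_x_self hn2, RVec.eRaw_pred_x_self hn2]
    exact hL.top_new

theorem V_eT_pred (hn : 3 ≤ n) (hp : p.Pos) (hA : gap n p ≠ 0) (hc : 0 < c) {j : ℕ}
    (hj : j ≤ n - 1) : V n j (eT n (n - 1) c p) = V n j p :=
  ((isTau_V hn (hp.eT hc n _)).unique hn (hp.eT hc n _)
    (by rwa [gap_eT_pred hp hc (by omega)]) (isTau_eT_pred hn hp hc) hj).1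

theorem Vstar_eT_pred (hn : 3 ≤ n) (hp : p.Pos) (hA : gap n p ≠ 0) (hc : 0 < c) {j : ℕ}
    (hj : j ≤ n - 2) : Vstar n j (eT n (n - 1) c p) = Vstar n j p := by
  have := ((isTau_V hn (hp.eT hc n _)).unique hn (hp.eT hc n _)
    (by rwa [gap_eT_pred hp hc (by omega)]) (isTau_eT_pred hn hp hc) (i := j) (by omega)).2
  simpa [show j ≠ n - 1 by omega] using this

theorem Vstar_eT_pred_last (hn : 3 ≤ n) (hp : p.Pos) (hA : gap n p ≠ 0) (hc : 0 < c) :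
    Vstar n (n - 1) (eT n (n - 1) c p) * csnd n (n - 1) c p
      = Vstar n (n - 1) p * cfst n (n - 1) c (R n p) := by
  have := ((isTau_V hn (hp.eT hc n _)).unique hn (hp.eT hc n _)
    (by rwa [gap_eT_pred hp hc (by omega)]) (isTau_eT_pred hn hp hc) (le_refl (n - 1))).2
  rw [this, Function.update_self, cfst.eq_1 n (n - 1) c (R n p)]
  refine (localPred hn hp hc).V_image (W_pos hn hp (n - 2)) ?_ ?_
  · rw [RVec.phi_pred (by omega), R_fst_x hn hp le_rfl, W_last hn,
      show n - 1 - 1 = n - 2 by omega]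
  · rw [RVec.eps_pred (by omega), R_snd_xb hn hp le_rfl, W_last hn, R_snd_x_self hn p,
      show n - 1 - 1 = n - 2 by omega]

theorem eps_R_pred (hn : 3 ≤ n) (hp : p.Pos) : eps n (n - 1) (R n p) = eps n (n - 1) p := by
  have hn2 : 2 ≤ n := by omega
  have h := (localPred hn hp one_pos).tensor_eps_image (W_pos hn hp (n - 2)) rfl rfl
  rw [eps, eps, RVec.eps_pred hn2, RVec.eps_pred hn2, RVec.eps_pred hn2, RVec.eps_pred hn2,
    RVec.phi_pred hn2, RVec.phi_pred hn2, R_fst_x hn hp le_rfl, R_snd_xb hn hp le_rfl, W_last hn,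
    R_snd_x_self hn p, R_fst_xb p le_rfl, R_fst_x_self hn p,
    show n - 1 - 1 = n - 2 by omega]
  exact h

theorem phi_R_pred (hn : 3 ≤ n) (hp : p.Pos) : phi n (n - 1) (R n p) = phi n (n - 1) p := by
  have hn2 : 2 ≤ n := by omega
  have h := (localPred hn hp one_pos).tensor_phi_image (W_pos hn hp (n - 2)) rfl rfl
  rw [phi, phi, RVec.phi_pred hn2, RVec.phi_pred hn2, RVec.phi_pred hn2, RVec.phi_pred hn2,
    RVec.eps_pred hn2, RVec.eps_pred hn2, R_fst_x hn hp le_rfl, R_snd_xb hn hp le_rfl, W_last hn,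
    R_snd_x_self hn p, R_snd_x hn hp le_rfl,
    show n - 1 - 1 = n - 2 by omega]
  exact h

theorem W_eT_pred (hn : 3 ≤ n) (hp : p.Pos) (hA : gap n p ≠ 0) (hc : 0 < c) {j : ℕ}
    (hj : j ≤ n - 2) : W n j (eT n (n - 1) c p) = W n j p := by
  have hg := gap_eT_pred hp hc (by omega : 2 ≤ n)
  rw [W_eq hn hp hA hj, W_eq hn (hp.eT hc n _) (by rwa [hg]) hj, hg,
    V_eT_pred hn hp hA hc (by omega), Vstar_eT_pred hn hp hA hc hj]

theorem cfst_mul_csnd (hp : p.Pos) (hc : 0 < c) : cfst n i c p * csnd n i c p = c := by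
  have h1 := hp.1.phi n i; have h2 := hp.2.eps n i
  unfold cfst csnd
  have : 0 < c * p.1.phi n i + p.2.eps n i := by positivity
  field_simp

theorem R_eT_pred (hn : 3 ≤ n) (hp : p.Pos) (hA : gap n p ≠ 0) (hc : 0 < c) :
    R n (eT n (n - 1) c p) = eT n (n - 1) c (R n p) := by
  have hn2 : 2 ≤ n := by omega
  have hpe := hp.eT hc n (n - 1)
  have hR := hp.R hn
  have hV := V_pos hn hp; have hVs := Vstar_pos hn hp; have hW := W_pos hn hp
  have hc1 := hp.cfst hc n (n - 1)
  have hc2 := hp.csnd hc n (n - 1)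
  have hd1 := hR.cfst hc n (n - 1)
  have hd2 := hR.csnd hc n (n - 1)
  have m1 := cfst_mul_csnd (n := n) (i := n - 1) hp hc
  have m2 := cfst_mul_csnd (n := n) (i := n - 1) hR hc
  have iV (j) (h : j ≤ n - 1) := V_eT_pred hn hp hA hc h
  have iVs (j) (h : j ≤ n - 2) := Vstar_eT_pred hn hp hA hc h
  have iW (j) (h : j ≤ n - 2) := W_eT_pred hn hp hA hc h
  have rV := Vstar_eT_pred_last hn hp hA hc
  rw [← eq_div_iff hc2.ne'] at rV
  have v0 := hV (n - 2); have v1 := hV (n - 1)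
  have s0 := hVs (n - 2); have s1 := hVs (n - 1)
  have w0 := hW (n - 2)
  have hnn : n - 1 - 1 = n - 2 := by omega
  have hr : eT n (n - 1) c (R n p) = ((R n p).1.eRaw n (n - 1) (cfst n (n - 1) c (R n p)),
    (R n p).2.eRaw n (n - 1) (csnd n (n - 1) c (R n p))) := rfl
  rw [hr]
  have m3 : cfst n (n - 1) c (R n p)
      = cfst n (n - 1) c p * csnd n (n - 1) c p / csnd n (n - 1) c (R n p) := by
    rw [m1, eq_div_iff hd2.ne', m2]
  ext k
  · rcases eq_or_ne k (n - 1) with rfl | e1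
    · rw [RVec.eRaw_pred_x_pred hn2, R_fst_x hn hpe le_rfl, R_fst_x hn hp le_rfl, W_last hn,
        W_last hn, hnn, iV _ (by omega), iV _ le_rfl, iW _ le_rfl, rV]
      simp only [eT]
      rw [RVec.eRaw_pred_x_pred hn2]
      field_simp
    rcases le_or_gt k (n - 2) with h | h
    · rw [RVec.eRaw_pred_x_of_ne hn2 _ _ (by omega) (by omega), R_fst_x hn hpe (by omega),
        R_fst_x hn hp (by omega), iV _ (by omega), iV _ (by omega), iW _ h, iW _ (by omega)]
      simp only [eT]
      rw [RVec.eRaw_pred_x_of_ne hn2 _ _ (by omega) (by omega)]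
    · rcases eq_or_ne k n with rfl | e2
      · rw [RVec.eRaw_pred_x_self hn2, R_fst_x_self hn, R_fst_x_self hn,
          iV _ le_rfl, rV]
        simp only [eT]
        rw [RVec.eRaw_pred_x_self hn2]
        field_simp
      · rw [RVec.eRaw_pred_x_of_ne hn2 _ _ e1 e2, R_fst_x_of_lt hn _ (by omega),
          R_fst_x_of_lt hn _ (by omega)]
  · rw [RVec.eRaw_pred_xb hn2]
    rcases le_or_gt k (n - 1) with h | h
    · rw [R_fst_xb _ h, R_fst_xb _ h, iV _ h, iV _ (by omega)]
      simp only [eT]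
      rw [RVec.eRaw_pred_xb hn2]
    · rw [R_fst_xb_of_le hn _ (by omega), R_fst_xb_of_le hn _ (by omega)]
  · rcases eq_or_ne k (n - 1) with rfl | e1
    · rw [RVec.eRaw_pred_x_pred hn2, R_snd_x hn hpe le_rfl, R_snd_x hn hp le_rfl,
        hnn, iVs _ le_rfl, rV, m3]
      simp only [eT]
      rw [RVec.eRaw_pred_x_pred hn2]
      field_simp
    rcases le_or_gt k (n - 2) with h | h
    · rw [RVec.eRaw_pred_x_of_ne hn2 _ _ (by omega) (by omega), R_snd_x hn hpe (by omega),
        R_snd_x hn hp (by omega), iVs _ (by omega), iVs _ (by omega)]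
      simp only [eT]
      rw [RVec.eRaw_pred_x_of_ne hn2 _ _ (by omega) (by omega)]
    · rcases eq_or_ne k n with rfl | e2
      · rw [RVec.eRaw_pred_x_self hn2, R_snd_x_self hn, R_snd_x_self hn,
          iV _ le_rfl, rV, m3]
        simp only [eT]
        rw [RVec.eRaw_pred_x_self hn2]
        field_simp
      · rw [RVec.eRaw_pred_x_of_ne hn2 _ _ e1 e2, R_snd_x_of_lt hn _ (by omega),
          R_snd_x_of_lt hn _ (by omega)]
  · rw [RVec.eRaw_pred_xb hn2]
    rcases eq_or_ne k (n - 1) with rfl | e1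
    · rw [R_snd_xb hn hpe le_rfl, R_snd_xb hn hp le_rfl, W_last hn, W_last hn, hnn, iV _ le_rfl,
        iVs _ le_rfl, iW _ le_rfl, rV]
      simp only [eT]
      rw [RVec.eRaw_pred_xb hn2]
      field_simp
    rcases le_or_gt k (n - 2) with h | h
    · rw [R_snd_xb hn hpe (by omega), R_snd_xb hn hp (by omega), iVs _ h, iVs _ (by omega), iW _ h,
        iW _ (by omega)]
      simp only [eT]
      rw [RVec.eRaw_pred_xb hn2]
    · rw [R_snd_xb_of_le hn _ (by omega), R_snd_xb_of_le hn _ (by omega)]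

section Last

theorem eps_last (hn : 3 ≤ n) (b : RVec) : b.eps n n = b.xb (n - 1) := by
  rw [RVec.eps, if_neg (by omega), if_neg (by omega), if_neg (by omega)]

theorem phi_last (hn : 3 ≤ n) (b : RVec) : b.phi n n = b.x (n - 1) * b.x n := by
  rw [RVec.phi, if_neg (by omega), if_neg (by omega), if_neg (by omega)]

theorem eRaw_last (hn : 3 ≤ n) (c : ℝ) (b : RVec) : b.eRaw n n c =
    ⟨update b.x n (b.x n * c), update b.xb (n - 1) (b.xb (n - 1) / c)⟩ := by
  rw [RVec.eRaw, if_neg (by omega), if_neg (by omega), if_neg (by omega)]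

theorem star_phi_pred (hn : 3 ≤ n) (p : RPair) : (star n p).1.phi n (n - 1) = p.2.eps n n := by
  rw [RVec.phi_pred (by omega), eps_last hn, star_fst_x (by omega)]

theorem star_eps_pred (hn : 3 ≤ n) (p : RPair) : (star n p).2.eps n (n - 1) = p.1.phi n n := by
  rw [RVec.eps_pred (by omega), phi_last hn, star_snd_xb (by omega), star_snd_x_self, mul_comm]

theorem star_eps_pred_fst (hn : 3 ≤ n) (p : RPair) :
    (star n p).1.eps n (n - 1) = p.2.phi n n := by
  rw [RVec.eps_pred (by omega), phi_last hn, star_fst_xb (by omega), star_fst_x_self, mul_comm]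

theorem star_phi_pred_snd (hn : 3 ≤ n) (p : RPair) :
    (star n p).2.phi n (n - 1) = p.1.eps n n := by
  rw [RVec.phi_pred (by omega), eps_last hn, star_snd_x (by omega)]

/-- The involution `*` swaps the nodes `n - 1` and `n`: `ε_n` of a factor of the old pair is
`φ_{n-1}` of the opposite factor of the new one, and vice versa. Node `n` thus needs no computation
of its own. -/
theorem star_eT_last (hn : 3 ≤ n) (c : ℝ) (p : RPair) :
    star n (eT n n c p) = eT n (n - 1) c⁻¹ (star n p) := by
  have f1 : cfst n (n - 1) c⁻¹ (star n p) = (csnd n n c p)⁻¹ := by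
    rw [cfst, csnd, star_phi_pred hn, star_eps_pred hn, inv_div]
    congr 1 <;> ring
  have f2 : csnd n (n - 1) c⁻¹ (star n p) = (cfst n n c p)⁻¹ := by
    rw [cfst, csnd, star_phi_pred hn, star_eps_pred hn, inv_div, div_inv_eq_mul]
    congr 1 <;> ring
  rw [show eT n (n - 1) c⁻¹ (star n p)
    = (RVec.eRaw n (n - 1) (cfst n (n - 1) c⁻¹ (star n p)) (star n p).1,
      RVec.eRaw n (n - 1) (csnd n (n - 1) c⁻¹ (star n p)) (star n p).2) from rfl, f1, f2,
    RVec.eRaw_pred (by omega), RVec.eRaw_pred (by omega)]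
  simp only [eT, eRaw_last hn]
  have hlt : n - 1 < n := by omega
  have hne : n ≠ n - 1 := by omega
  ext k <;> rcases eq_or_ne k n with e1 | e1
  all_goals try (subst e1; simp [star, hne, div_eq_mul_inv])
  all_goals
    rcases eq_or_ne k (n - 1) with e2 | e2
    · subst e2; simp [star, hlt, hne.symm, div_eq_mul_inv]
    · simp [star, e1, e2, div_eq_mul_inv]

theorem eT_last (hn : 3 ≤ n) (c : ℝ) (p : RPair) :
    eT n n c p = star n (eT n (n - 1) c⁻¹ (star n p)) := by
  rw [← star_eT_last hn, star_star]

theorem R_eT_last (hn : 3 ≤ n) (hp : p.Pos) (hA : gap n p ≠ 0) (hc : 0 < c) :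
    R n (eT n n c p) = eT n n c (R n p) := by
  have hc' := inv_pos.2 hc
  rw [eT_last hn, eT_last hn, R_star hn (hp.star.eT hc' n _),
    R_eT_pred hn hp.star (gap_star_ne hn hA) hc', R_star hn hp]

theorem eps_last_eq (hn : 3 ≤ n) (p : RPair) : eps n n p = phi n (n - 1) (star n p) := by
  rw [eps, phi, star_phi_pred hn, star_eps_pred hn, star_phi_pred_snd hn]

theorem phi_last_eq (hn : 3 ≤ n) (p : RPair) : phi n n p = eps n (n - 1) (star n p) := by
  rw [eps, phi, star_phi_pred hn, star_eps_pred hn, star_eps_pred_fst hn]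

end Last

theorem R_eT (hn : 3 ≤ n) (hp : p.Pos) (hA : gap n p ≠ 0) (hc : 0 < c) (hi : i ≤ n) :
    R n (eT n i c p) = eT n i c (R n p) := by
  rcases Nat.eq_zero_or_pos i with rfl | h
  · exact R_eT_zero hn hp hA hc
  rcases le_or_gt i (n - 2) with h' | h'
  · exact R_eT_mid hn hp hA hc h h'
  obtain rfl | rfl : i = n - 1 ∨ i = n := by omega
  · exact R_eT_pred hn hp hA hc
  · exact R_eT_last hn hp hA hc

theorem eps_R (hn : 3 ≤ n) (hp : p.Pos) (hA : gap n p ≠ 0) (hi : i ≤ n) :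
    eps n i (R n p) = eps n i p := by
  rcases Nat.eq_zero_or_pos i with rfl | h
  · exact eps_R_zero hn hp hA
  rcases le_or_gt i (n - 2) with h' | h'
  · exact eps_R_mid hn hp hA h h'
  obtain rfl | rfl : i = n - 1 ∨ i = n := by omega
  · exact eps_R_pred hn hp
  · rw [eps_last_eq hn, eps_last_eq hn, ← R_star hn hp, phi_R_pred hn hp.star]

theorem phi_R (hn : 3 ≤ n) (hp : p.Pos) (hA : gap n p ≠ 0) (hi : i ≤ n) :
    phi n i (R n p) = phi n i p := by
  rcases Nat.eq_zero_or_pos i with rfl | h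
  · exact phi_R_zero hn hp hA
  rcases le_or_gt i (n - 2) with h' | h'
  · exact phi_R_mid hn hp hA h h'
  obtain rfl | rfl : i = n - 1 ∨ i = n := by omega
  · exact phi_R_pred hn hp
  · rw [phi_last_eq hn, phi_last_eq hn, ← R_star hn hp, eps_R_pred hn hp.star]

end RPair

end DCrystal

/-! ### Ultradiscretization by growth exponents. -/

namespace DCrystal

open Finset (Icc)
open Function (update)

/-- The function `u` grows like `t ^ a`. -/
def Tr (u : ℝ → ℝ) (a : ℤ) : Prop :=
  ∃ k K : ℝ, 0 < k ∧ 0 < K ∧ ∀ t : ℝ, 3 ≤ t → k * t ^ a ≤ u t ∧ u t ≤ K * t ^ a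

namespace Tr

variable {u v : ℝ → ℝ} {a b : ℤ}

theorem congr (h : Tr u a) (hab : a = b) : Tr u b := hab ▸ h

theorem congr_fun (h : Tr u a) (huv : ∀ t, 3 ≤ t → u t = v t) : Tr v a := by
  obtain ⟨k, K, hk, hK, h⟩ := h
  exact ⟨k, K, hk, hK, fun t ht => huv t ht ▸ h t ht⟩

theorem pos (h : Tr u a) {t : ℝ} (ht : 3 ≤ t) : 0 < u t := by
  obtain ⟨k, K, hk, hK, h⟩ := h
  have : 0 < t := by linarith
  exact lt_of_lt_of_le (by positivity) (h t ht).1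

theorem mul (hu : Tr u a) (hv : Tr v b) : Tr (fun t => u t * v t) (a + b) := by
  obtain ⟨k, K, hk, hK, h⟩ := hu
  obtain ⟨k', K', hk', hK', h'⟩ := hv
  refine ⟨k * k', K * K', by positivity, by positivity, fun t ht => ?_⟩
  have h0 : 0 < t := by linarith
  obtain ⟨h1, h2⟩ := h t ht
  obtain ⟨h3, h4⟩ := h' t ht
  rw [zpow_add₀ h0.ne']
  constructor
  · calc k * k' * (t ^ a * t ^ b) = (k * t ^ a) * (k' * t ^ b) := by ring
      _ ≤ _ := mul_le_mul h1 h3 (by positivity) (le_trans (by positivity) h1)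
  · calc u t * v t ≤ (K * t ^ a) * (K' * t ^ b) :=
          mul_le_mul h2 h4 (le_trans (by positivity) h3) (by positivity)
      _ = _ := by ring

theorem inv (hu : Tr u a) : Tr (fun t => (u t)⁻¹) (-a) := by
  obtain ⟨k, K, hk, hK, h⟩ := hu
  refine ⟨K⁻¹, k⁻¹, by positivity, by positivity, fun t ht => ?_⟩
  have h0 : 0 < t := by linarith
  obtain ⟨h1, h2⟩ := h t ht
  have hu : 0 < u t := lt_of_lt_of_le (by positivity) h1
  rw [zpow_neg, ← mul_inv, ← mul_inv]
  exact ⟨inv_anti₀ hu h2, inv_anti₀ (by positivity) h1⟩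

theorem div (hu : Tr u a) (hv : Tr v b) : Tr (fun t => u t / v t) (a - b) := by
  simpa only [div_eq_mul_inv, sub_eq_add_neg] using hu.mul hv.inv

theorem const {r : ℝ} (hr : 0 < r) : Tr (fun _ => r) 0 :=
  ⟨r, r, hr, hr, fun t _ => by simp⟩

theorem one : Tr (fun _ => 1) 0 := const one_pos

theorem zpow (a : ℤ) : Tr (fun t => t ^ a) a :=
  ⟨1, 1, one_pos, one_pos, fun t _ => by simp⟩

/-- Both functions are positive, so nothing cancels and the larger exponent wins. This turns sums
into maxima, and it is why only subtraction-free expressions are evaluated by growth. -/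
theorem add (hu : Tr u a) (hv : Tr v b) : Tr (fun t => u t + v t) (max a b) := by
  wlog hab : b ≤ a generalizing u v a b
  · simpa only [add_comm, max_comm] using this hv hu (by omega)
  have hv' := hv
  obtain ⟨k, K, hk, hK, h⟩ := hu
  obtain ⟨k', K', hk', hK', h'⟩ := hv
  rw [max_eq_left hab]
  refine ⟨k, K + K', hk, by positivity, fun t ht => ?_⟩
  obtain ⟨h1, h2⟩ := h t ht
  obtain ⟨h3, h4⟩ := h' t ht
  have hb : t ^ b ≤ t ^ a := zpow_le_zpow_right₀ (by linarith) hab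
  constructor
  · linarith [hv'.pos ht]
  · have := mul_le_mul_of_nonneg_left hb hK'.le
    linarith

theorem unique (h : Tr u a) (h' : Tr u b) : a = b := by
  have key {a b : ℤ} (h : Tr u a) (h' : Tr u b) : b ≤ a := by
    by_contra! hlt
    obtain ⟨k, K, hk, hK, h⟩ := h
    obtain ⟨k', K', hk', hK', h'⟩ := h'
    -- At `t = 3 + K / k'` the bounds would yield `k' t ≤ K`, although `k' t = 3 k' + K`.
    have ht : (3 : ℝ) ≤ 3 + K / k' := by
      have : 0 < K / k' := by positivity
      linarith
    have h1 := (h' _ ht).1.trans (h _ ht).2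
    have h0 : (0 : ℝ) < 3 + K / k' := by linarith
    have h2 : (3 + K / k') ^ (a + 1) ≤ (3 + K / k') ^ b :=
      zpow_le_zpow_right₀ (by linarith) hlt
    rw [zpow_add_one₀ h0.ne'] at h2
    have h3 : k' * ((3 + K / k') ^ a * (3 + K / k')) ≤ K * (3 + K / k') ^ a :=
      (mul_le_mul_of_nonneg_left h2 hk'.le).trans h1
    have hp : 0 < (3 + K / k') ^ a := by positivity
    have h4 : k' * (3 + K / k') ≤ K := by
      refine le_of_mul_le_mul_right ?_ hp
      linarith
    rw [mul_add, mul_div_cancel₀ _ hk'.ne'] at h4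
    linarith
  exact le_antisymm (key h' h) (key h h')

theorem prod {s : Finset ℕ} {f : ℕ → ℝ → ℝ} {g : ℕ → ℤ} (h : ∀ k ∈ s, Tr (f k) (g k)) :
    Tr (fun t => ∏ k ∈ s, f k t) (∑ k ∈ s, g k) := by
  induction s using Finset.induction_on with
  | empty => simpa using one
  | insert k s hk ih =>
    simp only [Finset.prod_insert hk, Finset.sum_insert hk]
    exact (h k (Finset.mem_insert_self k s)).mul
      (ih fun j hj => h j (Finset.mem_insert_of_mem hj))

theorem sum {s : Finset ℕ} (hs : s.Nonempty) {f : ℕ → ℝ → ℝ} {g : ℕ → ℤ}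
    (h : ∀ k ∈ s, Tr (f k) (g k)) : Tr (fun t => ∑ k ∈ s, f k t) (s.sup' hs g) := by
  induction hs using Finset.Nonempty.cons_induction with
  | singleton k => simpa using h k
  | cons k s hk hs ih =>
    simp only [Finset.sum_cons, Finset.sup'_cons hs]
    exact (h k (Finset.mem_cons_self k s)).add
      (ih fun j hj => h j (Finset.mem_cons_of_mem hj))

end Tr

/-- Every coordinate of `X t` grows like `t` to the power of the coordinate of `b`. -/
structure TrVec {n : ℕ} (X : ℝ → RVec) (b : Vec n) : Prop where
  x : ∀ k, 1 ≤ k → k ≤ n → Tr (fun t => (X t).x k) (b.x k)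
  xb : ∀ k, 1 ≤ k → k ≤ n - 1 → Tr (fun t => (X t).xb k) (b.xb k)

/-- The version of `TrVec` for pairs. -/
def TrPair {n : ℕ} (X : ℝ → RPair) (p : Vec n × Vec n) : Prop :=
  TrVec (fun t => (X t).1) p.1 ∧ TrVec (fun t => (X t).2) p.2

theorem Vec.ext' {n : ℕ} {b b' : Vec n} (hx : ∀ k, 1 ≤ k → k ≤ n → b.x k = b'.x k)
    (hxb : ∀ k, 1 ≤ k → k ≤ n - 1 → b.xb k = b'.xb k) : b = b' := by
  ext k
  · have := hx (k + 1) (by omega) (by omega)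
    have hk : (k : ℕ) + 1 ≤ n := by omega
    simpa [Vec.x, hk] using this
  · have := hxb (k + 1) (by omega) (by omega)
    have hk : (k : ℕ) + 1 ≤ n - 1 := by omega
    simpa [Vec.xb, hk] using this

variable {n : ℕ}

/-- The operator `ẽ_i^c` on pairs, before one asks whether the result lies in the crystal. -/
def eTRaw (i : ℕ) (c : ℤ) (p : Vec n × Vec n) : Vec n × Vec n :=
  (p.1.eRaw i (max (c + p.1.phi i) (p.2.eps i) - max (p.1.phi i) (p.2.eps i)),
   p.2.eRaw i (max (p.1.phi i) (p.2.eps i) - max (p.1.phi i) (-c + p.2.eps i)))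

/-- The function `ε_i` of a tensor product. -/
def epsT (i : ℕ) (p : Vec n × Vec n) : ℤ := p.1.eps i + max 0 (p.2.eps i - p.1.phi i)

/-- The function `φ_i` of a tensor product. -/
def phiT (i : ℕ) (p : Vec n × Vec n) : ℤ := p.2.phi i + max 0 (p.1.phi i - p.2.eps i)

namespace TrVec

variable {X : ℝ → RVec} {b b' : Vec n} {i : ℕ}

theorem unique (h : TrVec X b) (h' : TrVec X b') : b = b' :=
  Vec.ext' (fun k h1 h2 => (h.x k h1 h2).unique (h'.x k h1 h2))
    (fun k h1 h2 => (h.xb k h1 h2).unique (h'.xb k h1 h2))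

theorem congr_fun {Y : ℝ → RVec} (h : TrVec X b) (hXY : ∀ t, 3 ≤ t → X t = Y t) :
    TrVec Y b where
  x k h1 h2 := (h.x k h1 h2).congr_fun fun t ht => by rw [hXY t ht]
  xb k h1 h2 := (h.xb k h1 h2).congr_fun fun t ht => by rw [hXY t ht]

theorem level (h : TrVec X b) : Tr (fun t => (X t).level n) b.level :=
  (Tr.prod fun k hk => h.x k (Finset.mem_Icc.1 hk).1 (Finset.mem_Icc.1 hk).2).mul
    (Tr.prod fun k hk => h.xb k (Finset.mem_Icc.1 hk).1 (Finset.mem_Icc.1 hk).2)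

theorem eps (hn : 3 ≤ n) (h : TrVec X b) (i : ℕ) : Tr (fun t => (X t).eps n i) (b.eps i) := by
  unfold RVec.eps Vec.eps
  split_ifs with h0 h1 h2
  · exact ((h.x 1 le_rfl (by omega)).mul (Tr.one.add ((h.x 2 (by omega) (by omega)).div
      (h.xb 2 (by omega) (by omega))))).congr (by omega)
  · exact ((h.xb i (by omega) (by omega)).mul (Tr.one.add ((h.x _ (by omega) (by omega)).div
      (h.xb _ (by omega) (by omega))))).congr (by omega)
  · exact (h.x _ (by omega) (by omega)).mul (h.xb _ (by omega) (by omega))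
  · exact h.xb _ (by omega) (by omega)

theorem phi (hn : 3 ≤ n) (h : TrVec X b) (i : ℕ) : Tr (fun t => (X t).phi n i) (b.phi i) := by
  unfold RVec.phi Vec.phi
  split_ifs with h0 h1 h2
  · exact ((h.xb 1 le_rfl (by omega)).mul (Tr.one.add ((h.xb 2 (by omega) (by omega)).div
      (h.x 2 (by omega) (by omega))))).congr (by omega)
  · exact ((h.x i (by omega) (by omega)).mul (Tr.one.add ((h.xb _ (by omega) (by omega)).div
      (h.x _ (by omega) (by omega))))).congr (by omega)
  · exact h.x _ (by omega) (by omega)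
  · exact (h.x _ (by omega) (by omega)).mul (h.x _ (by omega) (by omega))

theorem xi (h : TrVec X b) {C : ℝ → ℝ} {c : ℤ} (hC : Tr C c) (h1 : 1 ≤ i) (h2 : i ≤ n - 1) :
    Tr (fun t => (X t).xi (C t) i) (b.xi c i) :=
  (((h.x i h1 (by omega)).add (hC.mul (h.xb i h1 h2))).div
    ((h.x i h1 (by omega)).add (h.xb i h1 h2))).congr (by unfold Vec.xi; omega)

end TrVec

theorem tr_update {u : ℝ → ℕ → ℝ} {a : ℕ → ℤ} {k i : ℕ} {r : ℝ → ℝ} {s : ℤ}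
    (hu : k ≠ i → Tr (fun t => u t k) (a k)) (hr : k = i → Tr r s) :
    Tr (fun t => update (u t) i (r t) k) (update a i s k) := by
  rcases eq_or_ne k i with rfl | h
  · simpa using hr rfl
  · simpa [h] using hu h

theorem TrVec.of_mk' {f g : ℝ → ℕ → ℝ} {a b : ℕ → ℤ}
    (hf : ∀ k, 1 ≤ k → k ≤ n → Tr (fun t => f t k) (a k))
    (hg : ∀ k, 1 ≤ k → k ≤ n - 1 → Tr (fun t => g t k) (b k)) :
    TrVec (fun t => ⟨f t, g t⟩) (Vec.mk' n a b) where
  x k h1 h2 := by rw [Vec.x_mk' _ _ h1 h2]; exact hf k h1 h2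
  xb k h1 h2 := by rw [Vec.xb_mk' _ _ h1 h2]; exact hg k h1 h2

theorem TrVec.eRaw {X : ℝ → RVec} {b : Vec n} (hn : 3 ≤ n) (h : TrVec X b) (i : ℕ) {C : ℝ → ℝ}
    {c : ℤ} (hC : Tr C c) : TrVec (fun t => (X t).eRaw n i (C t)) (b.eRaw i c) := by
  unfold RVec.eRaw Vec.eRaw
  split_ifs with h0 h1 h2
  · have hξ := h.xi hC (i := 2) (by omega) (by omega)
    have hx1 := h.x 1 (by omega) (by omega); have hx2 := h.x 2 (by omega) (by omega)
    have hy1 := h.xb 1 (by omega) (by omega); have hy2 := h.xb 2 (by omega) (by omega)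
    exact TrVec.of_mk'
      (fun k k1 k2 => tr_update (fun _ => tr_update (fun _ => h.x k k1 k2) fun _ => hx1.div hξ)
        fun _ => (hx2.mul hξ).div hC)
      (fun k k1 k2 => tr_update (fun _ => tr_update (fun _ => h.xb k k1 k2) fun _ => hy2.mul hξ)
        fun _ => (hy1.div hξ).mul hC)
  · have hξ := h.xi hC (i := i + 1) (by omega) (by omega)
    have hx1 := h.x i (by omega) (by omega); have hx2 := h.x (i + 1) (by omega) (by omega)
    have hy1 := h.xb i (by omega) (by omega); have hy2 := h.xb (i + 1) (by omega) (by omega)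
    exact TrVec.of_mk'
      (fun k k1 k2 => tr_update
        (fun _ => tr_update (fun _ => h.x k k1 k2) fun _ => (hx1.div hξ).mul hC)
        fun _ => (hx2.mul hξ).div hC)
      (fun k k1 k2 => tr_update (fun _ => tr_update (fun _ => h.xb k k1 k2) fun _ => hy2.mul hξ)
        fun _ => hy1.div hξ)
  · exact TrVec.of_mk'
      (fun k k1 k2 => tr_update (fun _ => tr_update (fun _ => h.x k k1 k2)
        fun _ => (h.x (n - 1) (by omega) (by omega)).mul hC)
        fun _ => (h.x n (by omega) le_rfl).div hC)
      (fun k k1 k2 => h.xb k k1 k2)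
  · exact TrVec.of_mk'
      (fun k k1 k2 => tr_update (fun _ => h.x k k1 k2)
        fun _ => (h.x n (by omega) le_rfl).mul hC)
      (fun k k1 k2 => tr_update (fun _ => h.xb k k1 k2)
        fun _ => (h.xb (n - 1) (by omega) le_rfl).div hC)

namespace TrPair

variable {X : ℝ → RPair} {p q : Vec n × Vec n} {i j : ℕ}

theorem unique (h : TrPair X p) (h' : TrPair X q) : p = q :=
  Prod.ext (h.1.unique h'.1) (h.2.unique h'.2)

theorem congr_fun {Y : ℝ → RPair} (h : TrPair X p) (hXY : ∀ t, 3 ≤ t → X t = Y t) :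
    TrPair Y p :=
  ⟨h.1.congr_fun fun t ht => by rw [hXY t ht], h.2.congr_fun fun t ht => by rw [hXY t ht]⟩

theorem eT (hn : 3 ≤ n) (h : TrPair X p) (i : ℕ) {C : ℝ → ℝ} {c : ℤ} (hC : Tr C c) :
    TrPair (fun t => (X t).eT n i (C t)) (eTRaw i c p) := by
  have hf := h.1.phi hn i
  have hg := h.2.eps hn i
  exact ⟨h.1.eRaw hn i (((hC.mul hf).add hg).div (hf.add hg)),
    h.2.eRaw hn i (((hf.add hg).div (hf.add (hg.div hC))).congr (by omega))⟩

theorem eps (hn : 3 ≤ n) (h : TrPair X p) (i : ℕ) :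
    Tr (fun t => (X t).eps n i) (epsT i p) :=
  (h.1.eps hn i).mul (Tr.one.add ((h.2.eps hn i).div (h.1.phi hn i)))

theorem phi (hn : 3 ≤ n) (h : TrPair X p) (i : ℕ) :
    Tr (fun t => (X t).phi n i) (phiT i p) :=
  (h.2.phi hn i).mul (Tr.one.add ((h.1.phi hn i).div (h.2.eps hn i)))

theorem star (hn : 3 ≤ n) (h : TrPair X p) :
    TrPair (fun t => (X t).star n) (DCrystal.star p) := by
  constructor
  · refine TrVec.of_mk' (fun k k1 k2 => ?_) (fun k k1 k2 => ?_)
    · rcases eq_or_ne k n with rfl | hk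
      · simpa using h.2.x k k1 k2
      · simpa [hk, show k < n by omega] using h.2.xb k k1 (by omega)
    · simpa [show k < n by omega] using h.2.x k k1 (by omega)
  · refine TrVec.of_mk' (fun k k1 k2 => ?_) (fun k k1 k2 => ?_)
    · rcases eq_or_ne k n with rfl | hk
      · simpa using h.1.x k k1 k2
      · simpa [hk, show k < n by omega] using h.1.xb k k1 (by omega)
    · simpa [show k < n by omega] using h.1.x k k1 (by omega)

theorem sigma (hn : 3 ≤ n) (h : TrPair X p) :
    TrPair (fun t => (X t).sigma) (sigmaOne p) := by
  have aux {Y : ℝ → RVec} {b : Vec n} (h : TrVec Y b) : TrVec (fun t => (Y t).sigma)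
      (Vec.mk' n (update b.x 1 (b.xb 1)) (update b.xb 1 (b.x 1))) :=
    TrVec.of_mk'
      (fun k k1 k2 => tr_update (fun _ => h.x k k1 k2) fun _ => h.xb 1 le_rfl (by omega))
      (fun k k1 k2 => tr_update (fun _ => h.xb k k1 k2) fun _ => h.x 1 le_rfl (by omega))
  exact ⟨aux h.1, aux h.2⟩

theorem prod_xb (h : TrPair X p) {a b : ℕ} (ha : 1 ≤ a) (hb : b ≤ n - 1) :
    Tr (fun t => ∏ k ∈ Icc a b, ((X t).2.xb k / (X t).1.xb k))
      (∑ k ∈ Icc a b, (p.2.xb k - p.1.xb k)) :=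
  Tr.prod fun k hk => by
    have := Finset.mem_Icc.1 hk
    exact (h.2.xb k (by omega) (by omega)).div (h.1.xb k (by omega) (by omega))

theorem prod_xb' (h : TrPair X p) {a b : ℕ} (ha : 1 ≤ a) (hb : b ≤ n - 1) :
    Tr (fun t => ∏ k ∈ Icc a b, ((X t).1.xb k / (X t).2.xb k))
      (∑ k ∈ Icc a b, (p.1.xb k - p.2.xb k)) :=
  Tr.prod fun k hk => by
    have := Finset.mem_Icc.1 hk
    exact (h.1.xb k (by omega) (by omega)).div (h.2.xb k (by omega) (by omega))

theorem prod_x (h : TrPair X p) {a b : ℕ} (ha : 1 ≤ a) (hb : b ≤ n) :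
    Tr (fun t => ∏ k ∈ Icc a b, ((X t).2.x k / (X t).1.x k))
      (∑ k ∈ Icc a b, (p.2.x k - p.1.x k)) :=
  Tr.prod fun k hk => by
    have := Finset.mem_Icc.1 hk
    exact (h.2.x k (by omega) (by omega)).div (h.1.x k (by omega) (by omega))

theorem theta (h : TrPair X p) (hi : i ≤ n - 1) (hj : j ≤ n - 2) :
    Tr (fun t => (X t).theta n i j) (DCrystal.theta i j p) := by
  unfold RPair.theta DCrystal.theta
  split_ifs
  · exact h.1.level.mul (h.prod_xb (by omega) hi)
  · exact h.2.level.mul (h.prod_xb' (by omega) (by omega))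

theorem theta' (h : TrPair X p) (hi : i ≤ n - 1) (hj : j ≤ n - 2) :
    Tr (fun t => (X t).theta' n i j) (DCrystal.theta' i j p) :=
  (h.1.level.mul (h.prod_xb le_rfl hi)).mul (h.prod_x le_rfl (by omega))

theorem eta (hn : 3 ≤ n) (h : TrPair X p) (hi : i ≤ n - 1) (hj1 : 1 ≤ j) :
    Tr (fun t => (X t).eta n i j) (DCrystal.eta i j p) := by
  unfold RPair.eta DCrystal.eta
  split_ifs
  · exact (h.1.level.mul (h.prod_xb (by omega) hi)).mul
      ((h.2.xb j hj1 (by omega)).div (h.1.x j hj1 (by omega)))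
  · exact (h.2.level.mul (h.prod_xb' (by omega) (by omega))).mul
      ((h.2.xb j hj1 (by omega)).div (h.1.x j hj1 (by omega)))
  · exact (h.2.level.mul (h.prod_xb' (by omega) (by omega))).mul (h.1.x n (by omega) le_rfl)

theorem eta' (hn : 3 ≤ n) (h : TrPair X p) (hi : i ≤ n - 1) (hj1 : 1 ≤ j) :
    Tr (fun t => (X t).eta' n i j) (DCrystal.eta' i j p) := by
  unfold RPair.eta' DCrystal.eta'
  split_ifs
  · exact ((h.1.level.mul (h.prod_xb le_rfl hi)).mul (h.prod_x le_rfl (by omega))).mul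
      ((h.1.x j hj1 (by omega)).div (h.2.xb j hj1 (by omega)))
  · exact (((h.1.level.mul (h.1.level.div h.2.level)).mul (h.prod_xb le_rfl hi)).mul
      (h.prod_x le_rfl (by omega))).div (h.1.x n (by omega) le_rfl)
  · exact (((h.1.level.mul Tr.one).mul (h.prod_xb le_rfl hi)).mul
      (h.prod_x le_rfl (by omega))).div (h.1.x n (by omega) le_rfl)

theorem V (hn : 3 ≤ n) (h : TrPair X p) (hi : i ≤ n - 1) :
    Tr (fun t => (X t).V n i) (DCrystal.V i p) := by
  have ne : (Icc 1 (n - 2)).Nonempty := ⟨1, by simp; omega⟩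
  have ne' : (Icc 1 n).Nonempty := ⟨1, by simp; omega⟩
  have T := (((Tr.sum ne fun j hj => h.theta (j := j) hi (Finset.mem_Icc.1 hj).2).add
    (Tr.sum ne fun j hj => h.theta' (j := j) hi (Finset.mem_Icc.1 hj).2)).add
    (Tr.sum ne' fun j hj => h.eta (j := j) hn hi (Finset.mem_Icc.1 hj).1)).add
    (Tr.sum ne' fun j hj => h.eta' (j := j) hn hi (Finset.mem_Icc.1 hj).1)
  refine T.congr ?_
  have hne : (VSet i p).Nonempty :=
    ⟨DCrystal.theta i 1 p, by
      simp only [VSet, Finset.mem_union, Finset.mem_image]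
      exact Or.inl (Or.inl (Or.inl ⟨1, by simp; omega, rfl⟩))⟩
  rw [DCrystal.V, dif_pos hne]
  refine le_antisymm ?_ ?_
  · refine max_le (max_le (max_le ?_ ?_) ?_) ?_ <;>
      refine Finset.sup'_le _ _ fun j hj => Finset.le_max' _ _ ?_ <;>
      simp only [VSet, Finset.mem_union, Finset.mem_image]
    · exact Or.inl (Or.inl (Or.inl ⟨j, hj, rfl⟩))
    · exact Or.inl (Or.inl (Or.inr ⟨j, hj, rfl⟩))
    · exact Or.inl (Or.inr ⟨j, hj, rfl⟩)
    · exact Or.inr ⟨j, hj, rfl⟩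
  · refine Finset.max'_le _ _ _ fun y hy => ?_
    simp only [VSet, Finset.mem_union, Finset.mem_image] at hy
    simp only [le_max_iff]
    rcases hy with ((⟨j, hj, rfl⟩ | ⟨j, hj, rfl⟩) | ⟨j, hj, rfl⟩) | ⟨j, hj, rfl⟩
    · exact Or.inl (Or.inl (Or.inl (Finset.le_sup' (fun j => DCrystal.theta i j p) hj)))
    · exact Or.inl (Or.inl (Or.inr (Finset.le_sup' (fun j => DCrystal.theta' i j p) hj)))
    · exact Or.inl (Or.inr (Finset.le_sup' (fun j => DCrystal.eta i j p) hj))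
    · exact Or.inr (Finset.le_sup' (fun j => DCrystal.eta' i j p) hj)

theorem Vstar (hn : 3 ≤ n) (h : TrPair X p) (hi : i ≤ n - 1) :
    Tr (fun t => (X t).Vstar n i) (DCrystal.Vstar i p) :=
  (h.star hn).V hn hi

theorem W (hn : 3 ≤ n) (h : TrPair X p) (h1 : 1 ≤ i) (hi : i ≤ n - 1) :
    Tr (fun t => (X t).W n i) (DCrystal.W i p) := by
  unfold RPair.W DCrystal.W
  simp only [show i ≠ 0 by omega, if_false]
  split_ifs
  · exact (h.V hn (by omega)).mul ((h.sigma hn).V hn (by omega))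
  · exact (h.V hn (by omega)).mul (h.Vstar hn (by omega))
  · have hx := h.1.x i h1 (by omega)
    have hyb := h.2.xb i h1 hi
    exact (((((h.V hn hi).mul (h.Vstar hn (i := i - 1) (by omega))).div
      (h.2.x i h1 (by omega))).add
      (((h.V hn (i := i - 1) (by omega)).mul (h.Vstar hn hi)).div (h.1.xb i h1 hi))).div
      ((Tr.one.div hx).add (Tr.one.div hyb))).congr (by omega)

/-- Every formula in the rational `R` is subtraction-free, so the exponents follow from the rules
for `Tr`; the auxiliary value `W_0` does not occur in the definition. -/
theorem R (hn : 3 ≤ n) (h : TrPair X p) :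
    TrPair (fun t => (X t).R n) (piecewiseR p) := by
  have hV {i} (hi : i ≤ n - 1) := h.V hn hi
  have hVs {i} (hi : i ≤ n - 1) := h.Vstar hn hi
  have hσ := (h.sigma hn).V hn (i := 0) (by omega)
  have hW {i} (h1 : 1 ≤ i) (hi : i ≤ n - 1) := h.W hn h1 hi
  have hn0 : 1 ≤ n := by omega
  constructor
  all_goals unfold RPair.R piecewiseR
  · refine TrVec.mk (fun k k1 k2 => ?_) (fun k k1 k2 => ?_)
    · rw [Vec.x_mk' _ _ k1 k2]
      rcases eq_or_ne k 1 with rfl | e1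
      · simp only [if_true]
        exact ((h.2.x 1 k1 k2).mul hσ).div (hV (by omega))
      simp only [if_neg e1]
      rcases le_or_gt k (n - 1) with e2 | e2
      · simp only [if_pos e2]
        exact ((((h.2.x k k1 k2).mul (hV (i := k - 1) (by omega))).mul (hW k1 e2)).div
          ((hV e2).mul (hW (i := k - 1) (by omega) (by omega)))).congr (by omega)
      · simp only [show k = n by omega, if_true, show ¬n ≤ n - 1 by omega, if_false]
        exact ((h.2.x n hn0 le_rfl).mul (hV le_rfl)).div (hVs le_rfl)
    · rw [Vec.xb_mk' _ _ k1 k2]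
      rcases eq_or_ne k 1 with rfl | e1
      · simp only [if_true]
        exact ((h.2.xb 1 k1 k2).mul (hV (by omega))).div (hV (by omega))
      · simp only [if_neg e1, if_pos k2]
        exact ((h.2.xb k k1 k2).mul (hV (i := k - 1) (by omega))).div (hV k2)
  · refine TrVec.mk (fun k k1 k2 => ?_) (fun k k1 k2 => ?_)
    · rw [Vec.x_mk' _ _ k1 k2]
      rcases eq_or_ne k 1 with rfl | e1
      · simp only [if_true]
        exact ((h.1.x 1 k1 k2).mul (hV (by omega))).div (hVs (by omega))
      simp only [if_neg e1]
      rcases le_or_gt k (n - 1) with e2 | e2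
      · simp only [if_pos e2]
        exact ((h.1.x k k1 k2).mul (hVs (i := k - 1) (by omega))).div (hVs e2)
      · simp only [show k = n by omega, if_true, show ¬n ≤ n - 1 by omega, if_false]
        exact ((h.1.x n hn0 le_rfl).mul (hVs le_rfl)).div (hV le_rfl)
    · rw [Vec.xb_mk' _ _ k1 k2]
      rcases eq_or_ne k 1 with rfl | e1
      · simp only [if_true]
        exact ((h.1.xb 1 k1 k2).mul hσ).div (hVs (by omega))
      · simp only [if_neg e1, if_pos k2]
        exact ((((h.1.xb k k1 k2).mul (hVs (i := k - 1) (by omega))).mul (hW k1 k2)).div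
          ((hVs k2).mul (hW (i := k - 1) (by omega) (by omega)))).congr (by omega)

end TrPair

/-- A lift of an integer array to a curve of positive arrays, with a scaling factor at the first
coordinate. -/
noncomputable def lift (r : ℝ) (b : Vec n) (t : ℝ) : RVec :=
  ⟨update (fun k => t ^ b.x k) 1 (r * t ^ b.x 1), fun k => t ^ b.xb k⟩

theorem lift_pos {r : ℝ} (hr : 0 < r) (b : Vec n) {t : ℝ} (ht : 0 < t) : (lift r b t).Pos :=
  ⟨RVec.update_pos (fun _ => zpow_pos ht _) (mul_pos hr (zpow_pos ht _)) _,
    fun _ => zpow_pos ht _⟩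

theorem trVec_lift {r : ℝ} (hr : 0 < r) (b : Vec n) : TrVec (lift r b) b where
  x k _ _ := by
    rcases eq_or_ne k 1 with rfl | h
    · simpa [lift] using (Tr.const hr).mul (Tr.zpow (b.x 1))
    · simpa [lift, h] using Tr.zpow (b.x k)
  xb k _ _ := Tr.zpow _

theorem level_lift (hn : 1 ≤ n) (r : ℝ) (b : Vec n) {t : ℝ} (ht : 0 < t) :
    (lift r b t).level n = r * t ^ b.level := by
  have key (s : Finset ℕ) (f : ℕ → ℤ) : ∏ k ∈ s, t ^ f k = t ^ ∑ k ∈ s, f k := by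
    induction s using Finset.induction_on with
    | empty => simp
    | insert k s hk ih => rw [Finset.prod_insert hk, Finset.sum_insert hk, ih, zpow_add₀ ht.ne']
  have := (zpow_pos ht (b.x 1)).ne'
  rw [RVec.level, lift]
  simp only
  rw [prod_update_eq (by simp; omega) this, key, key, Vec.level, zpow_add₀ ht.ne']
  field_simp

/-- The levels are `2 t^ℓ(x)` and `t^ℓ(y)`, and `2` is not an integral power of any `t ≥ 3`. This is
the purpose of the factor `2` in the lift and of the threshold `3` in `Tr`. -/
theorem gap_lift (hn : 1 ≤ n) (p : Vec n × Vec n) {t : ℝ} (ht : 3 ≤ t) :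
    RPair.gap n (lift 2 p.1 t, lift 1 p.2 t) ≠ 0 := by
  have h0 : 0 < t := by linarith
  rw [RPair.gap, level_lift hn _ _ h0, level_lift hn _ _ h0, sub_ne_zero, one_mul]
  intro h
  have e : (2 : ℝ) = t ^ (p.2.level - p.1.level) := by
    rw [zpow_sub₀ h0.ne', ← h]
    have := (zpow_pos h0 p.1.level).ne'
    field_simp
  rcases le_or_gt (p.2.level - p.1.level) 0 with h1 | h1
  · have := zpow_le_zpow_right₀ (by linarith : 1 ≤ t) h1
    rw [zpow_zero] at this
    linarith
  · have := zpow_le_zpow_right₀ (by linarith : 1 ≤ t) (show (1 : ℤ) ≤ _ from h1)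
    rw [zpow_one] at this
    linarith

theorem trPair_lift (p : Vec n × Vec n) :
    TrPair (fun t => (lift 2 p.1 t, lift 1 p.2 t)) p :=
  ⟨trVec_lift two_pos _, trVec_lift one_pos _⟩

theorem pos_lift (p : Vec n × Vec n) {t : ℝ} (ht : 3 ≤ t) :
    RPair.Pos (lift 2 p.1 t, lift 1 p.2 t) :=
  ⟨lift_pos two_pos _ (by linarith), lift_pos one_pos _ (by linarith)⟩

/-- The piecewise linear map commutes with the operators `ẽ_i^c`. -/
theorem piecewiseR_eTRaw (hn : 3 ≤ n) (p : Vec n × Vec n) {i : ℕ} (hi : i ≤ n) (c : ℤ) :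
    piecewiseR (eTRaw i c p) = eTRaw i c (piecewiseR p) := by
  have h := trPair_lift p
  -- Both sides are the growth exponents of one curve, since the rational identity holds at every `t
  -- ≥ 3`. No membership in a crystal is involved.
  refine ((h.eT hn i (Tr.zpow c)).R hn).unique
    (((h.R hn).eT hn i (Tr.zpow c)).congr_fun fun t ht => ?_)
  exact (RPair.R_eT hn (pos_lift p ht) (gap_lift (by omega) p ht)
    (zpow_pos (by linarith) c) hi).symm

theorem epsT_piecewiseR (hn : 3 ≤ n) (p : Vec n × Vec n) {i : ℕ} (hi : i ≤ n) :
    epsT i (piecewiseR p) = epsT i p := by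
  have h := trPair_lift p
  refine ((h.R hn).eps hn i).unique ((h.eps hn i).congr_fun fun t ht => ?_)
  exact (RPair.eps_R hn (pos_lift p ht) (gap_lift (by omega) p ht) hi).symm

theorem phiT_piecewiseR (hn : 3 ≤ n) (p : Vec n × Vec n) {i : ℕ} (hi : i ≤ n) :
    phiT i (piecewiseR p) = phiT i p := by
  have h := trPair_lift p
  refine ((h.R hn).phi hn i).unique ((h.phi hn i).congr_fun fun t ht => ?_)
  exact (RPair.phi_R hn (pos_lift p ht) (gap_lift (by omega) p ht) hi).symm

end DCrystal

/-! ### Strings and membership in `B'_l` and `B'_l ⊗ B'_k`. -/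

namespace DCrystal

open Finset (Icc)
open Function (update)

variable {n : ℕ}

namespace Vec

variable {b : Vec n} {i : ℕ} {c : ℤ}

theorem eRaw_zero (c : ℤ) (b : Vec n) : b.eRaw 0 c = mk' n
    (update (update b.x 1 (b.x 1 - b.xi c 2)) 2 (b.x 2 + b.xi c 2 - c))
    (update (update b.xb 2 (b.xb 2 + b.xi c 2)) 1 (b.xb 1 - b.xi c 2 + c)) := by
  simp [eRaw]

theorem eRaw_mid (c : ℤ) (b : Vec n) (h1 : 1 ≤ i) (h2 : i ≤ n - 2) : b.eRaw i c = mk' n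
    (update (update b.x i (b.x i - b.xi c (i + 1) + c)) (i + 1) (b.x (i + 1) + b.xi c (i + 1) - c))
    (update (update b.xb (i + 1) (b.xb (i + 1) + b.xi c (i + 1))) i
      (b.xb i - b.xi c (i + 1))) := by
  simp [eRaw, h2, show i ≠ 0 by omega]

theorem eRaw_pred (hn : 3 ≤ n) (c : ℤ) (b : Vec n) : b.eRaw (n - 1) c =
    mk' n (update (update b.x (n - 1) (b.x (n - 1) + c)) n (b.x n - c)) b.xb := by
  simp [eRaw, show n - 1 ≠ 0 by omega, show ¬n - 1 ≤ n - 2 by omega]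

theorem eRaw_last (hn : 3 ≤ n) (c : ℤ) (b : Vec n) : b.eRaw n c =
    mk' n (update b.x n (b.x n + c)) (update b.xb (n - 1) (b.xb (n - 1) - c)) := by
  simp [eRaw, show n ≠ 0 by omega, show ¬n ≤ n - 2 by omega, show n ≠ n - 1 by omega]

theorem eps_zero (b : Vec n) : b.eps 0 = b.x 1 + max (b.x 2 - b.xb 2) 0 := rfl

theorem eps_mid (b : Vec n) (h1 : 1 ≤ i) (h2 : i ≤ n - 2) :
    b.eps i = b.xb i + max (b.x (i + 1) - b.xb (i + 1)) 0 := by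
  simp [eps, h2, show i ≠ 0 by omega]

theorem eps_pred (hn : 3 ≤ n) (b : Vec n) : b.eps (n - 1) = b.x n + b.xb (n - 1) := by
  simp [eps, show n - 1 ≠ 0 by omega, show ¬n - 1 ≤ n - 2 by omega]

theorem eps_last (hn : 3 ≤ n) (b : Vec n) : b.eps n = b.xb (n - 1) := by
  simp [eps, show n ≠ 0 by omega, show ¬n ≤ n - 2 by omega, show n ≠ n - 1 by omega]

theorem phi_zero (b : Vec n) : b.phi 0 = b.xb 1 + max (b.xb 2 - b.x 2) 0 := rfl

theorem phi_mid (b : Vec n) (h1 : 1 ≤ i) (h2 : i ≤ n - 2) :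
    b.phi i = b.x i + max (b.xb (i + 1) - b.x (i + 1)) 0 := by
  simp [phi, h2, show i ≠ 0 by omega]

theorem phi_pred (hn : 3 ≤ n) (b : Vec n) : b.phi (n - 1) = b.x (n - 1) := by
  simp [phi, show n - 1 ≠ 0 by omega, show ¬n - 1 ≤ n - 2 by omega]

theorem phi_last (hn : 3 ≤ n) (b : Vec n) : b.phi n = b.x (n - 1) + b.x n := by
  simp [phi, show n ≠ 0 by omega, show ¬n ≤ n - 2 by omega, show n ≠ n - 1 by omega]

theorem node_cases (hi : i ≤ n) : i = 0 ∨ 1 ≤ i ∧ i ≤ n - 2 ∨ i = n - 1 ∨ i = n := by omega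

theorem eps_eRaw (hn : 3 ≤ n) (hi : i ≤ n) (c : ℤ) (b : Vec n) :
    (b.eRaw i c).eps i = b.eps i - c := by
  rcases node_cases hi with rfl | ⟨h1, h2⟩ | rfl | rfl
  · rw [eps_zero, eps_zero, eRaw_zero]
    simp (disch := omega) only [x_mk', xb_mk', Function.update_apply, xi]
    simp
    omega
  · rw [eps_mid _ h1 h2, eps_mid _ h1 h2, eRaw_mid _ _ h1 h2]
    simp (disch := omega) only [x_mk', xb_mk', Function.update_apply, xi]
    simp
    omega
  · rw [eps_pred hn, eps_pred hn, eRaw_pred hn]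
    simp (disch := omega) only [x_mk', xb_mk', Function.update_apply]
    simp
    omega
  · rw [eps_last hn, eps_last hn, eRaw_last hn]
    simp (disch := omega) only [xb_mk', Function.update_apply]
    simp

theorem phi_eRaw (hn : 3 ≤ n) (hi : i ≤ n) (c : ℤ) (b : Vec n) :
    (b.eRaw i c).phi i = b.phi i + c := by
  rcases node_cases hi with rfl | ⟨h1, h2⟩ | rfl | rfl
  · rw [phi_zero, phi_zero, eRaw_zero]
    simp (disch := omega) only [x_mk', xb_mk', Function.update_apply, xi]
    simp
    omega
  · rw [phi_mid _ h1 h2, phi_mid _ h1 h2, eRaw_mid _ _ h1 h2]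
    simp (disch := omega) only [x_mk', xb_mk', Function.update_apply, xi]
    simp
    omega
  · rw [phi_pred hn, phi_pred hn, eRaw_pred hn]
    simp (disch := omega) only [x_mk', Function.update_apply]
    simp
    omega
  · rw [phi_last hn, phi_last hn, eRaw_last hn]
    simp (disch := omega) only [x_mk', Function.update_apply]
    simp
    omega

theorem eRaw_neg_eRaw (hn : 3 ≤ n) (hi : i ≤ n) (c : ℤ) (b : Vec n) :
    (b.eRaw i c).eRaw i (-c) = b := by
  rcases node_cases hi with rfl | ⟨h1, h2⟩ | rfl | rfl
  · rw [eRaw_zero, eRaw_zero]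
    refine ext' (fun k k1 k2 => ?_) fun k k1 k2 => ?_ <;>
    · simp (disch := omega) only [x_mk', xb_mk', Function.update_apply, xi]
      split_ifs <;> subst_vars <;> omega
  · rw [eRaw_mid _ _ h1 h2, eRaw_mid _ _ h1 h2]
    refine ext' (fun k k1 k2 => ?_) fun k k1 k2 => ?_ <;>
    · simp (disch := omega) only [x_mk', xb_mk', Function.update_apply, xi]
      split_ifs <;> subst_vars <;> omega
  · rw [eRaw_pred hn, eRaw_pred hn]
    refine ext' (fun k k1 k2 => ?_) fun k k1 k2 => ?_ <;>
    · simp (disch := omega) only [x_mk', xb_mk', Function.update_apply]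
      try split_ifs <;> subst_vars <;> omega
  · rw [eRaw_last hn, eRaw_last hn]
    refine ext' (fun k k1 k2 => ?_) fun k k1 k2 => ?_ <;>
    · simp (disch := omega) only [x_mk', xb_mk', Function.update_apply]
      split_ifs <;> subst_vars <;> omega

/-- A weighted sum of the coordinates. -/
def wsum (w w' : ℕ → ℤ) (b : Vec n) : ℤ :=
  ∑ k ∈ Icc 1 n, w k * b.x k + ∑ k ∈ Icc 1 (n - 1), w' k * b.xb k

theorem wsum_one (b : Vec n) : b.wsum 1 1 = b.level := by simp [wsum, level]

theorem wsum_mk' (w w' f g : ℕ → ℤ) : (mk' n f g).wsum w w' =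
    ∑ k ∈ Icc 1 n, w k * f k + ∑ k ∈ Icc 1 (n - 1), w' k * g k := by
  unfold wsum
  congr 1 <;> refine Finset.sum_congr rfl fun k hk => ?_ <;> obtain ⟨h1, h2⟩ := Finset.mem_Icc.1 hk
  · rw [x_mk' _ _ h1 h2]
  · rw [xb_mk' _ _ h1 h2]

theorem sum_mul_update (w f : ℕ → ℤ) {s : Finset ℕ} (hi : i ∈ s) (a : ℤ) :
    ∑ k ∈ s, w k * update f i a k = ∑ k ∈ s, w k * f k + w i * (a - f i) := by
  rw [← Finset.add_sum_erase s _ hi, ← Finset.add_sum_erase s (fun k => w k * f k) hi,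
    Finset.sum_congr rfl fun k hk => by rw [Function.update_of_ne (Finset.ne_of_mem_erase hk)],
    Function.update_self]
  ring

theorem wsum_eRaw_zero (hn : 3 ≤ n) (w w' : ℕ → ℤ) (c : ℤ) (b : Vec n) :
    (b.eRaw 0 c).wsum w w' = b.wsum w w' - w 1 * b.xi c 2 + w 2 * (b.xi c 2 - c)
      + w' 2 * b.xi c 2 + w' 1 * (c - b.xi c 2) := by
  rw [eRaw_zero, wsum_mk', sum_mul_update _ _ (by simp; omega), sum_mul_update _ _ (by simp; omega),
    sum_mul_update _ _ (by simp; omega), sum_mul_update _ _ (by simp; omega), wsum]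
  simp
  ring

theorem wsum_eRaw_mid (w w' : ℕ → ℤ) (c : ℤ) (b : Vec n) (h1 : 1 ≤ i) (h2 : i ≤ n - 2) :
    (b.eRaw i c).wsum w w' = b.wsum w w' + w i * (c - b.xi c (i + 1))
      + w (i + 1) * (b.xi c (i + 1) - c) + (w' (i + 1) - w' i) * b.xi c (i + 1) := by
  rw [eRaw_mid _ _ h1 h2, wsum_mk', sum_mul_update _ _ (by simp; omega),
    sum_mul_update _ _ (by simp; omega), sum_mul_update _ _ (by simp; omega),
    sum_mul_update _ _ (by simp; omega), wsum]
  simp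
  ring

theorem wsum_eRaw_pred (hn : 3 ≤ n) (w w' : ℕ → ℤ) (c : ℤ) (b : Vec n) :
    (b.eRaw (n - 1) c).wsum w w' = b.wsum w w' + (w (n - 1) - w n) * c := by
  rw [eRaw_pred hn, wsum_mk', sum_mul_update _ _ (by simp; omega),
    sum_mul_update _ _ (by simp; omega), wsum, Function.update_of_ne (by omega)]
  ring

theorem wsum_eRaw_last (hn : 3 ≤ n) (w w' : ℕ → ℤ) (c : ℤ) (b : Vec n) :
    (b.eRaw n c).wsum w w' = b.wsum w w' + (w n - w' (n - 1)) * c := by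
  rw [eRaw_last hn, wsum_mk', sum_mul_update _ _ (by simp; omega),
    sum_mul_update _ _ (by simp; omega), wsum]
  ring

theorem level_eRaw (hn : 3 ≤ n) (hi : i ≤ n) (c : ℤ) (b : Vec n) :
    (b.eRaw i c).level = b.level := by
  rw [← wsum_one, ← wsum_one]
  rcases node_cases hi with rfl | ⟨h1, h2⟩ | rfl | rfl
  · rw [wsum_eRaw_zero hn]; simp
  · rw [wsum_eRaw_mid _ _ _ _ h1 h2]; simp; ring
  · rw [wsum_eRaw_pred hn]; simp
  · rw [wsum_eRaw_last hn]; simp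

/-- The height of an array: `ẽ_i^c` lowers it by `c` for `1 ≤ i ≤ n`. -/
def height (b : Vec n) : ℤ := b.wsum (fun k => k) (fun k => 2 * n - k)

theorem height_eRaw (hn : 3 ≤ n) (h0 : 1 ≤ i) (hi : i ≤ n) (c : ℤ) (b : Vec n) :
    (b.eRaw i c).height = b.height - c := by
  have e1 : ((n - 1 : ℕ) : ℤ) = n - 1 := by omega
  unfold height
  rcases node_cases hi with rfl | ⟨h1, h2⟩ | rfl | rfl
  · omega
  · rw [wsum_eRaw_mid _ _ _ _ h1 h2]; push_cast; ring
  · rw [wsum_eRaw_pred hn, e1]; ring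
  · rw [wsum_eRaw_last hn, e1]; ring

end Vec

variable {l : ℕ} {b : Vec n} {i : ℕ}

/-- All weights are nonnegative, but `x_n` may be negative; it has to be absorbed by `x_{n-1}` and
`x̄_{n-1}`. -/
theorem height_nonneg (hn : 3 ≤ n) (hb : b ∈ KKM n l) : 0 ≤ b.height := by
  obtain ⟨h1, h2, -⟩ := hb
  have e : (Icc 1 n) = insert n (Icc 1 (n - 1)) := by ext k; simp; omega
  rw [Vec.height, Vec.wsum, e, Finset.sum_insert (by simp; omega), add_assoc,
    ← Finset.sum_add_distrib]
  have h3 := Finset.single_le_sum (s := Icc 1 (n - 1))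
    (f := fun k : ℕ => (k : ℤ) * b.x k + (2 * n - k) * b.xb k) (fun k hk => by
      obtain ⟨k1, k2⟩ := Finset.mem_Icc.1 hk
      exact add_nonneg (mul_nonneg (by omega) (h1 k k1 k2).1)
        (mul_nonneg (by omega) (h1 k k1 k2).2))
    (show n - 1 ∈ Icc 1 (n - 1) by simp; omega)
  have e1 : ((n - 1 : ℕ) : ℤ) = n - 1 := by omega
  simp only [e1] at h3
  refine le_trans ?_ (add_le_add_right h3 _)
  obtain ⟨h4, h5⟩ := h1 (n - 1) (by omega) le_rfl
  have h6 : (3 : ℤ) ≤ n := by exact_mod_cast hn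
  have h7 : 0 ≤ b.x n + b.x (n - 1) := by omega
  have h8 : 0 ≤ b.x n + b.xb (n - 1) := by omega
  -- The remaining terms are `(n-1)(x_n + x_{n-1}) + (x_n + x̄_{n-1}) + n x̄_{n-1}`.
  nlinarith [mul_nonneg (show (0 : ℤ) ≤ n - 1 by omega) h7,
    mul_nonneg (show (0 : ℤ) ≤ n by omega) h5]

theorem eps_nonneg (hn : 3 ≤ n) (hb : b ∈ KKM n l) (hi : i ≤ n) : 0 ≤ b.eps i := by
  obtain ⟨h, h', -⟩ := hb
  have h3 := h (n - 1) (by omega) (by omega)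
  rcases Vec.node_cases hi with rfl | ⟨h1, h2⟩ | rfl | rfl
  · have := h 1 (by omega) (by omega); rw [Vec.eps_zero]; omega
  · have := h i (by omega) (by omega); rw [Vec.eps_mid _ h1 h2]; omega
  · rw [Vec.eps_pred hn]; omega
  · rw [Vec.eps_last hn]; omega

theorem phi_nonneg (hn : 3 ≤ n) (hb : b ∈ KKM n l) (hi : i ≤ n) : 0 ≤ b.phi i := by
  obtain ⟨h, h', -⟩ := hb
  have h3 := h (n - 1) (by omega) (by omega)
  rcases Vec.node_cases hi with rfl | ⟨h1, h2⟩ | rfl | rfl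
  · have := h 1 (by omega) (by omega); rw [Vec.phi_zero]; omega
  · have := h i (by omega) (by omega); rw [Vec.phi_mid _ h1 h2]; omega
  · rw [Vec.phi_pred hn]; omega
  · rw [Vec.phi_last hn]; omega

/-- For `i ≤ n - 2` the operator preserves `min(x_j, x̄_j)`, with `j = 2` for `i = 0` and `j = i +
1` otherwise. So that pair stays nonnegative and the lower bound on `x_n` survives, even if `j = n -
1`. The two bounds on `c` keep the other affected pair nonnegative. -/
theorem eRaw_mem_of_le (hn : 3 ≤ n) (hb : b ∈ KKM n l) (hi : i ≤ n) {c : ℤ} (hc : -b.phi i ≤ c)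
    (hc' : c ≤ b.eps i) : b.eRaw i c ∈ KKM n l := by
  obtain ⟨h, h', h''⟩ := hb
  refine ⟨fun k k1 k2 => ?_, ?_, (Vec.level_eRaw hn hi c b).trans h''⟩
  · have hk := h k k1 k2
    rcases Vec.node_cases hi with rfl | ⟨h1, h2⟩ | rfl | rfl
    · have p1 := h 1 (by omega) (by omega); have p2 := h 2 (by omega) (by omega)
      rw [Vec.phi_zero] at hc; rw [Vec.eps_zero] at hc'; rw [Vec.eRaw_zero]
      simp (disch := omega) only [Vec.x_mk', Vec.xb_mk', Function.update_apply, Vec.xi]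
      split_ifs <;> omega
    · have p1 := h i (by omega) (by omega); have p2 := h (i + 1) (by omega) (by omega)
      rw [Vec.phi_mid _ h1 h2] at hc; rw [Vec.eps_mid _ h1 h2] at hc'
      rw [Vec.eRaw_mid _ _ h1 h2]
      simp (disch := omega) only [Vec.x_mk', Vec.xb_mk', Function.update_apply, Vec.xi]
      split_ifs <;> omega
    · rw [Vec.phi_pred hn] at hc; rw [Vec.eRaw_pred hn]
      simp (disch := omega) only [Vec.x_mk', Vec.xb_mk', Function.update_apply]
      split_ifs <;> omega
    · rw [Vec.eps_last hn] at hc'; rw [Vec.eRaw_last hn]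
      simp (disch := omega) only [Vec.x_mk', Vec.xb_mk', Function.update_apply]
      split_ifs <;> omega
  · rcases Vec.node_cases hi with rfl | ⟨h1, h2⟩ | rfl | rfl
    · rw [Vec.eRaw_zero]
      simp (disch := omega) only [Vec.x_mk', Vec.xb_mk', Function.update_apply, Vec.xi]
      rcases eq_or_ne (n - 1) 2 with e | e
      · simp only [e] at h' ⊢
        split_ifs <;> omega
      · split_ifs <;> omega
    · rw [Vec.eRaw_mid _ _ h1 h2]
      simp (disch := omega) only [Vec.x_mk', Vec.xb_mk', Function.update_apply, Vec.xi]
      rcases eq_or_ne (n - 1) (i + 1) with e | e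
      · simp only [e] at h' ⊢
        split_ifs <;> omega
      · split_ifs <;> omega
    · rw [Vec.phi_pred hn] at hc; rw [Vec.eps_pred hn] at hc'; rw [Vec.eRaw_pred hn]
      simp (disch := omega) only [Vec.x_mk', Vec.xb_mk', Function.update_apply]
      split_ifs <;> omega
    · rw [Vec.phi_last hn] at hc; rw [Vec.eps_last hn] at hc'; rw [Vec.eRaw_last hn]
      simp (disch := omega) only [Vec.x_mk', Vec.xb_mk', Function.update_apply]
      split_ifs <;> omega

/-- The bounds are necessary because `ε_i` drops by `c`, `φ_i` rises by `c`, and both are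
nonnegative on `B'_l`. -/
theorem eRaw_mem_iff (hn : 3 ≤ n) (hb : b ∈ KKM n l) (hi : i ≤ n) {c : ℤ} :
    b.eRaw i c ∈ KKM n l ↔ -b.phi i ≤ c ∧ c ≤ b.eps i := by
  refine ⟨fun h => ?_, fun h => eRaw_mem_of_le hn hb hi h.1 h.2⟩
  have h1 := eps_nonneg hn h hi
  have h2 := phi_nonneg hn h hi
  rw [Vec.eps_eRaw hn hi] at h1
  rw [Vec.phi_eRaw hn hi] at h2
  omega

/-- The underlying pairs of `B'_l ⊗ B'_k`. -/
def tensor (n l k : ℕ) : Set (Vec n × Vec n) := KKM n l ×ˢ KKM n k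

variable {k : ℕ} {p q : Vec n × Vec n} {c : ℤ}

theorem eTRaw_neg_eTRaw (hn : 3 ≤ n) (hi : i ≤ n) (c : ℤ) (p : Vec n × Vec n) :
    eTRaw i (-c) (eTRaw i c p) = p := by
  have key {a a' : ℤ} (b : Vec n) (h : a' = -a) : (b.eRaw i a).eRaw i a' = b :=
    h ▸ Vec.eRaw_neg_eRaw hn hi a b
  simp only [eTRaw, Vec.phi_eRaw hn hi, Vec.eps_eRaw hn hi]
  exact Prod.ext (key _ (by omega)) (key _ (by omega))

theorem eTRaw_injective (hn : 3 ≤ n) (hi : i ≤ n) (c : ℤ) :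
    Function.Injective (eTRaw (n := n) i c) :=
  Function.LeftInverse.injective (eTRaw_neg_eTRaw hn hi c)

theorem epsT_nonneg (hn : 3 ≤ n) (hp : p ∈ tensor n l k) (hi : i ≤ n) : 0 ≤ epsT i p :=
  add_nonneg (eps_nonneg hn hp.1 hi) (le_max_left _ _)

theorem phiT_nonneg (hn : 3 ≤ n) (hp : p ∈ tensor n l k) (hi : i ≤ n) : 0 ≤ phiT i p :=
  add_nonneg (phi_nonneg hn hp.2 hi) (le_max_left _ _)

theorem eTRaw_mem_iff (hn : 3 ≤ n) (hp : p ∈ tensor n l k) (hi : i ≤ n) :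
    eTRaw i c p ∈ tensor n l k ↔ -phiT i p ≤ c ∧ c ≤ epsT i p := by
  have h1 := eps_nonneg hn hp.1 hi
  have h2 := phi_nonneg hn hp.1 hi
  have h3 := eps_nonneg hn hp.2 hi
  have h4 := phi_nonneg hn hp.2 hi
  rw [tensor, eTRaw, Set.mem_prod, eRaw_mem_iff hn hp.1 hi, eRaw_mem_iff hn hp.2 hi, phiT, epsT]
  omega

end DCrystal

/-! ### Connectedness of `B'_l ⊗ B'_k`. -/

namespace DCrystal

open Finset (Icc)
open Function (update)

variable {n : ℕ}

namespace Vec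

/-- The array whose only entries are `x_1 = a`, `x̄_1 = a'`. -/
def line (n : ℕ) (a a' : ℤ) : Vec n :=
  mk' n (fun k => if k = 1 then a else 0) (fun k => if k = 1 then a' else 0)

/-- The array whose only entries are `x_1 = a`, `x_j = d` (added up if `j = 1`). -/
def row (n : ℕ) (a d : ℤ) (j : ℕ) : Vec n :=
  mk' n (fun k => (if k = 1 then a else 0) + if k = j then d else 0) (fun _ => 0)

/-- The array whose only entries are `x_1 = a`, `x̄_j = d`. -/
def rowBar (n : ℕ) (a d : ℤ) (j : ℕ) : Vec n :=
  mk' n (fun k => if k = 1 then a else 0) (fun k => if k = j then d else 0)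

/-- The array whose only entries are `x_1 = a`, `x_2 = a₂`, `x̄_1 = a'`. -/
def hook (n : ℕ) (a a₂ a' : ℤ) : Vec n :=
  mk' n (fun k => if k = 1 then a else if k = 2 then a₂ else 0) (fun k => if k = 1 then a' else 0)

variable {a a' d a₂ : ℤ} {j : ℕ}

theorem x_line {k : ℕ} (h1 : 1 ≤ k) (h2 : k ≤ n) :
    (line n a a').x k = if k = 1 then a else 0 := x_mk' _ _ h1 h2

theorem xb_line {k : ℕ} (h1 : 1 ≤ k) (h2 : k ≤ n - 1) :
    (line n a a').xb k = if k = 1 then a' else 0 := xb_mk' _ _ h1 h2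

theorem x_row {k : ℕ} (h1 : 1 ≤ k) (h2 : k ≤ n) :
    (row n a d j).x k = (if k = 1 then a else 0) + if k = j then d else 0 := x_mk' _ _ h1 h2

theorem xb_row {k : ℕ} (h1 : 1 ≤ k) (h2 : k ≤ n - 1) : (row n a d j).xb k = 0 :=
  xb_mk' _ _ h1 h2

theorem x_rowBar {k : ℕ} (h1 : 1 ≤ k) (h2 : k ≤ n) :
    (rowBar n a d j).x k = if k = 1 then a else 0 := x_mk' _ _ h1 h2

theorem xb_rowBar {k : ℕ} (h1 : 1 ≤ k) (h2 : k ≤ n - 1) :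
    (rowBar n a d j).xb k = if k = j then d else 0 := xb_mk' _ _ h1 h2

theorem x_hook {k : ℕ} (h1 : 1 ≤ k) (h2 : k ≤ n) :
    (hook n a a₂ a').x k = if k = 1 then a else if k = 2 then a₂ else 0 := x_mk' _ _ h1 h2

theorem xb_hook {k : ℕ} (h1 : 1 ≤ k) (h2 : k ≤ n - 1) :
    (hook n a a₂ a').xb k = if k = 1 then a' else 0 := xb_mk' _ _ h1 h2

theorem sum_ite_one (m : ℕ) (hm : 1 ≤ m) (a : ℤ) :
    ∑ k ∈ Icc 1 m, (if k = 1 then a else 0) = a := by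
  simp [hm]

theorem level_line (hn : 3 ≤ n) : (line n a a').level = a + a' := by
  have e1 : ∑ k ∈ Icc 1 n, (line n a a').x k = a := by
    refine (Finset.sum_congr rfl fun k hk => ?_).trans (sum_ite_one n (by omega) a)
    obtain ⟨h1, h2⟩ := Finset.mem_Icc.1 hk
    exact x_line h1 h2
  have e2 : ∑ k ∈ Icc 1 (n - 1), (line n a a').xb k = a' := by
    refine (Finset.sum_congr rfl fun k hk => ?_).trans (sum_ite_one (n - 1) (by omega) a')
    obtain ⟨h1, h2⟩ := Finset.mem_Icc.1 hk
    exact xb_line h1 h2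
  rw [level, e1, e2]

theorem level_hook (hn : 3 ≤ n) : (hook n a a₂ a').level = a + a₂ + a' := by
  have e1 : ∑ k ∈ Icc 1 n, (hook n a a₂ a').x k = a + a₂ := by
    have : ∑ k ∈ Icc 1 n, ((if k = 1 then a else 0) + if k = 2 then a₂ else 0) = a + a₂ := by
      rw [Finset.sum_add_distrib, sum_ite_one n (by omega)]
      simp [show 2 ≤ n by omega]
    rw [← this]
    refine Finset.sum_congr rfl fun k hk => ?_
    obtain ⟨h1, h2⟩ := Finset.mem_Icc.1 hk
    rw [x_hook h1 h2]
    split_ifs <;> omega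
  have e2 : ∑ k ∈ Icc 1 (n - 1), (hook n a a₂ a').xb k = a' := by
    refine (Finset.sum_congr rfl fun k hk => ?_).trans (sum_ite_one (n - 1) (by omega) a')
    obtain ⟨h1, h2⟩ := Finset.mem_Icc.1 hk
    exact xb_hook h1 h2
  rw [level, e1, e2]

end Vec

open Vec

variable {l k : ℕ} {b : Vec n} {p q : Vec n × Vec n} {i : ℕ} {c : ℤ}

theorem line_mem (hn : 3 ≤ n) (l : ℕ) : line n l 0 ∈ KKM n l := by
  refine ⟨fun k k1 k2 => ?_, ?_, by simp [level_line hn]⟩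
  · rw [x_line k1 (by omega), xb_line k1 k2]
    split_ifs <;> simp
  · rw [x_line (by omega) (by omega), xb_line (by omega) (by omega), x_line (by omega) le_rfl]
    split_ifs <;> omega

/-- The arrow `p → ẽ_i^c(p)` in the crystal `B'_l ⊗ B'_k`. -/
def Step (n l k : ℕ) (p q : Vec n × Vec n) : Prop :=
  p ∈ tensor n l k ∧ q ∈ tensor n l k ∧ ∃ i ≤ n, ∃ c, eTRaw i c p = q

/-- The existence of a directed path in the crystal graph of `B'_l ⊗ B'_k`. -/
def Reach (n l k : ℕ) : Vec n × Vec n → Vec n × Vec n → Prop := Relation.ReflTransGen (Step n l k)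

theorem Reach.trans {r : Vec n × Vec n} (h : Reach n l k p q) (h' : Reach n l k q r) :
    Reach n l k p r :=
  Relation.ReflTransGen.trans h h'

theorem Reach.mem (h : Reach n l k p q) (hp : p ∈ tensor n l k) : q ∈ tensor n l k := by
  induction h with
  | refl => exact hp
  | tail _ h _ => exact h.2.1

theorem reach_eTRaw (hn : 3 ≤ n) (hp : p ∈ tensor n l k) (hi : i ≤ n) (hc : -phiT i p ≤ c)
    (hc' : c ≤ epsT i p) (h : eTRaw i c p = q) : Reach n l k p q :=
  .single ⟨hp, h ▸ (eTRaw_mem_iff hn hp hi).2 ⟨hc, hc'⟩, i, hi, c, h⟩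

/-- The sources of the arrows `ẽ_i`, `1 ≤ i ≤ n`, are all arrays except these. -/
theorem eq_of_epsT_nonpos (hn : 3 ≤ n) (hp : p ∈ tensor n l k)
    (h : ∀ i, 1 ≤ i → i ≤ n → epsT i p ≤ 0) :
    ∃ a a₂ a' : ℤ, 0 ≤ a ∧ 0 ≤ a₂ ∧ 0 ≤ a' ∧ a₂ + a' ≤ l ∧ a + a₂ + a' = k ∧
      p = (line n l 0, hook n a a₂ a') := by
  obtain ⟨x, y⟩ := p
  obtain ⟨⟨hx, hx', hxl⟩, ⟨hy, hy', hyl⟩⟩ := id hp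
  simp only at hx hx' hxl hy hy' hyl
  have hε {i} (h1 : 1 ≤ i) (hi : i ≤ n) : x.eps i = 0 ∧ y.eps i ≤ x.phi i := by
    have e1 := h i h1 hi
    have e2 := eps_nonneg hn hp.1 hi
    simp only [epsT] at e1 e2
    omega
  have e1 := hε (i := n - 1) (by omega) (by omega)
  have e2 := hε (i := n) (by omega) le_rfl
  rw [eps_pred hn, eps_pred hn, phi_pred hn] at e1
  rw [eps_last hn, eps_last hn, phi_last hn] at e2
  -- Vanishing of all `ε_i(x)` with `i ≥ 1` leaves only `x_1` in the first factor. Then `φ_i(x) = 0`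
  -- for `i ≥ 2` forces `ε_i(y) = 0`, which leaves `y_1`, `y_2` and `ȳ_1`. Node `1` gives the bound
  -- by `l`.
  have hxb {i} (h1 : 1 ≤ i) (hi : i ≤ n - 1) : x.xb i = 0 := by
    have := hx i h1 hi
    rcases eq_or_ne i (n - 1) with rfl | hne
    · exact e2.1
    · have := (hε h1 (by omega)).1
      rw [eps_mid _ h1 (by omega)] at this
      omega
  have hxk {i} (h1 : 2 ≤ i) (hi : i ≤ n) : x.x i = 0 := by
    rcases eq_or_ne i n with rfl | hne
    · omega
    · have h3 := (hε (i := i - 1) (by omega) (by omega)).1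
      rw [eps_mid _ (by omega) (by omega), Nat.sub_add_cancel (by omega),
        hxb (i := i) (by omega) (by omega), hxb (i := i - 1) (by omega) (by omega)] at h3
      have := (hx i (by omega) (by omega)).1
      omega
  have hφ {i} (h1 : 2 ≤ i) (hi : i ≤ n - 2) : x.phi i = 0 := by
    rw [phi_mid _ (by omega) hi, hxk h1 (by omega), hxk (i := i + 1) (by omega) (by omega),
      hxb (i := i + 1) (by omega) (by omega)]
    simp
  have z1 := hxk (i := n - 1) (by omega) (by omega)
  have z2 := hxk (i := n) (by omega) (by omega)
  have z3 := hy (n - 1) (by omega) (by omega)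
  have hyb {i} (h1 : 2 ≤ i) (hi : i ≤ n - 1) : y.xb i = 0 := by
    have := hy i (by omega) hi
    rcases eq_or_ne i (n - 1) with rfl | hne
    · omega
    · have h3 := (hε (i := i) (by omega) (by omega)).2
      rw [hφ h1 (by omega), eps_mid _ (by omega) (by omega)] at h3
      omega
  have hyk {i} (h1 : 3 ≤ i) (hi : i ≤ n) : y.x i = 0 := by
    rcases eq_or_ne i n with rfl | hne
    · omega
    · have h3 := (hε (i := i - 1) (by omega) (by omega)).2
      rw [hφ (by omega) (by omega), eps_mid _ (by omega) (by omega),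
        Nat.sub_add_cancel (by omega), hyb (i := i) (by omega) (by omega),
        hyb (i := i - 1) (by omega) (by omega)] at h3
      have := (hy i (by omega) (by omega)).1
      omega
  have ex : x = line n (x.x 1) 0 := by
    refine ext' (fun k k1 k2 => ?_) fun k k1 k2 => ?_
    · rw [x_line k1 k2]
      split_ifs with h
      · rw [h]
      · exact hxk (by omega) k2
    · rw [xb_line k1 k2, hxb k1 k2]
      simp
  have ey : y = hook n (y.x 1) (y.x 2) (y.xb 1) := by
    refine ext' (fun k k1 k2 => ?_) fun k k1 k2 => ?_
    · rw [x_hook k1 k2]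
      split_ifs with h h'
      · rw [h]
      · rw [h']
      · exact hyk (by omega) k2
    · rw [xb_hook k1 k2]
      split_ifs with h
      · rw [h]
      · exact hyb (by omega) k2
  have hl1 : x.x 1 = l := by
    rw [ex, level_line hn] at hxl
    omega
  rw [hl1] at ex
  refine ⟨y.x 1, y.x 2, y.xb 1, (hy 1 le_rfl (by omega)).1, (hy 2 (by omega) (by omega)).1,
    (hy 1 le_rfl (by omega)).2, ?_, ?_, Prod.ext ex ey⟩
  · have h3 := (hε (i := 1) le_rfl (by omega)).2
    rw [eps_mid _ le_rfl (by omega), phi_mid _ le_rfl (by omega), hl1, hxk le_rfl (by omega),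
      hxb (by omega) (by omega), hyb (i := 1 + 1) (by omega) (by omega)] at h3
    have := (hy 2 (by omega) (by omega)).1
    simp only [Nat.reduceAdd] at h3
    omega
  · rw [ey, level_hook hn] at hyl
    exact hyl

theorem height_eTRaw (hn : 3 ≤ n) (h0 : 1 ≤ i) (hi : i ≤ n) (c : ℤ) (p : Vec n × Vec n) :
    (eTRaw i c p).1.height + (eTRaw i c p).2.height = p.1.height + p.2.height - c := by
  simp only [eTRaw, height_eRaw hn h0 hi]
  omega

/-- Applying `ẽ_i^1` with `1 ≤ i ≤ n` lowers the total height, which is nonnegative, so the process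
stops, and `eq_of_epsT_nonpos` describes where. -/
theorem exists_reach_hook (hn : 3 ≤ n) (hp : p ∈ tensor n l k) :
    ∃ a a₂ a' : ℤ, 0 ≤ a ∧ 0 ≤ a₂ ∧ 0 ≤ a' ∧ a₂ + a' ≤ l ∧ a + a₂ + a' = k ∧
      Reach n l k p (line n l 0, hook n a a₂ a') := by
  induction hN : (p.1.height + p.2.height).toNat using Nat.strong_induction_on generalizing p with
  | _ N ih =>
  by_cases h : ∀ i, 1 ≤ i → i ≤ n → epsT i p ≤ 0
  · obtain ⟨a, a₂, a', h1, h2, h3, h4, h5, h6⟩ := eq_of_epsT_nonpos hn hp h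
    exact ⟨a, a₂, a', h1, h2, h3, h4, h5, h6 ▸ .refl⟩
  · push Not at h
    obtain ⟨i, h1, hi, hε⟩ := h
    have hφ := phiT_nonneg hn hp hi
    have hs : Reach n l k p (eTRaw i 1 p) := reach_eTRaw hn hp hi (by omega) (by omega) rfl
    have hq := hs.mem hp
    have e1 := height_eTRaw hn h1 hi 1 p
    have e2 := height_nonneg hn hq.1
    have e3 := height_nonneg hn hq.2
    obtain ⟨a, a₂, a', h1, h2, h3, h4, h5, h6⟩ := ih _ (by omega) hq rfl
    exact ⟨a, a₂, a', h1, h2, h3, h4, h5, hs.trans h6⟩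

/-- If `ε_i(y) = 0`, then `f̃_i^max` of `x ⊗ y` is `f̃_i^max(x) ⊗ f̃_i^max(y)`. -/
theorem reach_max (hn : 3 ≤ n) (hi : i ≤ n) {x y x' y' : Vec n} (h : (x, y) ∈ tensor n l k)
    (hy : y.eps i = 0) (ex : x.eRaw i (-x.phi i) = x') (ey : y.eRaw i (-y.phi i) = y') :
    Reach n l k (x, y) (x', y') := by
  have h1 := phi_nonneg hn h.1 hi
  have h2 := phi_nonneg hn h.2 hi
  have h3 := eps_nonneg hn h.1 hi
  simp only at h1 h2 h3
  refine reach_eTRaw hn h hi (c := -phiT i (x, y)) le_rfl ?_ ?_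
  · have := phiT_nonneg hn h hi
    have := epsT_nonneg hn h hi
    omega
  · rw [← ex, ← ey]
    simp only [eTRaw, phiT, hy]
    congr 2 <;> omega

section rows

variable {a d : ℤ} {j : ℕ}

/-- The maximal lowering at node `j` carries the amount `d` from `x_j` to `x_{j+1}`. This lemma and
the next three lead `d` once around the loop `x_2, …, x_n, x̄_{n-1}, …, x̄_2` and back into `x_1`
through node `0`. -/
theorem eRaw_row (hn : 3 ≤ n) (hd : 0 ≤ d) (h2 : 2 ≤ j) (hj : j ≤ n - 1) :
    (row n a d j).eps j = 0 ∧
      (row n a d j).eRaw j (-(row n a d j).phi j) = row n a d (j + 1) := by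
  rcases eq_or_ne j (n - 1) with rfl | hne
  · have hφ : (row n a d (n - 1)).phi (n - 1) = d := by
      rw [phi_pred hn, x_row (by omega) (by omega)]
      simp
      omega
    rw [hφ]
    constructor
    · rw [eps_pred hn, x_row (by omega) le_rfl, xb_row (by omega) le_rfl]
      split_ifs <;> omega
    · rw [eRaw_pred hn]
      refine ext' (fun k k1 k2 => ?_) fun k k1 k2 => ?_ <;>
      · simp (disch := omega) only [x_mk', xb_mk', Function.update_apply, x_row, xb_row]
        try split_ifs <;> omega
  · have hφ : (row n a d j).phi j = d := by
      rw [phi_mid _ (by omega) (by omega)]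
      simp (disch := omega) only [x_row, xb_row]
      split_ifs <;> omega
    rw [hφ]
    constructor
    · rw [eps_mid _ (by omega) (by omega)]
      simp (disch := omega) only [x_row, xb_row]
      split_ifs <;> omega
    · rw [eRaw_mid _ _ (by omega) (by omega)]
      refine ext' (fun k k1 k2 => ?_) fun k k1 k2 => ?_ <;>
      · simp (disch := omega) only [x_mk', xb_mk', Function.update_apply, xi, x_row, xb_row]
        split_ifs <;> omega

theorem eRaw_row_last (hn : 3 ≤ n) : (row n a d n).eps n = 0 ∧
    (row n a d n).eRaw n (-(row n a d n).phi n) = rowBar n a d (n - 1) := by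
  have hφ : (row n a d n).phi n = d := by
    rw [phi_last hn, x_row (by omega) (by omega), x_row (by omega) le_rfl]
    split_ifs <;> omega
  rw [hφ]
  constructor
  · rw [eps_last hn, xb_row (by omega) le_rfl]
  · rw [eRaw_last hn]
    refine ext' (fun k k1 k2 => ?_) fun k k1 k2 => ?_ <;>
    · simp (disch := omega) only [x_mk', xb_mk', Function.update_apply, x_row, xb_row, x_rowBar,
        xb_rowBar]
      split_ifs <;> omega

theorem eRaw_rowBar (hd : 0 ≤ d) (h2 : 2 ≤ j) (hj : j ≤ n - 2) :
    (rowBar n a d (j + 1)).eps j = 0 ∧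
      (rowBar n a d (j + 1)).eRaw j (-(rowBar n a d (j + 1)).phi j) = rowBar n a d j := by
  have hφ : (rowBar n a d (j + 1)).phi j = d := by
    rw [phi_mid _ (by omega) (by omega)]
    simp (disch := omega) only [x_rowBar, xb_rowBar]
    split_ifs <;> omega
  rw [hφ]
  constructor
  · rw [eps_mid _ (by omega) (by omega)]
    simp (disch := omega) only [x_rowBar, xb_rowBar]
    split_ifs <;> omega
  · rw [eRaw_mid _ _ (by omega) (by omega)]
    refine ext' (fun k k1 k2 => ?_) fun k k1 k2 => ?_ <;>
    · simp (disch := omega) only [x_mk', xb_mk', Function.update_apply, xi, x_rowBar, xb_rowBar]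
      split_ifs <;> omega

/-- Since `ε_0` counts `x_1`, the array whose `ε_0` must vanish has `x_1 = 0`; this is why the
second factor is emptied of `x_1` before the loop starts. -/
theorem eRaw_rowBar_two (hn : 3 ≤ n) (hd : 0 ≤ d) :
    (rowBar n 0 d 2).eps 0 = 0 ∧
      (rowBar n a d 2).eRaw 0 (-(rowBar n a d 2).phi 0) = line n (a + d) 0 := by
  have hφ : (rowBar n a d 2).phi 0 = d := by
    rw [phi_zero]
    simp (disch := omega) only [x_rowBar, xb_rowBar]
    simp
    omega
  rw [hφ]
  constructor
  · rw [eps_zero]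
    simp (disch := omega) only [x_rowBar, xb_rowBar]
    simp
    omega
  · rw [eRaw_zero]
    refine ext' (fun k k1 k2 => ?_) fun k k1 k2 => ?_ <;>
    · simp (disch := omega) only [x_mk', xb_mk', Function.update_apply, xi, x_rowBar, xb_rowBar,
        x_line, xb_line]
      split_ifs <;> omega

end rows

theorem reach_row (hn : 3 ≤ n) {a d d' : ℤ} (hd : 0 ≤ d) (hd' : 0 ≤ d')
    (h : (row n a d 2, row n 0 d' 2) ∈ tensor n l k) {j : ℕ} (h2 : 2 ≤ j) (hj : j ≤ n) :
    Reach n l k (row n a d 2, row n 0 d' 2) (row n a d j, row n 0 d' j) := by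
  induction j, h2 using Nat.le_induction with
  | base => exact .refl
  | succ j h2 ih =>
    have ih := ih (by omega)
    exact ih.trans (reach_max hn (by omega) (ih.mem h)
      (eRaw_row hn hd' h2 (by omega)).1 (eRaw_row hn hd h2 (by omega)).2
      (eRaw_row hn hd' h2 (by omega)).2)

theorem reach_rowBar (hn : 3 ≤ n) {a d d' : ℤ} (hd : 0 ≤ d) (hd' : 0 ≤ d')
    (h : (rowBar n a d (n - 1), rowBar n 0 d' (n - 1)) ∈ tensor n l k) {j : ℕ} (h2 : 2 ≤ j)
    (hj : j ≤ n - 1) : Reach n l k (rowBar n a d (n - 1), rowBar n 0 d' (n - 1))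
      (rowBar n a d j, rowBar n 0 d' j) := by
  induction hj using Nat.decreasingInduction with
  | self => exact .refl
  | of_succ j hj ih =>
    have ih := ih (by omega)
    exact ih.trans (reach_max hn (by omega) (ih.mem h)
      (eRaw_rowBar hd' h2 (by omega)).1 (eRaw_rowBar hd h2 (by omega)).2
      (eRaw_rowBar hd' h2 (by omega)).2)

/-- Both factors travel around the loop together: at every step the relevant `ε_i` of the second
factor is zero, so `reach_max` applies. The amount `a` in `x_1` of the first factor stays put. -/
theorem reach_line_of_row (hn : 3 ≤ n) {a d : ℤ} (hd : 0 ≤ d) (had : a + d = l)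
    (h : (row n a d 2, row n 0 k 2) ∈ tensor n l k) :
    Reach n l k (row n a d 2, row n 0 k 2) (line n l 0, line n k 0) := by
  have hk : (0 : ℤ) ≤ k := by omega
  have h1 := reach_row hn hd hk h (show 2 ≤ n by omega) le_rfl
  have h2 := h1.trans (reach_max hn le_rfl (h1.mem h) (eRaw_row_last hn).1 (eRaw_row_last hn).2
    (eRaw_row_last hn).2)
  have h3 := h2.trans (reach_rowBar hn hd hk (h2.mem h) le_rfl (by omega))
  refine h3.trans (reach_max hn (Nat.zero_le n) (h3.mem h) (eRaw_rowBar_two (a := 0) hn hk).1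
    (had ▸ (eRaw_rowBar_two hn hd).2) ?_)
  rw [(eRaw_rowBar_two hn hk).2, zero_add]

theorem reach_line_of_hook (hn : 3 ≤ n) {a a₂ a' : ℤ} (h0 : 0 ≤ a) (h1 : 0 ≤ a₂) (h2 : 0 ≤ a')
    (h3 : a₂ + a' ≤ l) (h4 : a + a₂ + a' = k) (h : (line n l 0, hook n a a₂ a') ∈ tensor n l k) :
    Reach n l k (line n l 0, hook n a a₂ a') (line n l 0, line n k 0) := by
  -- The maximal lowering at node `0` acts on the second factor only and moves `a'` from `x̄_1` to
  -- `x_2`.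
  have s1 : Reach n l k (line n l 0, hook n a a₂ a') (line n l 0, hook n a (a₂ + a') 0) := by
    have e1 : (line n l 0).phi 0 = 0 := by
      rw [phi_zero]; simp (disch := omega) only [x_line, xb_line]; simp
    have e2 : (hook n a a₂ a').eps 0 = a + a₂ := by
      rw [eps_zero]; simp (disch := omega) only [x_hook, xb_hook]; simp; omega
    have e3 : (hook n a a₂ a').phi 0 = a' := by
      rw [phi_zero]; simp (disch := omega) only [x_hook, xb_hook]; simp; omega
    refine reach_eTRaw hn h (Nat.zero_le n) (c := -a') ?_ ?_ ?_
    · rw [phiT, e1, e2, e3]; omega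
    · have := epsT_nonneg hn h (Nat.zero_le n); omega
    · rw [eTRaw, e1, e2, eRaw_zero, eRaw_zero]
      refine Prod.ext (ext' (fun k k1 k2 => ?_) fun k k1 k2 => ?_)
        (ext' (fun k k1 k2 => ?_) fun k k1 k2 => ?_) <;>
      · simp (disch := omega) only [x_mk', xb_mk', Function.update_apply, xi, x_line, xb_line,
          x_hook, xb_hook]
        split_ifs <;> omega
  have hm := s1.mem h
  -- The maximal lowering at node `1` empties `x_1` of the second factor into `x_2`. In the first
  -- factor `a₂ + a'` remains in `x_1`, blocked by `ε_1` of the second factor.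
  have s2 : Reach n l k (line n l 0, hook n a (a₂ + a') 0)
      (row n (a₂ + a') (l - (a₂ + a')) 2, row n 0 k 2) := by
    have e1 : (line n l 0).phi 1 = l := by
      rw [phi_mid _ le_rfl (by omega)]; simp (disch := omega) only [x_line, xb_line]; simp
    have e2 : (hook n a (a₂ + a') 0).eps 1 = a₂ + a' := by
      rw [eps_mid _ le_rfl (by omega)]; simp (disch := omega) only [x_hook, xb_hook]; simp; omega
    have e3 : (hook n a (a₂ + a') 0).phi 1 = a := by
      rw [phi_mid _ le_rfl (by omega)]; simp (disch := omega) only [x_hook, xb_hook]; simp; omega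
    refine reach_eTRaw hn hm (i := 1) (by omega) (c := -(a + l - (a₂ + a'))) ?_ ?_ ?_
    · rw [phiT, e1, e2, e3]; omega
    · have := epsT_nonneg hn hm (i := 1) (by omega); omega
    · rw [eTRaw, e1, e2, eRaw_mid _ _ le_rfl (by omega), eRaw_mid _ _ le_rfl (by omega)]
      refine Prod.ext (ext' (fun k k1 k2 => ?_) fun k k1 k2 => ?_)
        (ext' (fun k k1 k2 => ?_) fun k k1 k2 => ?_) <;>
      · simp (disch := omega) only [x_mk', xb_mk', Function.update_apply, xi, x_line, xb_line,
          x_hook, xb_hook, x_row, xb_row]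
        split_ifs <;> omega
  exact (s1.trans s2).trans
    (reach_line_of_row hn (by omega) (by omega) (s2.mem hm))

/-- The crystal `B'_l ⊗ B'_k` is connected. -/
theorem reach_line (hn : 3 ≤ n) (hp : p ∈ tensor n l k) :
    Reach n l k p (line n l 0, line n k 0) := by
  obtain ⟨a, a₂, a', h1, h2, h3, h4, h5, h6⟩ := exists_reach_hook hn hp
  exact h6.trans (reach_line_of_hook hn h1 h2 h3 h4 h5 (h6.mem hp))

/-- Induction along paths in the crystal graph. -/
theorem tensor_induction (hn : 3 ≤ n) {P : Vec n × Vec n → Prop}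
    (base : P (line n l 0, line n k 0))
    (step : ∀ p ∈ tensor n l k, ∀ i ≤ n, ∀ c, eTRaw i c p ∈ tensor n l k → P (eTRaw i c p) → P p)
    (hp : p ∈ tensor n l k) : P p := by
  have h := reach_line hn hp
  clear hp
  induction h using Relation.ReflTransGen.head_induction_on with
  | refl => exact base
  | head h _ ih =>
    obtain ⟨h1, h2, i, hi, c, rfl⟩ := h
    exact step _ h1 i hi c h2 ih

end DCrystal

/-! ### The base element, and existence and uniqueness of the combinatorial `R`. -/

namespace DCrystal

open Finset (Icc)
open Function (update)

variable {n : ℕ}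

open Vec

section line

variable {a a' b b' : ℤ} {i j m : ℕ}

theorem sum_xb_line (hm : 1 ≤ m) (hi : i ≤ n - 1) :
    ∑ k ∈ Icc m i, ((line n b b').xb k - (line n a a').xb k) =
      if m = 1 ∧ 1 ≤ i then b' - a' else 0 := by
  have : ∑ k ∈ Icc m i, ((line n b b').xb k - (line n a a').xb k) =
      ∑ k ∈ Icc m i, if k = 1 then b' - a' else 0 := by
    refine Finset.sum_congr rfl fun k hk => ?_
    obtain ⟨h1, h2⟩ := Finset.mem_Icc.1 hk
    rw [xb_line (by omega) (by omega), xb_line (by omega) (by omega)]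
    split_ifs <;> simp
  rw [this, Finset.sum_ite_eq']
  simp only [Finset.mem_Icc]
  split_ifs <;> omega

theorem sum_x_line (hi : 1 ≤ i) (hi' : i ≤ n) :
    ∑ k ∈ Icc 1 i, ((line n b b').x k - (line n a a').x k) = b - a := by
  rw [← sum_ite_one i hi (b - a)]
  refine Finset.sum_congr rfl fun k hk => ?_
  obtain ⟨h1, h2⟩ := Finset.mem_Icc.1 hk
  rw [x_line (by omega) (by omega), x_line (by omega) (by omega)]
  split_ifs <;> simp

theorem theta_line (hn : 3 ≤ n) (hi : i ≤ n - 1) (hj : 1 ≤ j) (hj' : j ≤ n - 2) :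
    theta i j (line n a a', line n b b') =
      if j ≤ i then a + a' else if i = 0 then b + a' else b + b' := by
  simp (disch := omega) only [theta, level_line hn, sum_xb_line]
  split_ifs <;> omega

theorem theta'_line (hn : 3 ≤ n) (hi : i ≤ n - 1) (hj : 1 ≤ j) (hj' : j ≤ n - 2) :
    theta' i j (line n a a', line n b b') = if i = 0 then b + a' else b + b' := by
  simp (disch := omega) only [theta', level_line hn, sum_xb_line, sum_x_line, true_and]
  split_ifs <;> omega

theorem eta_line (hn : 3 ≤ n) (hi : i ≤ n - 1) (hj : 1 ≤ j) (hj' : j ≤ n) :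
    eta i j (line n a a', line n b b') =
      if j = 1 then (if i = 0 then b + a' + b' - a else a' + b')
      else if j ≤ i then a + a' else if i = 0 then b + a' else b + b' := by
  unfold eta
  simp only [level_line hn]
  split_ifs <;> simp (disch := omega) only [sum_xb_line, x_line, xb_line] <;> split_ifs <;> omega

theorem eta'_line (hn : 3 ≤ n) (hi : i ≤ n - 1) (hj : 1 ≤ j) (hj' : j ≤ n) :
    eta' i j (line n a a', line n b b') =
      if j = 1 then (if i = 0 then b + a' + a - b' else a + b)
      else if i = 0 then b + a' else if j = n ∧ i = n - 1 then a + a' else b + b' := by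
  unfold eta'
  simp only [level_line hn]
  split_ifs <;> simp (disch := omega) only [sum_xb_line, sum_x_line, x_line, xb_line, true_and] <;>
    split_ifs <;> omega

/-- The maximum is attained among the terms with `j = 1`: for `i = 0` by the two `η`, for `i ≥ 1` by
one of the four. -/
theorem V_line (hn : 3 ≤ n) (hi : i ≤ n - 1) : V i (line n a a', line n b b') =
    if i = 0 then b + a' + max (a - b') (b' - a)
    else max (max (a + a') (b + b')) (max (a + b) (a' + b')) := by
  have hne : (VSet i (line n a a', line n b b')).Nonempty :=
    ⟨_, Finset.mem_union_right _ (Finset.mem_image_of_mem _ (Finset.mem_Icc.2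
      ⟨le_rfl, show 1 ≤ n by omega⟩))⟩
  rw [V, dif_pos hne]
  have hθ : theta i 1 (line n a a', line n b b') ∈ VSet i (line n a a', line n b b') :=
    Finset.mem_union_left _ (Finset.mem_union_left _ (Finset.mem_union_left _
      (Finset.mem_image_of_mem _ (Finset.mem_Icc.2 ⟨le_rfl, show 1 ≤ n - 2 by omega⟩))))
  have hθ' : theta' i 1 (line n a a', line n b b') ∈ VSet i (line n a a', line n b b') :=
    Finset.mem_union_left _ (Finset.mem_union_left _ (Finset.mem_union_right _
      (Finset.mem_image_of_mem _ (Finset.mem_Icc.2 ⟨le_rfl, show 1 ≤ n - 2 by omega⟩))))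
  have hη : eta i 1 (line n a a', line n b b') ∈ VSet i (line n a a', line n b b') :=
    Finset.mem_union_left _ (Finset.mem_union_right _
      (Finset.mem_image_of_mem _ (Finset.mem_Icc.2 ⟨le_rfl, show 1 ≤ n by omega⟩)))
  have hη' : eta' i 1 (line n a a', line n b b') ∈ VSet i (line n a a', line n b b') :=
    Finset.mem_union_right _
      (Finset.mem_image_of_mem _ (Finset.mem_Icc.2 ⟨le_rfl, show 1 ≤ n by omega⟩))
  apply le_antisymm
  · refine Finset.max'_le _ _ _ fun y hy => ?_
    simp only [VSet, Finset.mem_union, Finset.mem_image, Finset.mem_Icc] at hy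
    rcases hy with ((⟨j, ⟨h1, h2⟩, rfl⟩ | ⟨j, ⟨h1, h2⟩, rfl⟩) | ⟨j, ⟨h1, h2⟩, rfl⟩) |
      ⟨j, ⟨h1, h2⟩, rfl⟩
    · rw [theta_line hn hi h1 h2]; split_ifs <;> omega
    · rw [theta'_line hn hi h1 h2]; split_ifs <;> omega
    · rw [eta_line hn hi h1 h2]; split_ifs <;> omega
    · rw [eta'_line hn hi h1 h2]; split_ifs <;> omega
  · generalize hM : (VSet i (line n a a', line n b b')).max' hne = M
    have hle {y} (hy : y ∈ VSet i (line n a a', line n b b')) : y ≤ M :=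
      hM ▸ Finset.le_max' _ _ hy
    have h1 := hle hθ
    have h2 := hle hθ'
    have h3 := hle hη
    have h4 := hle hη'
    rw [theta_line hn hi le_rfl (by omega)] at h1
    rw [theta'_line hn hi le_rfl (by omega)] at h2
    rw [eta_line hn hi le_rfl (by omega)] at h3
    rw [eta'_line hn hi le_rfl (by omega)] at h4
    clear hle hM hθ hθ' hη hη'
    split_ifs at * <;> omega

theorem star_line (hn : 3 ≤ n) :
    star (line n a a', line n b b') = (line n b' b, line n a' a) := by
  refine Prod.ext (ext' (fun k k1 k2 => ?_) fun k k1 k2 => ?_)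
    (ext' (fun k k1 k2 => ?_) fun k k1 k2 => ?_)
  · rw [star, x_mk' _ _ k1 k2, x_line k1 k2, Function.update_apply]
    split_ifs with h h' <;> simp (disch := omega) only [xb_line, x_line] <;> split_ifs <;> omega
  · rw [star, xb_mk' _ _ k1 k2, xb_line k1 k2, x_line k1 (by omega)]
  · rw [star, x_mk' _ _ k1 k2, x_line k1 k2, Function.update_apply]
    split_ifs with h h' <;> simp (disch := omega) only [xb_line, x_line] <;> split_ifs <;> omega
  · rw [star, xb_mk' _ _ k1 k2, xb_line k1 k2, x_line k1 (by omega)]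

theorem sigmaOne_line (hn : 3 ≤ n) :
    sigmaOne (line n a a', line n b b') = (line n a' a, line n b' b) := by
  refine Prod.ext (ext' (fun k k1 k2 => ?_) fun k k1 k2 => ?_)
    (ext' (fun k k1 k2 => ?_) fun k k1 k2 => ?_) <;>
  · simp (disch := omega) only [sigmaOne, x_mk', xb_mk', Function.update_apply, x_line, xb_line]
    split_ifs <;> omega

/-- Here all `V_i`, `V_i^*` and `V_0^{σ₁}` equal `a + b` and all `W_i` equal `2(a + b)`, so every
correction term cancels. -/
theorem piecewiseR_line (hn : 3 ≤ n) (ha : 0 ≤ a) (hb : 0 ≤ b) :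
    piecewiseR (line n a 0, line n b 0) = (line n b 0, line n a 0) := by
  have hV {i} (hi : i ≤ n - 1) : V i (line n a 0, line n b 0) = a + b := by
    rw [V_line hn hi]; split_ifs <;> omega
  have hVs {i} (hi : i ≤ n - 1) : Vstar i (line n a 0, line n b 0) = a + b := by
    rw [Vstar, star_line hn, V_line hn hi]; split_ifs <;> omega
  have hσ : VzeroSigma (line n a 0, line n b 0) = a + b := by
    rw [VzeroSigma, sigmaOne_line hn, V_line hn (by omega)]; simp; omega
  have hW {i} (h1 : 1 ≤ i) (hi : i ≤ n - 1) :
      W i (line n a 0, line n b 0) = 2 * (a + b) := by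
    simp (disch := omega) only [W, hV, hVs, hσ, x_line, xb_line]
    split_ifs <;> omega
  refine Prod.ext (ext' (fun k k1 k2 => ?_) fun k k1 k2 => ?_)
    (ext' (fun k k1 k2 => ?_) fun k k1 k2 => ?_)
  · rw [piecewiseR, x_mk' _ _ k1 k2, x_line k1 k2]
    split_ifs <;> simp (disch := omega) only [hV, hVs, hσ, hW, x_line] <;> grind
  · rw [piecewiseR, xb_mk' _ _ k1 k2, xb_line k1 k2]
    split_ifs <;> simp (disch := omega) only [hV, xb_line] <;> grind
  · rw [piecewiseR, x_mk' _ _ k1 k2, x_line k1 k2]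
    split_ifs <;> simp (disch := omega) only [hV, hVs, x_line] <;> grind
  · rw [piecewiseR, xb_mk' _ _ k1 k2, xb_line k1 k2]
    split_ifs <;> simp (disch := omega) only [hVs, hσ, hW, xb_line] <;> grind

end line

variable {l k : ℕ} {p q : Vec n × Vec n} {i : ℕ} {c : ℤ}

/-- Membership spreads from the base element against the arrows: whether an operator stays inside
the crystal depends only on `ε_i` and `φ_i` of the pair, which the map preserves. -/
theorem piecewiseR_mem (hn : 3 ≤ n) (hp : p ∈ tensor n l k) : piecewiseR p ∈ tensor n k l := by
  refine tensor_induction hn (P := fun p => piecewiseR p ∈ tensor n k l) ?_ ?_ hp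
  · rw [piecewiseR_line hn (by omega) (by omega)]
    exact ⟨line_mem hn k, line_mem hn l⟩
  · intro p hp i hi c hq h
    have e : eTRaw i (-c) (eTRaw i c p) = p := eTRaw_neg_eTRaw hn hi c p
    -- Since `p` is recovered from `ẽ_i^c(p)` by the parameter `-c`, this parameter lies in the
    -- admissible interval.
    have h1 := (eTRaw_mem_iff hn hq hi).1 (e.symm ▸ hp)
    rw [← epsT_piecewiseR hn _ hi, ← phiT_piecewiseR hn _ hi] at h1
    have h2 := (eTRaw_mem_iff hn h hi).2 h1
    rwa [← piecewiseR_eTRaw hn _ hi, e] at h2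

/-- Both sides commute with the injective operators, so the equality at the base element spreads
along paths. -/
theorem piecewiseR_piecewiseR (hn : 3 ≤ n) (hp : p ∈ tensor n l k) :
    piecewiseR (piecewiseR p) = p := by
  refine tensor_induction hn (P := fun p => piecewiseR (piecewiseR p) = p) ?_ ?_ hp
  · rw [piecewiseR_line hn (by omega) (by omega), piecewiseR_line hn (by omega) (by omega)]
  · intro p hp i hi c hq h
    rw [piecewiseR_eTRaw hn _ hi, piecewiseR_eTRaw hn _ hi] at h
    exact eTRaw_injective hn hi c h

/-- The pair of arrays underlying an element of `B'_l ⊗ B'_k`. -/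
def toPair (p : KKM n l × KKM n k) : Vec n × Vec n := (p.1.1, p.2.1)

theorem toPair_mem (p : KKM n l × KKM n k) : toPair p ∈ tensor n l k := ⟨p.1.2, p.2.2⟩

theorem toPair_injective : Function.Injective (toPair (n := n) (l := l) (k := k)) := by
  intro p q h
  exact Prod.ext (Subtype.ext (congrArg Prod.fst h)) (Subtype.ext (congrArg Prod.snd h))

/-- The element of `B'_l ⊗ B'_k` given by a pair of arrays. -/
def ofPair (p : Vec n × Vec n) (hp : p ∈ tensor n l k) : KKM n l × KKM n k :=
  (⟨p.1, hp.1⟩, ⟨p.2, hp.2⟩)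

open Classical in
theorem eTensor_eq (i : ℕ) (c : ℤ) (p : KKM n l × KKM n k) : eTensor i c p =
    if h : eTRaw i c (toPair p) ∈ tensor n l k then some (ofPair _ h) else none := by
  rw [eTensor]
  simp only [e]
  by_cases h1 : (eTRaw i c (toPair p)).1 ∈ KKM n l
  · by_cases h2 : (eTRaw i c (toPair p)).2 ∈ KKM n k
    · have h : eTRaw i c (toPair p) ∈ tensor n l k := ⟨h1, h2⟩
      rw [dif_pos h]
      exact congrArg₂ Option.bind (dif_pos h1) (funext fun _ => congrArg _ (dif_pos h2))
    · rw [dif_neg fun h : eTRaw i c (toPair p) ∈ tensor n l k => h2 h.2]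
      exact congrArg₂ Option.bind (dif_pos h1) (funext fun _ => congrArg _ (dif_neg h2))
  · rw [dif_neg fun h : eTRaw i c (toPair p) ∈ tensor n l k => h1 h.1]
    exact congrArg (fun o => Option.bind o _) (dif_neg h1)

theorem eTensor_eq_some_iff {p q : KKM n l × KKM n k} :
    eTensor i c p = some q ↔ eTRaw i c (toPair p) = toPair q := by
  rw [eTensor_eq]
  constructor
  · intro h
    split_ifs at h with h1
    rw [← Option.some_inj.1 h]
    rfl
  · intro h
    have h1 : eTRaw i c (toPair p) ∈ tensor n l k := h ▸ toPair_mem q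
    rw [dif_pos h1, Option.some_inj]
    exact toPair_injective h

theorem isSome_eTensor_iff (hn : 3 ≤ n) (hi : i ≤ n) (p : KKM n l × KKM n k) :
    (eTensor i c p).isSome ↔ -phiT i (toPair p) ≤ c ∧ c ≤ epsT i (toPair p) := by
  rw [← eTRaw_mem_iff hn (toPair_mem p) hi, eTensor_eq]
  split_ifs with h <;> simp [h]

/-- The piecewise linear map as a map between the crystals. -/
def crystalR (hn : 3 ≤ n) (p : KKM n l × KKM n k) : KKM n k × KKM n l :=
  ofPair (piecewiseR (toPair p)) (piecewiseR_mem hn (toPair_mem p))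

theorem toPair_crystalR (hn : 3 ≤ n) (p : KKM n l × KKM n k) :
    toPair (crystalR hn p) = piecewiseR (toPair p) := rfl

theorem crystalR_crystalR (hn : 3 ≤ n) (p : KKM n l × KKM n k) :
    crystalR hn (crystalR hn p) = p :=
  toPair_injective (piecewiseR_piecewiseR hn (toPair_mem p))

theorem isCombinatorialR_crystalR (hn : 3 ≤ n) :
    IsCombinatorialR (crystalR (n := n) (l := l) (k := k) hn) := by
  refine ⟨⟨Function.LeftInverse.injective (crystalR_crystalR hn),
    Function.LeftInverse.surjective (crystalR_crystalR hn)⟩,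
    fun i hi c p => ?_⟩
  rcases h : eTensor i c p with _ | q
  · have h1 := isSome_eTensor_iff (c := c) hn hi (crystalR hn p)
    rw [toPair_crystalR, epsT_piecewiseR hn _ hi, phiT_piecewiseR hn _ hi,
      ← isSome_eTensor_iff hn hi, h] at h1
    simpa using h1
  · rw [Option.map_some, eTensor_eq_some_iff, toPair_crystalR, toPair_crystalR,
      ← piecewiseR_eTRaw hn _ hi, eTensor_eq_some_iff.1 h]

section uniqueness

variable {R : KKM n l × KKM n k → KKM n k × KKM n l}

/-- The parameters `c` with nonzero `ẽ_i^c(p)` form the interval from `-φ_i` to `ε_i`, and `R`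
preserves this set. -/
theorem IsCombinatorialR.epsT_phiT (hR : IsCombinatorialR R) (hn : 3 ≤ n) (hi : i ≤ n)
    (p : KKM n l × KKM n k) : epsT i (toPair (R p)) = epsT i (toPair p) ∧
      phiT i (toPair (R p)) = phiT i (toPair p) := by
  have key (c : ℤ) : (-phiT i (toPair (R p)) ≤ c ∧ c ≤ epsT i (toPair (R p))) ↔
      -phiT i (toPair p) ≤ c ∧ c ≤ epsT i (toPair p) := by
    rw [← isSome_eTensor_iff hn hi, ← isSome_eTensor_iff hn hi, hR.2 i hi c p,
      Option.isSome_map]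
  have h1 := epsT_nonneg hn (toPair_mem p) hi
  have h2 := phiT_nonneg hn (toPair_mem p) hi
  have h3 := epsT_nonneg hn (toPair_mem (R p)) hi
  have h4 := phiT_nonneg hn (toPair_mem (R p)) hi
  have k1 := key (epsT i (toPair p))
  have k2 := key (epsT i (toPair (R p)))
  have k3 := key (-phiT i (toPair p))
  have k4 := key (-phiT i (toPair (R p)))
  omega

theorem eps_line (hn : 3 ≤ n) {a : ℤ} (h1 : 1 ≤ i) (hi : i ≤ n) : (line n a 0).eps i = 0 := by
  rcases node_cases hi with rfl | ⟨-, h2⟩ | rfl | rfl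
  · omega
  · rw [eps_mid _ h1 h2]
    simp (disch := omega) only [x_line, xb_line]
    split_ifs <;> omega
  · rw [eps_pred hn]
    simp (disch := omega) only [x_line, xb_line]
    split_ifs <;> omega
  · rw [eps_last hn]
    simp (disch := omega) only [xb_line]
    split_ifs <;> omega

theorem phi_one_line (hn : 3 ≤ n) {a : ℤ} : (line n a 0).phi 1 = a := by
  rw [phi_mid _ le_rfl (by omega)]
  simp (disch := omega) only [x_line, xb_line]
  simp

/-- The image has no positive `ε_i` with `i ≥ 1`, so it has the form in `eq_of_epsT_nonpos` with `l`
and `k` exchanged. Comparing `φ_1`, which is `l + k` before and `a + k - (a₂ + a')` after, with `a +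
a₂ + a' = l` leaves only `a = l`. -/
theorem IsCombinatorialR.line (hR : IsCombinatorialR R) (hn : 3 ≤ n)
    {p : KKM n l × KKM n k} (hp : toPair p = (line n l 0, line n k 0)) :
    toPair (R p) = (Vec.line n k 0, Vec.line n l 0) := by
  have hε {i} (h1 : 1 ≤ i) (hi : i ≤ n) : epsT i (toPair (R p)) ≤ 0 := by
    rw [(hR.epsT_phiT hn hi p).1, hp, epsT, eps_line hn h1 hi, eps_line hn h1 hi]
    have := phi_nonneg hn (line_mem hn l) hi
    simp only
    omega
  obtain ⟨a, a₂, a', h1, h2, h3, h4, h5, h6⟩ :=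
    eq_of_epsT_nonpos hn (toPair_mem (R p)) fun i h1 hi => hε h1 hi
  have e1 : (hook n a a₂ a').eps 1 = a₂ + a' := by
    rw [eps_mid _ le_rfl (by omega)]; simp (disch := omega) only [x_hook, xb_hook]; simp; omega
  have e2 : (hook n a a₂ a').phi 1 = a := by
    rw [phi_mid _ le_rfl (by omega)]; simp (disch := omega) only [x_hook, xb_hook]; simp; omega
  have h := (hR.epsT_phiT hn (i := 1) (by omega) p).2
  rw [h6, hp, phiT, phiT] at h
  simp only [e1, e2, phi_one_line hn, eps_line hn le_rfl (show 1 ≤ n by omega)] at h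
  have ha : a = l := by omega
  have ha2 : a₂ = 0 := by omega
  have ha' : a' = 0 := by omega
  rw [h6, ha, ha2, ha']
  refine Prod.ext rfl (ext' (fun k k1 k2 => ?_) fun k k1 k2 => ?_)
  · rw [x_hook k1 k2, x_line k1 k2]; split_ifs <;> rfl
  · rw [xb_hook k1 k2, xb_line k1 k2]

/-- Two maps that commute with the operators and agree at the base element agree on the whole
connected crystal. -/
theorem IsCombinatorialR.toPair_eq (hR : IsCombinatorialR R) (hn : 3 ≤ n)
    (p : KKM n l × KKM n k) : toPair (R p) = piecewiseR (toPair p) := by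
  suffices H : ∀ p ∈ tensor n l k, ∀ h : p ∈ tensor n l k,
      toPair (R (ofPair p h)) = piecewiseR p from H _ (toPair_mem p) (toPair_mem p)
  intro p hp
  -- The membership proof is quantified inside the predicate because `ofPair` takes it as an
  -- argument.
  refine tensor_induction hn (P := fun p => ∀ h : p ∈ tensor n l k,
      toPair (R (ofPair p h)) = piecewiseR p) ?_ ?_ hp
  · intro h
    rw [piecewiseR_line hn (by omega) (by omega)]
    exact hR.line hn rfl
  · intro p hp i hi c hq ih h
    have h1 : eTensor i c (ofPair p h) = some (ofPair _ hq) := eTensor_eq_some_iff.2 rfl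
    have h2 := hR.2 i hi c (ofPair p h)
    rw [h1, Option.map_some, eTensor_eq_some_iff, ih hq, piecewiseR_eTRaw hn _ hi] at h2
    exact eTRaw_injective hn hi c h2

end uniqueness

end DCrystal

theorem mainTheorem5 (n : ℕ) (hn : 3 ≤ n) (l₁ l₂ : ℕ) (hl₁ : 0 < l₁) (hl₂ : 0 < l₂) :
    ∃ R : DCrystal.KKM n l₁ × DCrystal.KKM n l₂ → DCrystal.KKM n l₂ × DCrystal.KKM n l₁,
      (∀ p : DCrystal.KKM n l₁ × DCrystal.KKM n l₂,
        ((R p).1.1, (R p).2.1) = DCrystal.piecewiseR (p.1.1, p.2.1)) ∧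
      DCrystal.IsCombinatorialR R ∧
      ∀ R' : DCrystal.KKM n l₁ × DCrystal.KKM n l₂ → DCrystal.KKM n l₂ × DCrystal.KKM n l₁,
        DCrystal.IsCombinatorialR R' → R' = R := by
  refine ⟨DCrystal.crystalR hn, fun p => rfl, DCrystal.isCombinatorialR_crystalR hn,
    fun R' hR' => funext fun p => DCrystal.toPair_injective ?_⟩
  rw [hR'.toPair_eq hn, DCrystal.toPair_crystalR]
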